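/- Let $F$ be a field of characteristic $0$, let $E$ be the (unital) infinite dimensional Grassmann algebra over $F$, that is, the exterior algebra of an $F$-vector space with a countably infinite basis, and let $R=UT_2(E)$ be the algebra of upper triangular $2\times 2$ matrices with entries in $E$. For an algebra $A$ let $T(A)$ denote the ideal of the polynomial identities of $A$ in a free associative unital algebra. The Hilbert series $H(A,t_1,\dots,t_d)=\sum_\alpha \dim_F\big(F\langle x_1,\dots,x_d\rangle/(F\langle x_1,\dots,x_d\rangle\cap T(A))\big)^{(\alpha)}\,t^{\alpha}$ is that of the relatively free algebra in $d$ variables, graded by multidegree. Let $V_n$ be the space of multilinear polynomials of degree $n$ in $x_1,\dots,x_n$, and let $\chi_n(A)$ be the character of the $S_n$-module $V_n/(V_n\cap T(A))$, where $\sigma x_i=x_{\sigma(i)}$. Let $S_\lambda$ be the Schur function of a partition $\lambda$ (the generating function of the semistandard tableaux of shape $\lambda$), and for $\lambda\vdash n$ let $\chi_\lambda$ be the irreducible character of $S_n$ attached to $\lambda$ (the character of the Specht module). There are nonnegative integers $m_\lambda$, one for each partition $\lambda$, such that for every $d\ge 0$ $$H(R,t_1,\dots,t_d)=\sum_\lambda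 m_\lambda S_\lambda(t_1,\dots,t_d),$$ such that for every $n\ge 0$ $$\chi_n(R)=\sum_{\lambda\vdash n}m_\lambda\chi_\lambda ,$$ and such that the $m_\lambda$ are as follows. If $m_\lambda\neq 0$, then $\lambda$ is empty, or $\lambda=(k,1^l)$ with $k\ge1$, or $\lambda=(k_1,k_2,2^m,1^l)$ with $k_1\ge k_2\ge 2$, or $\lambda=(k_1,k_2,3,2^m,1^l)$ with $k_1\ge k_2\ge 3$ (here $m,l\ge 0$). If $\lambda=(k_1,k_2,2^m,1^l)$, where $k_2$ may be $0$, then - $m_\lambda=12(k_1-k_2+1)(l+1)$ if $k_1\ge k_2\ge 3$ and $m\ge 1$; - $m_\lambda=4(k_1-k_2+1)(2l+1)$ if $k_1\ge k_2\ge 3$ and $m=0$; - $m_\lambda=8(k_1-2)(l+1)+4(l+1)$ if $k_1\ge k_2=2$ and $m\ge 1$; - $m_\lambda=3(k_1-2)(2l+1)+3l+2$ if $k_1\ge k_2=2$ and $m=0$; - $m_\lambda=(k_1-2)(2l-1)+l+1$ if $k_1\ge 2$, $k_2=0$, $m=0$ and $l\ge 1$, that is, $\lambda=(k_1,1^l)$;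 - $m_\lambda=1$ if $\lambda=(1^l)$ with $l\ge0$, or $\lambda=(k)$ with $k\ge 1$. If $\lambda=(k_1,k_2,3,2^m,1^l)$ with $k_1\ge k_2\ge 3$ and $m,l\ge 0$, then - $m_\lambda=4(k_1-k_2+1)(l+1)$. -/

import Mathlib

open scoped MvPowerSeries.WithPiTopology

noncomputable section

namespace PICochar

/-! ### Polynomial identities -/

/-- `T(A)` in the free associative unital algebra on the set `X` of variables: the intersection of
the kernels of all homomorphisms `F⟨X⟩ → A`. -/
def identities (F A X : Type*) [Field F] [Ring A] [Algebra F A] :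
    Submodule F (FreeAlgebra F X) :=
  ⨅ φ : FreeAlgebra F X →ₐ[F] A, LinearMap.ker φ.toLinearMap

/-- The noncommutative monomial `x_{w₁} x_{w₂} ⋯ x_{wᵣ}`. -/
def monomial (F : Type*) {X : Type*} [Field F] (w : List X) : FreeAlgebra F X :=
  (w.map (FreeAlgebra.ι F)).prod

/-! ### Hilbert series -/

/-- The multihomogeneous component of multidegree `α` of `F⟨x₁, …, x_d⟩`: the span of the monomials
in which every variable `xᵢ` occurs exactly `α i` times. -/
def multihomogeneous (F : Type*) [Field F] (d : ℕ) (α : Fin d →₀ ℕ) :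
    Submodule F (FreeAlgebra F (Fin d)) :=
  Submodule.span F {f | ∃ w : List (Fin d), (∀ i, w.count i = α i) ∧ f = monomial F w}

/-- The Hilbert series `H(A, t₁, …, t_d)`: the coefficient of `t^α` is the dimension of the
component of multidegree `α` of the relatively free algebra `F⟨x₁, …, x_d⟩ / T(A)`, that is of the
image of the multihomogeneous component of `F⟨x₁, …, x_d⟩`. -/
def hilbertSeries (F A : Type*) [Field F] [Ring A] [Algebra F A] (d : ℕ) :
    MvPowerSeries (Fin d) ℤ :=
  fun α => (Module.finrank F
    ((multihomogeneous F d α).map (identities F A (Fin d)).mkQ) : ℤ)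

/-- The Schur function `S_μ(t₁, …, t_d)`: the coefficient of `t^α` is the number of semistandard
tableaux of shape `μ` with entries in `{0, …, d - 1}` (standing for `t₁, …, t_d`) in which every
`k` occurs exactly `α k` times. -/
def schur (d : ℕ) (μ : YoungDiagram) : MvPowerSeries (Fin d) ℤ :=
  fun α => (Nat.card {T : SemistandardYoungTableau μ //
    (∀ c ∈ μ.cells, T c.1 c.2 < d) ∧
    ∀ k : Fin d, (μ.cells.filter fun c => T c.1 c.2 = (k : ℕ)).card = α k} : ℤ)

/-! ### Cocharacters -/

/-- The natural left action of permutations on the free algebra, `σ · xᵢ = x_{σ i}`. -/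
def permuteVariables (F X : Type*) [Field F] :
    Representation F (Equiv.Perm X) (FreeAlgebra F X) where
  toFun σ := (FreeAlgebra.lift F fun x => FreeAlgebra.ι F (σ x)).toLinearMap
  map_one' := by
    have h : (FreeAlgebra.lift F fun x => FreeAlgebra.ι F ((1 : Equiv.Perm X) x)) =
        AlgHom.id F (FreeAlgebra F X) := by
      ext x; simp
    rw [h]; rfl
  map_mul' σ τ := by
    have h : (FreeAlgebra.lift F fun x => FreeAlgebra.ι F ((σ * τ) x)) =
        (FreeAlgebra.lift F fun x => FreeAlgebra.ι F (σ x)).comp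
          (FreeAlgebra.lift F fun x => FreeAlgebra.ι F (τ x)) := by
      ext x; simp
    rw [h]; rfl

theorem permuteVariables_apply {F X : Type*} [Field F] (σ : Equiv.Perm X) (f : FreeAlgebra F X) :
    permuteVariables F X σ f = FreeAlgebra.lift F (fun x => FreeAlgebra.ι F (σ x)) f := rfl

theorem permuteVariables_monomial {F X : Type*} [Field F] (σ : Equiv.Perm X) (w : List X) :
    permuteVariables F X σ (monomial F w) = monomial F (w.map σ) := by
  rw [permuteVariables_apply, monomial, monomial, map_list_prod, List.map_map, List.map_map]
  congr 2
  funext x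
  simp

theorem identities_stable (F A X : Type*) [Field F] [Ring A] [Algebra F A] (σ : Equiv.Perm X) :
    identities F A X ≤ (identities F A X).comap (permuteVariables F X σ) := by
  intro f hf
  simp only [identities, Submodule.mem_comap, Submodule.mem_iInf] at hf ⊢
  intro φ
  exact hf (φ.comp (FreeAlgebra.lift F fun x => FreeAlgebra.ι F (σ x)))

/-- The space `Vₙ` of multilinear polynomials of degree `n`, spanned by the monomials
`x_{σ 1} ⋯ x_{σ n}` with `σ ∈ Sₙ`. -/
def multilinear (F : Type*) [Field F] (n : ℕ) : Submodule F (FreeAlgebra F (Fin n)) :=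
  Submodule.span F (Set.range fun σ : Equiv.Perm (Fin n) => monomial F (List.ofFn σ))

theorem multilinear_stable (F : Type*) [Field F] (n : ℕ) (σ : Equiv.Perm (Fin n)) :
    multilinear F n ≤ (multilinear F n).comap (permuteVariables F (Fin n) σ) := by
  rw [multilinear, Submodule.span_le]
  rintro _ ⟨τ, rfl⟩
  refine Submodule.subset_span ⟨σ * τ, ?_⟩
  simp only [permuteVariables_monomial, List.map_ofFn]
  rfl

/-- `Vₙ` as an `Sₙ`-module. -/
def multilinearRep (F : Type*) [Field F] (n : ℕ) :
    Representation F (Equiv.Perm (Fin n)) (multilinear F n) :=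
  (permuteVariables F (Fin n)).subrepresentation (multilinear F n) (multilinear_stable F n)

/-- The subspace `Vₙ ∩ T(A)` of `Vₙ`. -/
def multilinearIdentities (F A : Type*) [Field F] [Ring A] [Algebra F A] (n : ℕ) :
    Submodule F (multilinear F n) :=
  (identities F A (Fin n)).comap (multilinear F n).subtype

/-- The `Sₙ`-module `Vₙ(A) = Vₙ / (Vₙ ∩ T(A))`. -/
def cocharacterRep (F A : Type*) [Field F] [Ring A] [Algebra F A] (n : ℕ) :
    Representation F (Equiv.Perm (Fin n)) (multilinear F n ⧸ multilinearIdentities F A n) :=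
  (multilinearRep F n).quotient (multilinearIdentities F A n)
    fun σ _ hf => identities_stable F A (Fin n) σ hf

/-- The `n`-th cocharacter `χₙ(A)`. -/
def cocharacter (F A : Type*) [Field F] [Ring A] [Algebra F A] (n : ℕ) (σ : Equiv.Perm (Fin n)) :
    F :=
  LinearMap.trace F _ (cocharacterRep F A n σ)

/-! ### Irreducible characters of the symmetric groups -/

/-- The permutation module on row assignments `r : Fin n → ℕ`. A tabloid is identified with the
function that sends each number to the index of its row; `σ · r = r ∘ σ⁻¹`. -/
def tabloidRep (F : Type*) [Field F] (n : ℕ) :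
    Representation F (Equiv.Perm (Fin n)) ((Fin n → ℕ) →₀ F) where
  toFun σ := Finsupp.lmapDomain F F fun r : Fin n → ℕ => r ∘ ⇑σ⁻¹
  map_one' := by
    ext r : 2
    simp
  map_mul' σ τ := by
    ext r : 2
    simp [Function.comp_assoc]

open Classical in
/-- The polytabloid `e_T = ∑_{q ∈ C_T} sgn(q) q · {T}` of a bijective tableau `T` of shape `μ`,
where `C_T` is the column stabilizer of `T`. -/
def polytabloid (F : Type*) [Field F] {n : ℕ} {μ : YoungDiagram} (T : Fin n ≃ μ.cells) :
    (Fin n → ℕ) →₀ F :=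
  ∑ q : Equiv.Perm (Fin n) with ∀ i, (T (q i)).1.2 = (T i).1.2,
    ((Equiv.Perm.sign q : ℤ) : F) • tabloidRep F n q (Finsupp.single (fun i => (T i).1.1) 1)

theorem tabloidRep_polytabloid (F : Type*) [Field F] {n : ℕ} {μ : YoungDiagram}
    (σ : Equiv.Perm (Fin n)) (T : Fin n ≃ μ.cells) :
    tabloidRep F n σ (polytabloid F T) = polytabloid F (σ.symm.trans T) := by
  classical
  rw [polytabloid, polytabloid, map_sum]
  refine Finset.sum_equiv (MulAut.conj σ).toEquiv ?_ ?_
  · intro q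
    simp only [Finset.mem_filter, Finset.mem_univ, true_and]
    constructor
    · intro h i
      simpa using h (σ.symm i)
    · intro h i
      simpa using h (σ i)
  · intro q _
    have hs : Finsupp.single (fun i => ((σ.symm.trans T) i).1.1) (1 : F) =
        tabloidRep F n σ (Finsupp.single (fun i => (T i).1.1) 1) := by
      simp [tabloidRep]
      rfl
    have hq : σ * q = (MulAut.conj σ).toEquiv q * σ := by simp
    rw [hs, map_smul, ← Module.End.mul_apply, ← Module.End.mul_apply, ← map_mul, ← map_mul, hq]
    rcases Int.units_eq_one_or (Equiv.Perm.sign σ) with h | h <;> simp [h]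

/-- The Specht module of shape `μ`, spanned by all polytabloids of shape `μ` (it is zero unless
`μ` has exactly `n` cells). -/
def specht (F : Type*) [Field F] (n : ℕ) (μ : YoungDiagram) : Submodule F ((Fin n → ℕ) →₀ F) :=
  Submodule.span F (Set.range fun T : Fin n ≃ μ.cells => polytabloid F T)

theorem specht_stable (F : Type*) [Field F] (n : ℕ) (μ : YoungDiagram) (σ : Equiv.Perm (Fin n)) :
    specht F n μ ≤ (specht F n μ).comap (tabloidRep F n σ) := by
  rw [specht, Submodule.span_le]
  rintro _ ⟨T, rfl⟩
  exact Submodule.subset_span ⟨σ.symm.trans T, (tabloidRep_polytabloid F σ T).symm⟩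

/-- The irreducible character `χ_μ` of `Sₙ` attached to the partition `μ` of `n`: the character
of the Specht module. -/
def irreducibleCharacter (F : Type*) [Field F] (n : ℕ) (μ : YoungDiagram)
    (σ : Equiv.Perm (Fin n)) : F :=
  LinearMap.trace F _ ((tabloidRep F n).subrepresentation (specht F n μ) (specht_stable F n μ) σ)

theorem finite_card_eq (n : ℕ) : {μ : YoungDiagram | μ.card = n}.Finite := by
  refine Set.Finite.of_finite_image
    (f := YoungDiagram.cells) (Set.Finite.subset
      (Finset.range n ×ˢ Finset.range n).powerset.finite_toSet ?_) ?_
  · rintro _ ⟨μ, rfl, rfl⟩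
    simp only [Finset.coe_powerset, Set.mem_preimage, Set.mem_powerset_iff, Finset.coe_subset]
    rintro ⟨i, j⟩ h
    have hi : i < μ.colLen j := YoungDiagram.mem_iff_lt_colLen.1 h
    have hj : j < μ.rowLen i := YoungDiagram.mem_iff_lt_rowLen.1 h
    rw [YoungDiagram.colLen_eq_card] at hi
    rw [YoungDiagram.rowLen_eq_card] at hj
    have h1 : (μ.col j).card ≤ μ.card := Finset.card_le_card (Finset.filter_subset _ _)
    have h2 : (μ.row i).card ≤ μ.card := Finset.card_le_card (Finset.filter_subset _ _)
    simp only [Finset.mem_product, Finset.mem_range]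
    omega
  · intro μ _ ν _ h
    exact YoungDiagram.ext h

/-- The partitions of `n`, as Young diagrams. -/
def partitions (n : ℕ) : Finset YoungDiagram := (finite_card_eq n).toFinset

theorem mem_partitions {n : ℕ} {μ : YoungDiagram} : μ ∈ partitions n ↔ μ.card = n := by
  simp [partitions]

/-! ### The algebra `UT₂(E)` -/

/-- The infinite dimensional Grassmann algebra `E` (with unit): the exterior algebra of a vector
space with a countably infinite basis. -/
abbrev Grassmann (F : Type*) [Field F] : Type _ := ExteriorAlgebra F (ℕ →₀ F)

/-- The algebra `UT₂(A)` of upper triangular `2 × 2` matrices with entries in `A`. -/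
def UT2 (F A : Type*) [Field F] [Ring A] [Algebra F A] :
    Subalgebra F (Matrix (Fin 2) (Fin 2) A) where
  carrier := {M | M 1 0 = 0}
  mul_mem' {M N} hM hN := by
    simp only [Set.mem_ofPred_eq] at hM hN ⊢
    simp [Matrix.mul_apply, Fin.sum_univ_two, hM, hN]
  add_mem' {M N} hM hN := by
    simp only [Set.mem_ofPred_eq] at hM hN ⊢
    simp [hM, hN]
  algebraMap_mem' r := by
    simp [Matrix.algebraMap_matrix_apply]

end PICochar

end

open PICochar

/-!
Write `E` for the Grassmann algebra, `H` for its Hilbert series in `d` variables, `e₁` for the sum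
of the variables and `P = ∏ (1 + t_k) / (1 - t_k)`. The argument computes the Hilbert series of
`UT₂(E)` as `2 H + (e₁ - 1) H ^ 2`, expands it in Schur functions, and transfers the expansion to
the cocharacters.

*The Grassmann algebra.* A multihomogeneous polynomial is an identity of `E` if and only if it
vanishes under the single substitution `x_k ↦ 1 + e_k` (`mem_identities_of_theta_eq_zero`). The
values of the words of a given content are `(1 + η) q`, where the vector `η` depends only on the
content and `q` is even; conversely products of commutators reach every even monomial in the letters
that occur. Hence the dimension of a multihomogeneous component is the number of subsets of even
cardinality of the set of its letters (`finrank_map_theta`), which gives `2 H = 1 + P`.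

*From `E` to `UT₂(E)`.* Call a word normal if it is not congruent modulo the identities of `E` to a
combination of lexicographically smaller rearrangements. The relatively free algebra of `UT₂(E)` has
as a basis the normal words and the products `v · (x u - normal form)` with `v`, `u` normal and
`x u` not normal. They span because products of two identities of `E` are identities of `UT₂(E)`
(`monomial_mem_generators`). They are independent because the upper right entry of a triangular
substitution splits a word at a letter and evaluates both factors independently, the generators of
`E` that are used for the two diagonal entries being disjoint (`ofWords_splitSum_eq_zero`). Subwords
of normal words are normal, so the triples `(v, x, u)` are counted by `e₁ H ^ 2 - (H ^ 2 - H)`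
(`four_mul_finrank_identities_UT2`).

*Schur expansion.* By the branching rule for tableaux, a function on diagrams that is an
eigenfunction of all operators "sum over the horizontal strips of size `j`", with eigenvalues
`φ j`, is the family of Schur coefficients of `∏ φ(t_k)` (`schurSum_eq_prod`). This is verified for
explicit coefficients of `1`, `P` and `P ^ 2`. Multiplication by `e₁` sums over the removals of a
box; it is compatible with the branching rule by a commutation relation (`stripSum_boxSum`). The
resulting multiplicities are evaluated shape by shape in `mult_values`.

*Cocharacters.* A class function on a symmetric group is determined by its sums over the stabilizers
of words (`classFunction_eq_zero`). For a cocharacter such a sum is a coefficient of the Hilbert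
series (`sum_cocharacter`), because linearization inverts the identification of variables. For the
character of a Specht module it is a Kostka number (`sum_irreducibleCharacter`, Young's rule), since
the invariants are isomorphic to the span of the bideterminants of the fillings of a given content,
with the semistandard ones as a basis. So the multiplicities in both expansions agree
(`cocharacter_eq_sum`).
-/

open scoped MvPowerSeries.WithPiTopology

noncomputable section

namespace PICochar

/-! ### Young diagrams and their row lengths -/

theorem rowLen_ext {μ ν : YoungDiagram} (h : ∀ i, μ.rowLen i = ν.rowLen i) : μ = ν := by
  apply YoungDiagram.ext
  ext ⟨i, j⟩
  rw [YoungDiagram.mem_cells, YoungDiagram.mem_cells, YoungDiagram.mem_iff_lt_rowLen,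
    YoungDiagram.mem_iff_lt_rowLen, h]

theorem rowLen_eq_zero_iff {μ : YoungDiagram} {i : ℕ} : μ.rowLen i = 0 ↔ μ.colLen 0 ≤ i := by
  rw [← not_iff_not, not_le, ← YoungDiagram.mem_iff_lt_colLen, YoungDiagram.mem_iff_lt_rowLen]
  omega

theorem lt_rowLen_iff {μ : YoungDiagram} {i j : ℕ} : j < μ.rowLen i ↔ i < μ.colLen j := by
  rw [← YoungDiagram.mem_iff_lt_colLen, YoungDiagram.mem_iff_lt_rowLen]

theorem rowLen_colLen_zero (μ : YoungDiagram) : μ.rowLen (μ.colLen 0) = 0 :=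
  rowLen_eq_zero_iff.2 le_rfl

theorem card_eq_sum_rowLen (μ : YoungDiagram) {N : ℕ} (hN : μ.rowLen N = 0) :
    μ.card = ∑ i ∈ Finset.range N, μ.rowLen i := by
  have h : μ.cells = (Finset.range N).biUnion μ.row := by
    ext ⟨i, j⟩
    simp only [YoungDiagram.mem_cells, Finset.mem_biUnion, Finset.mem_range,
      YoungDiagram.mem_row_iff]
    constructor
    · intro hc
      refine ⟨i, ?_, hc, rfl⟩
      by_contra hi
      have h1 := μ.rowLen_anti N i (by omega)
      rw [YoungDiagram.mem_iff_lt_rowLen] at hc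
      omega
    · rintro ⟨_, _, hc, rfl⟩
      exact hc
  rw [YoungDiagram.card, h, Finset.card_biUnion]
  · simp only [YoungDiagram.rowLen_eq_card]
  · intro i _ j _ hij
    rw [Function.onFun, Finset.disjoint_left]
    intro c hc hc'
    rw [YoungDiagram.mem_row_iff] at hc hc'
    exact hij (hc.2.symm.trans hc'.2)

open Classical in
/-- The Young diagram with the row lengths `f 0, f 1, …`. This is meaningful if `f` is antitone and
vanishes somewhere; otherwise the value is the empty diagram. -/
def ofRows (f : ℕ → ℕ) : YoungDiagram :=
  if h : Antitone f ∧ ∃ N, f N = 0 then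
    { cells := (Finset.range h.2.choose ×ˢ Finset.range (f 0)).filter fun c => c.2 < f c.1
      isLowerSet := by
        rintro ⟨i, j⟩ ⟨i', j'⟩ ⟨hi, hj⟩ hc
        simp only [Finset.coe_filter, Finset.mem_product, Finset.mem_range,
          Set.mem_ofPred_eq] at hi hj hc ⊢
        have := h.1 hi
        omega }
  else ⊥

theorem rowLen_ofRows {f : ℕ → ℕ} (hf : Antitone f) {N : ℕ} (hN : f N = 0) (i : ℕ) :
    (ofRows f).rowLen i = f i := by
  have h : Antitone f ∧ ∃ N, f N = 0 := ⟨hf, N, hN⟩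
  have key : ∀ j, j < (ofRows f).rowLen i ↔ j < f i := by
    intro j
    rw [← YoungDiagram.mem_iff_lt_rowLen, ofRows, dif_pos h, ← YoungDiagram.mem_cells]
    simp only [Finset.mem_filter, Finset.mem_product, Finset.mem_range, and_iff_right_iff_imp]
    intro hj
    have h0 := hf (Nat.zero_le i)
    refine ⟨?_, by omega⟩
    by_contra hi
    have h1 := hf (not_lt.1 hi)
    have := h.2.choose_spec
    omega
  have h1 := key (f i)
  have h2 := key ((ofRows f).rowLen i)
  omega

/-- `λ / μ` is a horizontal strip: the row lengths interlace, `λ₀ ≥ μ₀ ≥ λ₁ ≥ μ₁ ≥ ⋯`. -/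
def IsHStrip (μ l : YoungDiagram) : Prop :=
  ∀ i, μ.rowLen i ≤ l.rowLen i ∧ l.rowLen (i + 1) ≤ μ.rowLen i

/-- `λ` arises from `ν` by adding one box in row `i`. -/
def IsBoxAt (i : ℕ) (ν l : YoungDiagram) : Prop :=
  ∀ j, l.rowLen j = ν.rowLen j + if j = i then 1 else 0

/-- `λ` arises from `ν` by adding one box. -/
def IsBox (ν l : YoungDiagram) : Prop := ∃ i, IsBoxAt i ν l

theorem IsHStrip.le {μ l : YoungDiagram} (h : IsHStrip μ l) : μ ≤ l := by
  rintro ⟨i, j⟩ hc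
  rw [YoungDiagram.mem_iff_lt_rowLen] at hc ⊢
  exact hc.trans_le (h i).1

theorem IsBoxAt.card {i : ℕ} {ν l : YoungDiagram} (h : IsBoxAt i ν l) : l.card = ν.card + 1 := by
  have hN : l.rowLen (l.colLen 0) = 0 := rowLen_colLen_zero l
  have hN' : ν.rowLen (l.colLen 0) = 0 := by have := h (l.colLen 0); omega
  have hi : i < l.colLen 0 := by
    rw [← lt_rowLen_iff, h i]; simp
  rw [card_eq_sum_rowLen l hN, card_eq_sum_rowLen ν hN', Finset.sum_congr rfl fun j _ => h j,
    Finset.sum_add_distrib, Finset.sum_ite_eq']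
  simp [hi]

theorem IsBox.card {ν l : YoungDiagram} (h : IsBox ν l) : l.card = ν.card + 1 := by
  obtain ⟨i, hi⟩ := h
  exact hi.card

/-! ### Kostka numbers -/

/-- The semistandard tableaux of shape `μ` with entries in `{0, …, d - 1}` and content `α`. -/
abbrev Tableaux (d : ℕ) (μ : YoungDiagram) (α : Fin d → ℕ) : Type :=
  {T : SemistandardYoungTableau μ // (∀ c ∈ μ.cells, T c.1 c.2 < d) ∧
    ∀ k : Fin d, (μ.cells.filter fun c => T c.1 c.2 = (k : ℕ)).card = α k}

/-- The Kostka number: the number of semistandard tableaux of shape `μ` and content `α`. -/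
def kostka (d : ℕ) (μ : YoungDiagram) (α : Fin d → ℕ) : ℕ := Nat.card (Tableaux d μ α)

instance (d : ℕ) (μ : YoungDiagram) (α : Fin d → ℕ) : Finite (Tableaux d μ α) := by
  refine Finite.of_injective
    (fun (T : Tableaux d μ α) (c : μ.cells) => (⟨T.1 c.1.1 c.1.2, T.2.1 c.1 c.2⟩ : Fin d)) ?_
  intro T T' h
  refine Subtype.ext (SemistandardYoungTableau.ext fun i j => ?_)
  by_cases hc : (i, j) ∈ μ
  · have := congrFun h ⟨(i, j), (YoungDiagram.mem_cells _).2 hc⟩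
    simpa using this
  · rw [T.1.zeros hc, T'.1.zeros hc]

/-- The content of a tableau has as many entries as the shape has cells. -/
theorem card_eq_sum_content {d : ℕ} {μ : YoungDiagram} {α : Fin d → ℕ} (T : Tableaux d μ α) :
    μ.card = ∑ k, α k := by
  rw [YoungDiagram.card, Finset.card_eq_sum_card_fiberwise (t := Finset.range d)
    (f := fun c => T.1 c.1 c.2) (fun c hc => Finset.mem_coe.2 (Finset.mem_range.2 (T.2.1 c hc))),
    Finset.sum_range]
  exact Finset.sum_congr rfl fun k _ => T.2.2 k

theorem kostka_eq_zero {d : ℕ} {μ : YoungDiagram} {α : Fin d → ℕ} (h : μ.card ≠ ∑ k, α k) :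
    kostka d μ α = 0 := by
  have : IsEmpty (Tableaux d μ α) := ⟨fun T => h (card_eq_sum_content T)⟩
  exact Nat.card_of_isEmpty

/-- The cells of a tableau that do not contain the largest letter. -/
def truncShape {μ : YoungDiagram} (T : SemistandardYoungTableau μ)
    (d : ℕ) : YoungDiagram where
  cells := μ.cells.filter fun c => T c.1 c.2 < d
  isLowerSet := by
    rintro ⟨i, j⟩ ⟨i', j'⟩ ⟨hi, hj⟩ hc
    simp only [Finset.coe_filter, YoungDiagram.mem_cells, Set.mem_ofPred_eq] at hi hj hc ⊢
    refine ⟨μ.up_left_mem hi hj hc.1, lt_of_le_of_lt ?_ hc.2⟩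
    exact (T.row_weak_of_le hj (μ.up_left_mem hi le_rfl hc.1)).trans (T.col_weak hi hc.1)

theorem mem_truncShape {μ : YoungDiagram}
    (T : SemistandardYoungTableau μ) (d : ℕ) (c : ℕ × ℕ) :
    c ∈ truncShape T d ↔ c ∈ μ ∧ T c.1 c.2 < d := by
  rw [← YoungDiagram.mem_cells]
  simp [truncShape]

/-- Removal of the largest letter from a tableau. -/
def truncTableau {μ : YoungDiagram} (T : SemistandardYoungTableau μ) (d : ℕ) :
    SemistandardYoungTableau (truncShape T d) where
  entry i j := if T i j < d then T i j else 0
  row_weak' {i j1 j2} hj hc := by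
    rw [mem_truncShape] at hc
    have := T.row_weak hj hc.1
    simp only at hc
    rw [if_pos hc.2, if_pos (by omega)]
    exact this
  col_strict' {i1 i2 j} hi hc := by
    rw [mem_truncShape] at hc
    have := T.col_strict hi hc.1
    simp only at hc
    rw [if_pos hc.2, if_pos (by omega)]
    exact this
  zeros' {i j} hc := by
    rw [mem_truncShape] at hc
    split_ifs with h
    · exact T.zeros fun h' => hc ⟨h', h⟩
    · rfl

open Classical in
/-- Filling of a horizontal strip with a new largest letter. -/
def extendTableau {μ ν : YoungDiagram} (T : SemistandardYoungTableau ν) (d : ℕ)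
    (hT : ∀ c ∈ ν.cells, T c.1 c.2 < d) (h : IsHStrip ν μ) : SemistandardYoungTableau μ where
  entry i j := if (i, j) ∈ ν then T i j else if (i, j) ∈ μ then d else 0
  row_weak' {i j1 j2} hj hc := by
    have hc1 : (i, j1) ∈ μ := μ.up_left_mem le_rfl hj.le hc
    rw [if_pos hc, if_pos hc1]
    split_ifs with h1 h2 h2
    · exact T.row_weak hj h2
    · exact (hT _ ((YoungDiagram.mem_cells _).2 h1)).le
    · exact absurd (ν.up_left_mem le_rfl hj.le h2) h1
    · rfl
  col_strict' {i1 i2 j} hi hc := by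
    have h1 : (i1, j) ∈ ν := by
      rw [YoungDiagram.mem_iff_lt_rowLen] at hc ⊢
      exact hc.trans_le ((μ.rowLen_anti (i1 + 1) i2 hi).trans (h i1).2)
    rw [if_pos h1, if_pos hc]
    split_ifs with h2
    · exact T.col_strict hi h2
    · exact hT _ ((YoungDiagram.mem_cells _).2 h1)
  zeros' {i j} hc := by
    have h1 : (i, j) ∉ ν := fun h' => hc (h.le h')
    rw [if_neg h1, if_neg hc]

open Classical in
/-- Branching rule: removal of the largest letter `d` from the tableaux with entries in
`{0, …, d}`. -/
theorem kostka_succ (d n : ℕ) (μ : YoungDiagram) (α : Fin (d + 1) → ℕ)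
    (hμ : μ.card = n + α (Fin.last d)) :
    kostka (d + 1) μ α =
      ∑ ν ∈ (partitions n).filter (IsHStrip · μ), kostka d ν (fun k => α k.castSucc) := by
  let P := (partitions n).filter (IsHStrip · μ)
  have key : Tableaux (d + 1) μ α ≃ Σ ν : P, Tableaux d ν.1 (fun k => α k.castSucc) := by
    -- The cells with entries `< d` form a diagram `ν`, and `μ / ν` is a horizontal strip since the
    -- letter `d` occurs at most once in a column.
    have hshape (T : Tableaux (d + 1) μ α) : truncShape T.1 d ∈ P := by
      simp only [P, Finset.mem_filter, mem_partitions]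
      constructor
      · have h1 := Finset.card_filter_add_card_filter_not (s := μ.cells) (fun c => T.1 c.1 c.2 < d)
        have h2 : (μ.cells.filter fun c => ¬ T.1 c.1 c.2 < d) =
            μ.cells.filter fun c => T.1 c.1 c.2 = ((Fin.last d : Fin (d + 1)) : ℕ) := by
          refine Finset.filter_congr fun c hc => ?_
          have := T.2.1 c hc
          simp only [Fin.val_last]
          omega
        rw [h2, T.2.2 (Fin.last d)] at h1
        have h3 : μ.cells.card = n + α (Fin.last d) := hμ
        change (μ.cells.filter fun c => T.1 c.1 c.2 < d).card = n
        omega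
      · intro i
        constructor
        · by_contra hlt
          have h1 : (i, μ.rowLen i) ∈ truncShape T.1 d :=
            YoungDiagram.mem_iff_lt_rowLen.2 (by omega)
          rw [mem_truncShape] at h1
          have := YoungDiagram.mem_iff_lt_rowLen.1 h1.1
          omega
        · by_contra hlt
          set j := (truncShape T.1 d).rowLen i with hj
          have h1 : (i + 1, j) ∈ μ := YoungDiagram.mem_iff_lt_rowLen.2 (by omega)
          have h2 := T.1.col_strict (Nat.lt_add_one i) h1
          have h3 := T.2.1 _ ((YoungDiagram.mem_cells _).2 h1)
          have h4 : (i, j) ∈ truncShape T.1 d := by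
            rw [mem_truncShape]
            refine ⟨μ.up_left_mem (Nat.le_succ i) le_rfl h1, ?_⟩
            simp only at h3 ⊢
            omega
          have := YoungDiagram.mem_iff_lt_rowLen.1 h4
          omega
    have hent (T : SemistandardYoungTableau μ) : ∀ i j,
        (truncTableau T d) i j = if T i j < d then T i j else 0 :=
      fun _ _ => rfl
    have hext {ν : YoungDiagram} (T : SemistandardYoungTableau ν) (hT) (h : IsHStrip ν μ) :
        ∀ i j, (extendTableau T d hT h) i j =
          if (i, j) ∈ ν then T i j else if (i, j) ∈ μ then d else 0 := fun _ _ => rfl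
    refine
      { toFun := fun T => ⟨⟨_, hshape T⟩, ⟨truncTableau T.1 d, ?_, ?_⟩⟩
        invFun := fun T => ⟨extendTableau T.2.1 d T.2.2.1
          (Finset.mem_filter.1 T.1.2).2, ?_, ?_⟩
        left_inv := ?_
        right_inv := ?_ }
    · intro c hc
      rw [YoungDiagram.mem_cells, mem_truncShape] at hc
      rw [hent, if_pos hc.2]
      exact hc.2
    · intro k
      refine Eq.trans ?_ (T.2.2 k.castSucc)
      congr 1
      ext c
      simp only [Finset.mem_filter, YoungDiagram.mem_cells,
        mem_truncShape, hent, Fin.val_castSucc]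
      constructor
      · rintro ⟨⟨h1, h2⟩, h3⟩
        rw [if_pos h2] at h3
        exact ⟨h1, h3⟩
      · rintro ⟨h1, h2⟩
        have : T.1 c.1 c.2 < d := h2 ▸ k.2
        exact ⟨⟨h1, this⟩, by rw [if_pos this]; exact h2⟩
    · intro c hc
      rw [hext]
      split_ifs with h1
      · exact (T.2.2.1 _ ((YoungDiagram.mem_cells _).2 h1)).trans (Nat.lt_succ_self d)
      · exact Nat.lt_succ_self d
      · exact absurd ((YoungDiagram.mem_cells _).1 hc) ‹_›
    · have hstrip := (Finset.mem_filter.1 T.1.2).2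
      have hcard := mem_partitions.1 (Finset.mem_filter.1 T.1.2).1
      intro k
      refine Fin.lastCases ?_ (fun k => ?_) k
      · have h1 : (μ.cells.filter fun c =>
            (extendTableau T.2.1 d T.2.2.1 hstrip) c.1 c.2 =
              ((Fin.last d : Fin (d + 1)) : ℕ)) = μ.cells \ T.1.1.cells := by
          ext c
          simp only [Finset.mem_filter, Finset.mem_sdiff, YoungDiagram.mem_cells, hext,
            Fin.val_last]
          refine and_congr_right fun hc => ?_
          constructor
          · intro h hc'
            rw [if_pos hc'] at h
            have := T.2.2.1 c ((YoungDiagram.mem_cells _).2 hc')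
            omega
          · intro h
            rw [if_neg h, if_pos hc]
        rw [h1, Finset.card_sdiff_of_subset (YoungDiagram.cells_subset_iff.2 hstrip.le)]
        change μ.card - T.1.1.card = _
        omega
      · refine Eq.trans ?_ (T.2.2.2 k)
        congr 1
        ext c
        simp only [Finset.mem_filter, YoungDiagram.mem_cells, hext, Fin.val_castSucc]
        constructor
        · rintro ⟨h1, h2⟩
          have hk := k.2
          by_cases h3 : c ∈ T.1.1
          · rw [if_pos h3] at h2
            exact ⟨h3, h2⟩
          · rw [if_neg h3, if_pos h1] at h2
            omega
        · rintro ⟨h1, h2⟩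
          exact ⟨hstrip.le h1, by rw [if_pos h1]; exact h2⟩
    · intro T
      refine Subtype.ext (SemistandardYoungTableau.ext fun i j => ?_)
      rw [hext, hent]
      simp only [mem_truncShape]
      by_cases hc : (i, j) ∈ μ
      · have := T.2.1 _ ((YoungDiagram.mem_cells _).2 hc)
        simp only [hc, true_and, if_true] at this ⊢
        split_ifs <;> omega
      · simp [hc, T.1.zeros hc]
    · rintro ⟨⟨ν, hν⟩, T⟩
      have hstrip := (Finset.mem_filter.1 hν).2
      have hsh : truncShape
          (extendTableau T.1 d T.2.1 hstrip) d = ν := by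
        apply YoungDiagram.ext
        ext c
        rw [YoungDiagram.mem_cells, mem_truncShape, hext,
          YoungDiagram.mem_cells]
        constructor
        · rintro ⟨h1, h2⟩
          by_contra h3
          rw [if_neg h3, if_pos h1] at h2
          omega
        · intro h
          exact ⟨hstrip.le h, by rw [if_pos h]; exact T.2.1 c ((YoungDiagram.mem_cells _).2 h)⟩
      -- The type of the second component of the pair depends on the first.
      have aux : ∀ (ν' : YoungDiagram) (hν' : ν' ∈ P) (T' : Tableaux d ν' (fun k => α k.castSucc)),
          ν' = ν → (∀ i j, T'.1 i j = T.1 i j) →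
          (⟨⟨ν', hν'⟩, T'⟩ : Σ ν : P, Tableaux d ν.1 (fun k => α k.castSucc)) = ⟨⟨ν, hν⟩, T⟩ := by
        rintro ν' hν' T' rfl h
        congr 1
        exact Subtype.ext (SemistandardYoungTableau.ext h)
      refine aux _ _ _ hsh fun i j => ?_
      simp only
      rw [hent, hext]
      by_cases hc : (i, j) ∈ ν
      · have := T.2.1 _ ((YoungDiagram.mem_cells _).2 hc)
        simp only [hc, if_true] at this ⊢
        rw [if_pos this]
      · simp only [hc, if_false, T.1.zeros hc]
        split_ifs <;> omega
  rw [kostka, Nat.card_congr key, Nat.card_sigma]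
  exact Finset.sum_coe_sort P (fun ν => kostka d ν (fun k => α k.castSucc))

/-! ### Symmetric functions given by their Schur coefficients -/

open Classical in
/-- The sum of `c` over all diagrams that arise from `μ` by adding a horizontal strip of size `j`.
This is the adjoint of the multiplication of Schur functions by the complete symmetric function of
degree `j`. -/
def stripSum (c : YoungDiagram → ℤ) (j : ℕ) (μ : YoungDiagram) : ℤ :=
  ∑ l ∈ (partitions (μ.card + j)).filter (IsHStrip μ ·), c l

open Classical in
/-- The sum of `c` over all diagrams that arise from `l` by removing a box: if `c` gives the Schur
coefficients of `f`, then `boxSum c` gives those of `(t₁ + t₂ + ⋯) f`. -/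
def boxSum (c : YoungDiagram → ℤ) (l : YoungDiagram) : ℤ :=
  ∑ ν ∈ (partitions (l.card - 1)).filter (IsBox · l), c ν

/-- The coefficient of `t^α` in `∑ c_λ S_λ(t₁, …, t_d)`. -/
def schurSum (d : ℕ) (c : YoungDiagram → ℤ) (α : Fin d → ℕ) : ℤ :=
  ∑ l ∈ partitions (∑ k, α k), c l * kostka d l α

theorem partitions_zero : partitions 0 = {⊥} := by
  ext μ
  rw [mem_partitions, Finset.mem_singleton, YoungDiagram.card, Finset.card_eq_zero]
  constructor
  · intro h
    exact YoungDiagram.ext h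
  · rintro rfl
    rfl

theorem kostka_zero (α : Fin 0 → ℕ) : kostka 0 ⊥ α = 1 := by
  rw [kostka, Nat.card_eq_one_iff_unique]
  refine ⟨⟨fun T T' => Subtype.ext (SemistandardYoungTableau.ext fun i j => ?_)⟩,
    ⟨⟨default, ?_, ?_⟩⟩⟩
  · rw [T.1.zeros (YoungDiagram.notMem_bot _), T'.1.zeros (YoungDiagram.notMem_bot _)]
  · simp
  · exact fun k => k.elim0

theorem schurSum_zero (c : YoungDiagram → ℤ) (α : Fin 0 → ℕ) : schurSum 0 c α = c ⊥ := by
  simp [schurSum, partitions_zero, kostka_zero]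

theorem schurSum_succ (d : ℕ) (c : YoungDiagram → ℤ) (α : Fin (d + 1) → ℕ) :
    schurSum (d + 1) c α = schurSum d (stripSum c (α (Fin.last d))) (fun k => α k.castSucc) := by
  classical
  rw [schurSum, schurSum, Fin.sum_univ_castSucc]
  set n := ∑ k : Fin d, α k.castSucc
  set j := α (Fin.last d) with hj
  have h1 : ∀ l ∈ partitions (n + j), c l * (kostka (d + 1) l α : ℤ) =
      ∑ ν ∈ partitions n, if IsHStrip ν l then c l * kostka d ν (fun k => α k.castSucc) else 0 := by
    intro l hl
    rw [mem_partitions] at hl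
    rw [kostka_succ d n l α hl, Nat.cast_sum, Finset.mul_sum, Finset.sum_filter]
  rw [Finset.sum_congr rfl h1, Finset.sum_comm]
  refine Finset.sum_congr rfl fun ν hν => ?_
  rw [mem_partitions] at hν
  rw [stripSum, Finset.sum_mul, Finset.sum_filter, hν]

theorem schurSum_add (d : ℕ) (c c' : YoungDiagram → ℤ) (α : Fin d → ℕ) :
    schurSum d (fun l => c l + c' l) α = schurSum d c α + schurSum d c' α := by
  simp only [schurSum, add_mul, Finset.sum_add_distrib]

theorem schurSum_smul (d : ℕ) (a : ℤ) (c : YoungDiagram → ℤ) (α : Fin d → ℕ) :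
    schurSum d (fun l => a * c l) α = a * schurSum d c α := by
  simp only [schurSum, mul_assoc, Finset.mul_sum]

/-- If `c` is an eigenfunction of all the operators `stripSum · j`, then `∑ c_λ S_λ` is a
product of series in one variable. -/
theorem schurSum_eq_prod {c : YoungDiagram → ℤ} {φ : ℕ → ℤ}
    (h : ∀ j μ, stripSum c j μ = φ j * c μ) (d : ℕ) (α : Fin d → ℕ) :
    schurSum d c α = (∏ k, φ (α k)) * c ⊥ := by
  induction d with
  | zero => simp [schurSum_zero]
  | succ d ih =>
    have : stripSum c (α (Fin.last d)) = fun μ => φ (α (Fin.last d)) * c μ := funext fun μ => h _ μ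
    rw [schurSum_succ, this, schurSum_smul, ih, Fin.prod_univ_castSucc]
    ring

open Classical in
/-- The number of ways to add a box to `ν` such that a horizontal strip over `μ` results. The
condition on the rows of `ν` enforces that the new rows are weakly decreasing. -/
theorem card_isBox_isHStrip (μ ν : YoungDiagram) {N : ℕ} (hμ : μ.rowLen N = 0)
    (hν : ν.rowLen N = 0) :
    ((partitions (ν.card + 1)).filter fun l => IsBox ν l ∧ IsHStrip μ l).card =
      ((Finset.range (N + 1)).filter fun i => ∀ j,
        μ.rowLen j ≤ ν.rowLen j + (if j = i then 1 else 0) ∧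
        ν.rowLen (j + 1) + (if j + 1 = i then 1 else 0) ≤ μ.rowLen j).card := by
  symm
  have hrow : ∀ i, (∀ j, μ.rowLen j ≤ ν.rowLen j + (if j = i then 1 else 0) ∧
      ν.rowLen (j + 1) + (if j + 1 = i then 1 else 0) ≤ μ.rowLen j) →
      ∀ j, (ofRows fun j => ν.rowLen j + if j = i then 1 else 0).rowLen j =
        ν.rowLen j + if j = i then 1 else 0 := by
    intro i hi j
    refine rowLen_ofRows (f := fun j => ν.rowLen j + if j = i then 1 else 0)
      (antitone_nat_of_succ_le fun j => (hi j).2.trans (hi j).1) (N := N + i + 1) ?_ j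
    have := ν.rowLen_anti N (N + i + 1) (by omega)
    rw [if_neg (by omega)]
    omega
  refine Finset.card_bij (fun i _ => ofRows fun j => ν.rowLen j + if j = i then 1 else 0) ?_ ?_ ?_
  · intro i hi
    have hi' := (Finset.mem_filter.1 hi).2
    have hbox : IsBoxAt i ν (ofRows fun j => ν.rowLen j + if j = i then 1 else 0) :=
      hrow i hi'
    refine Finset.mem_filter.2 ⟨mem_partitions.2 hbox.card, ⟨i, hbox⟩, fun j => ?_⟩
    rw [hrow i hi', hrow i hi']
    exact hi' j
  · intro i hi i' hi' heq
    have h1 := hrow i (Finset.mem_filter.1 hi).2 i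
    rw [heq, hrow i' (Finset.mem_filter.1 hi').2 i] at h1
    by_contra hne
    simp [hne] at h1
  · intro l hl
    obtain ⟨-, ⟨i, hi⟩, hs⟩ := Finset.mem_filter.1 hl
    have hP : ∀ j, μ.rowLen j ≤ ν.rowLen j + (if j = i then 1 else 0) ∧
        ν.rowLen (j + 1) + (if j + 1 = i then 1 else 0) ≤ μ.rowLen j := by
      intro j
      rw [← hi j, ← hi (j + 1)]
      exact hs j
    refine ⟨i, Finset.mem_filter.2 ⟨Finset.mem_range.2 ?_, hP⟩, rowLen_ext fun j => ?_⟩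
    · by_contra hlt
      have h1 := (hP (i - 1)).2
      have h2 := μ.rowLen_anti N (i - 1) (by omega)
      have h3 : i - 1 + 1 = i := by omega
      simp only [h3, if_true] at h1
      omega
    · rw [hrow i hP, hi j]

open Classical in
/-- The number of ways to remove a box from `μ` such that `ν` is a horizontal strip over the
result. -/
theorem card_isBox_isHStrip' (μ ν : YoungDiagram) {N : ℕ} (hμ : μ.rowLen N = 0) :
    ((partitions (μ.card - 1)).filter fun l => IsBox l μ ∧ IsHStrip l ν).card =
      ((Finset.range (N + 1)).filter fun i => ∀ j,
        μ.rowLen j ≤ ν.rowLen j + (if j = i then 1 else 0) ∧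
        ν.rowLen (j + 1) + (if j = i then 1 else 0) ≤ μ.rowLen j).card := by
  symm
  have hrow : ∀ i, (∀ j, μ.rowLen j ≤ ν.rowLen j + (if j = i then 1 else 0) ∧
      ν.rowLen (j + 1) + (if j = i then 1 else 0) ≤ μ.rowLen j) →
      ∀ j, (ofRows fun j => μ.rowLen j - if j = i then 1 else 0).rowLen j =
        μ.rowLen j - if j = i then 1 else 0 := by
    intro i hi j
    refine rowLen_ofRows (f := fun j => μ.rowLen j - if j = i then 1 else 0)
      (antitone_nat_of_succ_le fun j => ?_) (N := N) (by simp only [hμ]; omega) j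
    have h1 := (hi j).2
    have h2 := (hi (j + 1)).1
    omega
  refine Finset.card_bij (fun i _ => ofRows fun j => μ.rowLen j - if j = i then 1 else 0) ?_ ?_ ?_
  · intro i hi
    have hi' := (Finset.mem_filter.1 hi).2
    have hbox : IsBoxAt i (ofRows fun j => μ.rowLen j - if j = i then 1 else 0) μ := by
      intro j
      rw [hrow i hi']
      have := (hi' j).2
      omega
    refine Finset.mem_filter.2 ⟨mem_partitions.2 ?_, ⟨i, hbox⟩, fun j => ?_⟩
    · have := hbox.card
      omega
    · rw [hrow i hi']
      have := hi' j
      omega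
  · intro i hi i' hi' heq
    have h1 := hrow i (Finset.mem_filter.1 hi).2 i
    have h2 := ((Finset.mem_filter.1 hi).2 i).2
    rw [heq, hrow i' (Finset.mem_filter.1 hi').2 i] at h1
    by_contra hne
    simp only [hne, if_false, if_true] at h1 h2
    omega
  · intro l hl
    obtain ⟨-, ⟨i, hi⟩, hs⟩ := Finset.mem_filter.1 hl
    have hP : ∀ j, μ.rowLen j ≤ ν.rowLen j + (if j = i then 1 else 0) ∧
        ν.rowLen (j + 1) + (if j = i then 1 else 0) ≤ μ.rowLen j := by
      intro j
      have h1 := hi j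
      have h2 := hs j
      omega
    refine ⟨i, Finset.mem_filter.2 ⟨Finset.mem_range.2 ?_, hP⟩, rowLen_ext fun j => ?_⟩
    · by_contra hlt
      have h1 := (hP i).2
      have h2 := μ.rowLen_anti N i (by omega)
      simp only [if_true] at h1
      omega
    · rw [hrow i hP]
      have := hi j
      omega

open Classical in
/-- The local form of the commutation of adding a box and removing a horizontal strip. If `ν` is
itself a horizontal strip over `μ`, a box of `ν` in row `i + 1` corresponds to a box of `μ` in
row `i`; otherwise at most one row is possible, the same for both. -/
theorem card_isBox_commute (μ ν : YoungDiagram) :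
    ((partitions (ν.card + 1)).filter fun l => IsBox ν l ∧ IsHStrip μ l).card =
      ((partitions (μ.card - 1)).filter fun l => IsBox l μ ∧ IsHStrip l ν).card +
        if IsHStrip μ ν then 1 else 0 := by
  obtain ⟨N, hμ, hν⟩ : ∃ N, μ.rowLen N = 0 ∧ ν.rowLen N = 0 := by
    refine ⟨max (μ.colLen 0) (ν.colLen 0), ?_, ?_⟩ <;> rw [rowLen_eq_zero_iff] <;> simp
  rw [card_isBox_isHStrip μ ν hμ hν, card_isBox_isHStrip' μ ν hμ]
  by_cases hs : IsHStrip μ ν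
  -- If `ν / μ` is a horizontal strip, row `i + 1` of `ν` matches row `i` of `μ`, and row `0` of
  -- `ν`, where a box can always be added, gives the correction.
  · rw [if_pos hs, Finset.card_filter, Finset.card_filter, Finset.sum_range_succ',
      Finset.sum_range_succ]
    have h0 : ∀ j, μ.rowLen j ≤ ν.rowLen j + (if j = 0 then 1 else 0) ∧
        ν.rowLen (j + 1) + (if j + 1 = 0 then 1 else 0) ≤ μ.rowLen j := by
      intro j
      have := hs j
      have h1 : ¬ (j + 1 = 0) := by omega
      simp only [h1, if_false]
      omega
    have hN : ¬ ∀ j, μ.rowLen j ≤ ν.rowLen j + (if j = N then 1 else 0) ∧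
        ν.rowLen (j + 1) + (if j = N then 1 else 0) ≤ μ.rowLen j := by
      intro h
      have := (h N).2
      simp only [if_true] at this
      omega
    rw [if_pos h0, if_neg hN, add_zero]
    congr 1
    refine Finset.sum_congr rfl fun i _ => ?_
    congr 1
    rw [eq_iff_iff]
    refine forall_congr' fun j => ?_
    have := hs j
    have h1 : (j + 1 = i + 1) ↔ j = i := by omega
    simp only [h1]
    split_ifs <;> omega
  · rw [if_neg hs, add_zero]
    congr 1
    refine Finset.filter_congr fun i _ => ?_
    -- The interlacing fails in some row `k`; the new box has to repair it, hence lies in row `k`.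
    rw [IsHStrip, not_forall] at hs
    obtain ⟨k, hk⟩ := hs
    constructor
    · intro h j
      have h1 := h k
      have h2 := h j
      have hki : k = i := by
        by_contra hne
        simp only [hne, if_false] at h1
        omega
      subst hki
      have h3 := ν.rowLen_anti k (k + 1) (by omega)
      refine ⟨h2.1, ?_⟩
      by_cases hj : j = k
      · subst hj
        simp only [if_true] at h1 ⊢
        omega
      · simp only [hj, if_false]
        omega
    · intro h j
      have h1 := h k
      have h2 := h j
      have hki : k = i := by
        by_contra hne
        simp only [hne, if_false] at h1
        omega
      subst hki
      refine ⟨h2.1, ?_⟩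
      by_cases hj : j + 1 = k
      · have h3 := μ.rowLen_anti j k (by omega)
        simp only [hj, if_true] at h1 ⊢
        omega
      · simp only [hj, if_false]
        omega

theorem stripSum_zero (c : YoungDiagram → ℤ) (μ : YoungDiagram) : stripSum c 0 μ = c μ := by
  classical
  rw [stripSum]
  refine Finset.sum_eq_single_of_mem μ ?_ ?_ |>.trans rfl
  · exact Finset.mem_filter.2
      ⟨mem_partitions.2 rfl, fun i => ⟨le_rfl, μ.rowLen_anti _ _ (by omega)⟩⟩
  · intro l hl hne
    obtain ⟨h1, h2⟩ := Finset.mem_filter.1 hl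
    rw [mem_partitions] at h1
    refine absurd (YoungDiagram.ext ?_) hne
    exact (Finset.eq_of_subset_of_card_le (YoungDiagram.cells_subset_iff.2 h2.le) h1.le).symm

/-- Adding a box and removing horizontal strips commute up to a correction, since
`t₁ + t₂ + ⋯` becomes `t₁ + t₂ + ⋯ + t` when the variable `t` is added. -/
theorem stripSum_boxSum (c : YoungDiagram → ℤ) (j : ℕ) (μ : YoungDiagram) :
    stripSum (boxSum c) (j + 1) μ = boxSum (stripSum c (j + 1)) μ + stripSum c j μ := by
  classical
  -- Both sides are sums over the diagrams `ν` with `|μ| + j` cells; the multiplicities of `c ν` are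
  -- compared by `card_isBox_commute`.
  have hL : stripSum (boxSum c) (j + 1) μ = ∑ ν ∈ partitions (μ.card + j),
      (((partitions (ν.card + 1)).filter fun l => IsBox ν l ∧ IsHStrip μ l).card : ℤ) * c ν := by
    have h1 : ∀ l ∈ partitions (μ.card + (j + 1)), (if IsHStrip μ l then boxSum c l else 0) =
        ∑ ν ∈ partitions (μ.card + j), if IsBox ν l ∧ IsHStrip μ l then c ν else 0 := by
      intro l hl
      rw [mem_partitions] at hl
      rw [boxSum, hl, Finset.sum_filter]
      split_ifs with h
      · simp only [h, and_true]
        rfl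
      · simp only [h, and_false, if_false, Finset.sum_const_zero]
    rw [stripSum, Finset.sum_filter, Finset.sum_congr rfl h1, Finset.sum_comm]
    refine Finset.sum_congr rfl fun ν hν => ?_
    rw [mem_partitions] at hν
    rw [Finset.card_filter, Nat.cast_sum, Finset.sum_mul, hν]
    refine Finset.sum_congr rfl fun l _ => ?_
    split_ifs <;> simp
  have hR : boxSum (stripSum c (j + 1)) μ = ∑ ν ∈ partitions (μ.card + j),
      (((partitions (μ.card - 1)).filter fun l => IsBox l μ ∧ IsHStrip l ν).card : ℤ) * c ν := by
    have h1 : ∀ l ∈ partitions (μ.card - 1), (if IsBox l μ then stripSum c (j + 1) l else 0) =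
        ∑ ν ∈ partitions (μ.card + j), if IsBox l μ ∧ IsHStrip l ν then c ν else 0 := by
      intro l _
      split_ifs with h
      · have : l.card + (j + 1) = μ.card + j := by rw [h.card]; ring
        rw [stripSum, this, Finset.sum_filter]
        simp only [h, true_and]
      · simp only [h, false_and, if_false, Finset.sum_const_zero]
    rw [boxSum, Finset.sum_filter, Finset.sum_congr rfl h1, Finset.sum_comm]
    refine Finset.sum_congr rfl fun ν _ => ?_
    rw [Finset.card_filter, Nat.cast_sum, Finset.sum_mul]
    refine Finset.sum_congr rfl fun l _ => ?_
    split_ifs <;> simp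
  rw [hL, hR, stripSum, Finset.sum_filter, ← Finset.sum_add_distrib]
  refine Finset.sum_congr rfl fun ν _ => ?_
  rw [card_isBox_commute]
  split_ifs <;> push_cast <;> ring

theorem boxSum_bot (c : YoungDiagram → ℤ) : boxSum c ⊥ = 0 := by
  classical
  rw [boxSum]
  refine Finset.sum_eq_zero fun ν hν => ?_
  have := (Finset.mem_filter.1 hν).2.card
  simp [YoungDiagram.card] at this

theorem boxSum_smul (a : ℤ) (c : YoungDiagram → ℤ) (μ : YoungDiagram) :
    boxSum (fun l => a * c l) μ = a * boxSum c μ := by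
  simp only [boxSum, Finset.mul_sum]

/-- The coefficients of `(t₁ + ⋯ + t_d) ∏ φ(t_k)`. -/
theorem schurSum_boxSum {c : YoungDiagram → ℤ} {φ : ℕ → ℤ}
    (h : ∀ j μ, stripSum c j μ = φ j * c μ) (d : ℕ) (α : Fin d → ℕ) :
    schurSum d (boxSum c) α =
      (∑ k, if α k = 0 then 0 else ∏ i, φ (α i - if i = k then 1 else 0)) * c ⊥ := by
  induction d with
  | zero => simp [schurSum_zero, boxSum_bot]
  | succ d ih =>
    rw [schurSum_succ, Fin.sum_univ_castSucc]
    have h1 : ∀ k : Fin d, (∏ i : Fin (d + 1), φ (α i - if i = k.castSucc then 1 else 0)) =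
        φ (α (Fin.last d)) * ∏ i : Fin d, φ (α i.castSucc - if i = k then 1 else 0) := by
      intro k
      rw [Fin.prod_univ_castSucc, if_neg (Fin.castSucc_lt_last k).ne', mul_comm]
      simp
    have h2 : (∏ i : Fin (d + 1), φ (α i - if i = Fin.last d then 1 else 0)) =
        φ (α (Fin.last d) - 1) * ∏ i : Fin d, φ (α i.castSucc) := by
      rw [Fin.prod_univ_castSucc, if_pos rfl, mul_comm]
      congr 1
      refine Finset.prod_congr rfl fun i _ => ?_
      rw [if_neg (Fin.castSucc_lt_last i).ne, Nat.sub_zero]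
    rw [h2, Finset.sum_congr rfl fun k _ => by rw [h1 k]]
    have hc : ∀ j, stripSum c j = fun μ => φ j * c μ := fun j => funext fun μ => h j μ
    rcases hj : α (Fin.last d) with _ | j
    · have hb : stripSum (boxSum c) 0 = fun μ => 1 * boxSum c μ := by
        funext μ
        rw [stripSum_zero, one_mul]
      have hφ : φ 0 * c ⊥ = c ⊥ := by rw [← h, stripSum_zero]
      rw [hb, schurSum_smul, ih, if_pos rfl, add_zero, Finset.sum_mul, one_mul, Finset.sum_mul]
      refine Finset.sum_congr rfl fun k _ => ?_
      split_ifs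
      · rfl
      · rw [mul_right_comm, hφ, mul_comm]
    · have hb : stripSum (boxSum c) (j + 1) =
          fun μ => φ (j + 1) * boxSum c μ + φ j * c μ := by
        funext μ
        rw [stripSum_boxSum, hc, hc, boxSum_smul]
      rw [hb, schurSum_add, schurSum_smul, schurSum_smul, ih, schurSum_eq_prod h, if_neg (by omega),
        Nat.add_sub_cancel, add_mul, ← mul_assoc, ← mul_assoc, Finset.mul_sum]
      congr 2
      refine Finset.sum_congr rfl fun k _ => ?_
      split_ifs <;> simp

/-! ### The Schur coefficients of the powers of `∏ (1 + t) / (1 - t)` -/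

/-- The row lengths of `μ`, enlarged by `a`, `b`, `r`, `s` in the rows `0`, `1`, `q`, `p`. -/
def enlargedRows (μ : YoungDiagram) (a b q r p s : ℕ) (i : ℕ) : ℕ :=
  μ.rowLen i + ((if i = 0 then a else 0) + (if i = 1 then b else 0) + (if i = q then r else 0) +
    (if i = p then s else 0))

theorem card_of_rowLen_eq {μ l : YoungDiagram} {a b q r p s : ℕ}
    (h : ∀ i, l.rowLen i = enlargedRows μ a b q r p s i) : l.card = μ.card + (a + b + r + s) := by
  let N := l.colLen 0 + μ.colLen 0 + p + q + 2
  have hN : l.rowLen N = 0 := rowLen_eq_zero_iff.2 (by omega)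
  have hN' : μ.rowLen N = 0 := rowLen_eq_zero_iff.2 (by omega)
  rw [card_eq_sum_rowLen l hN, card_eq_sum_rowLen μ hN', Finset.sum_congr rfl fun i _ => h i]
  unfold enlargedRows
  rw [Finset.sum_add_distrib, Finset.sum_add_distrib, Finset.sum_add_distrib,
    Finset.sum_add_distrib]
  simp only [Finset.sum_ite_eq', Finset.mem_range]
  rw [if_pos (by omega), if_pos (by omega), if_pos (by omega), if_pos (by omega)]

theorem rowLen_ofRows_enlargedRows {μ : YoungDiagram} {a b q r p s : ℕ}
    (h : ∀ i, enlargedRows μ a b q r p s (i + 1) ≤ μ.rowLen i) (i : ℕ) :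
    (ofRows (enlargedRows μ a b q r p s)).rowLen i = enlargedRows μ a b q r p s i := by
  refine rowLen_ofRows (antitone_nat_of_succ_le fun i => (h i).trans ?_) (N := μ.colLen 0 + 1) ?_ i
  · simp [enlargedRows]
  · have := h (μ.colLen 0)
    rw [rowLen_colLen_zero] at this
    omega

theorem isHStrip_ofRows_enlargedRows {μ : YoungDiagram} {a b q r p s : ℕ}
    (h : ∀ i, enlargedRows μ a b q r p s (i + 1) ≤ μ.rowLen i) :
    IsHStrip μ (ofRows (enlargedRows μ a b q r p s)) := by
  intro i
  rw [rowLen_ofRows_enlargedRows h, rowLen_ofRows_enlargedRows h]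
  exact ⟨by simp [enlargedRows], h i⟩

theorem colLen_eq_of_rowLen {l : YoungDiagram} {j n : ℕ} (h : ∀ i, i < n ↔ j < l.rowLen i) :
    l.colLen j = n := by
  have h1 := h (l.colLen j)
  have h2 := h n
  rw [lt_rowLen_iff] at h1 h2
  omega

theorem stripSum_eq_sum {ι : Type*} (c : YoungDiagram → ℤ) (j : ℕ) (μ : YoungDiagram)
    (S : Finset ι) (f : ι → YoungDiagram)
    (hf : ∀ x ∈ S, IsHStrip μ (f x) ∧ (f x).card = μ.card + j)
    (hinj : ∀ x ∈ S, ∀ y ∈ S, f x = f y → x = y)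
    (hsurj : ∀ l, IsHStrip μ l → l.card = μ.card + j → c l ≠ 0 → ∃ x ∈ S, f x = l) :
    stripSum c j μ = ∑ x ∈ S, c (f x) := by
  classical
  rw [stripSum, ← Finset.sum_image (f := c) (g := f) hinj]
  symm
  refine Finset.sum_subset ?_ ?_
  · intro l hl
    obtain ⟨x, hx, rfl⟩ := Finset.mem_image.1 hl
    exact Finset.mem_filter.2 ⟨mem_partitions.2 (hf x hx).2, (hf x hx).1⟩
  · intro l hl hl'
    by_contra hne
    obtain ⟨h1, h2⟩ := Finset.mem_filter.1 hl
    obtain ⟨x, hx, rfl⟩ := hsurj l h2 (mem_partitions.1 h1) hne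
    exact hl' (Finset.mem_image_of_mem f hx)

/-- The Schur coefficients of `1`. -/
def coeffOne (μ : YoungDiagram) : ℤ := if μ.rowLen 0 = 0 then 1 else 0

/-- The Schur coefficients of `P = ∏ (1 + t) / (1 - t)`: all hooks have coefficient `2`. -/
def coeffP (μ : YoungDiagram) : ℤ :=
  if μ.rowLen 0 = 0 then 1 else if μ.rowLen 1 ≤ 1 then 2 else 0

/-- The Schur coefficients of `P ^ 2`. -/
def coeffPSq (μ : YoungDiagram) : ℤ :=
  if μ.rowLen 0 = 0 then 1
  else if μ.rowLen 1 ≤ 1 then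
    4 * (2 * (μ.rowLen 0 : ℤ) * μ.colLen 0 - μ.rowLen 0 - μ.colLen 0 + 1)
  else if μ.rowLen 2 ≤ 2 then
    16 * ((μ.rowLen 0 : ℤ) - μ.rowLen 1 + 1) * ((μ.colLen 0 : ℤ) - μ.colLen 1 + 1)
  else 0

/-- The coefficients of `(1 + t) / (1 - t)`. -/
def seriesP (j : ℕ) : ℤ := if j = 0 then 1 else 2

/-- The coefficients of `((1 + t) / (1 - t)) ^ 2`. -/
def seriesPSq (j : ℕ) : ℤ := if j = 0 then 1 else 4 * j

/-- The horizontal strips over a diagram without cells. -/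
theorem stripSum_of_rowLen_zero (c : YoungDiagram → ℤ) (j : ℕ) {μ : YoungDiagram}
    (hμ : μ.rowLen 0 = 0) : stripSum c j μ = c (ofRows (enlargedRows μ j 0 0 0 0 0)) := by
  have h0 : ∀ i, μ.rowLen i = 0 := fun i => by
    have := μ.rowLen_anti 0 i (Nat.zero_le i)
    omega
  have h : ∀ i, enlargedRows μ j 0 0 0 0 0 (i + 1) ≤ μ.rowLen i := by
    intro i
    simp [enlargedRows, h0]
  rw [stripSum_eq_sum c j μ {()} (fun _ => ofRows (enlargedRows μ j 0 0 0 0 0))]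
  · simp
  · intro _ _
    refine ⟨isHStrip_ofRows_enlargedRows h, ?_⟩
    rw [card_of_rowLen_eq (rowLen_ofRows_enlargedRows h)]
    simp
  · simp
  · intro l hs hl _
    refine ⟨(), by simp, rowLen_ext fun i => ?_⟩
    have hr : ∀ i, l.rowLen i = enlargedRows μ (l.rowLen 0) 0 0 0 0 0 i := by
      intro i
      rcases i with _ | i
      · simp [enlargedRows, h0]
      · have := (hs i).2
        rw [h0] at this
        simp [enlargedRows, h0]
        omega
    have hcard := card_of_rowLen_eq hr
    have : l.rowLen 0 = j := by omega
    rw [rowLen_ofRows_enlargedRows h, hr, this]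

/-- The horizontal strips over a single row. -/
theorem stripSum_of_row (c : YoungDiagram → ℤ) (j : ℕ) {μ : YoungDiagram}
    (hμ : μ.rowLen 1 = 0) : stripSum c j μ =
      ∑ b ∈ (Finset.range (μ.rowLen 0 + 1)).filter (· ≤ j),
        c (ofRows (enlargedRows μ (j - b) b 0 0 0 0)) := by
  have h0 : ∀ i, μ.rowLen (i + 1) = 0 := fun i => by
    have := μ.rowLen_anti 1 (i + 1) (by omega)
    omega
  have h : ∀ b ∈ (Finset.range (μ.rowLen 0 + 1)).filter (· ≤ j),
      ∀ i, enlargedRows μ (j - b) b 0 0 0 0 (i + 1) ≤ μ.rowLen i := by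
    intro b hb i
    simp only [Finset.mem_filter, Finset.mem_range] at hb
    rcases i with _ | i <;> simp [enlargedRows, h0]
    omega
  refine stripSum_eq_sum c j μ _ (fun b => ofRows (enlargedRows μ (j - b) b 0 0 0 0)) ?_ ?_ ?_
  · intro b hb
    refine ⟨isHStrip_ofRows_enlargedRows (h b hb), ?_⟩
    rw [card_of_rowLen_eq (rowLen_ofRows_enlargedRows (h b hb))]
    simp only [Finset.mem_filter, Finset.mem_range] at hb
    omega
  · intro b hb b' hb' heq
    have h1 := rowLen_ofRows_enlargedRows (h b hb) 1
    rw [heq, rowLen_ofRows_enlargedRows (h b' hb') 1] at h1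
    simp [enlargedRows] at h1
    exact h1.symm
  · intro l hs hl _
    have h1 := hs 0
    have hr : ∀ i, l.rowLen i =
        enlargedRows μ (l.rowLen 0 - μ.rowLen 0) (l.rowLen 1) 0 0 0 0 i := by
      intro i
      rcases i with _ | _ | i
      · simp [enlargedRows]
        omega
      · simp [enlargedRows, h0]
      · have := (hs (i + 1)).2
        rw [h0] at this
        simp [enlargedRows, h0]
        omega
    have hcard := card_of_rowLen_eq hr
    have hb : l.rowLen 1 ∈ (Finset.range (μ.rowLen 0 + 1)).filter (· ≤ j) := by
      simp only [Finset.mem_filter, Finset.mem_range]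
      simp only [zero_add] at h1
      omega
    have ha : j - l.rowLen 1 = l.rowLen 0 - μ.rowLen 0 := by omega
    refine ⟨l.rowLen 1, hb, rowLen_ext fun i => ?_⟩
    have := h _ hb
    rw [ha] at this ⊢
    rw [rowLen_ofRows_enlargedRows this]
    exact (hr i).symm

/-- The horizontal strips over a hook with at least two rows. -/
theorem stripSum_of_hook (c : YoungDiagram → ℤ) (j : ℕ) {μ : YoungDiagram}
    (hμ : μ.rowLen 1 = 1) : stripSum c j μ =
      ∑ x ∈ (Finset.range 2 ×ˢ Finset.range (μ.rowLen 0)).filter (fun x => x.1 + x.2 ≤ j),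
        c (ofRows (enlargedRows μ (j - (x.1 + x.2)) x.2 0 0 (μ.colLen 0) x.1)) := by
  have h0 : ∀ i, μ.rowLen (i + 1) ≤ 1 := fun i => by
    have := μ.rowLen_anti 1 (i + 1) (by omega)
    omega
  have hp : ∀ i, 0 < μ.rowLen i ↔ i < μ.colLen 0 := fun i => lt_rowLen_iff
  have hp1 : 1 < μ.colLen 0 := by rw [← hp, hμ]; omega
  have h00 := μ.rowLen_anti 0 1 (by omega)
  have h : ∀ x ∈ (Finset.range 2 ×ˢ Finset.range (μ.rowLen 0)).filter (fun x => x.1 + x.2 ≤ j),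
      ∀ i, enlargedRows μ (j - (x.1 + x.2)) x.2 0 0 (μ.colLen 0) x.1 (i + 1) ≤ μ.rowLen i := by
    intro x hx i
    simp only [Finset.mem_filter, Finset.mem_product, Finset.mem_range] at hx
    have h1 := hp i
    have h2 := hp (i + 1)
    have h3 := h0 i
    rcases i with _ | i
    · simp [enlargedRows, hμ]
      split_ifs <;> omega
    · simp [enlargedRows]
      split_ifs <;> omega
  refine stripSum_eq_sum c j μ _ (fun x : ℕ × ℕ => ofRows
    (enlargedRows μ (j - (x.1 + x.2)) x.2 0 0 (μ.colLen 0) x.1)) ?_ ?_ ?_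
  · intro x hx
    refine ⟨isHStrip_ofRows_enlargedRows (h x hx), ?_⟩
    rw [card_of_rowLen_eq (rowLen_ofRows_enlargedRows (h x hx))]
    simp only [Finset.mem_filter] at hx
    omega
  · intro x hx y hy heq
    have h1 := rowLen_ofRows_enlargedRows (h x hx) 1
    have h2 := rowLen_ofRows_enlargedRows (h x hx) (μ.colLen 0)
    rw [heq, rowLen_ofRows_enlargedRows (h y hy)] at h1 h2
    have h3 : ¬ (1 = μ.colLen 0) := by omega
    have h4 : ¬ (μ.colLen 0 = 1) := by omega
    have h5 : ¬ (μ.colLen 0 = 0) := by omega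
    simp only [enlargedRows, h3, h4, h5, one_ne_zero, if_true, if_false] at h1 h2
    ext <;> omega
  · intro l hs hl _
    have h1 := hs 0
    have h2 := hs (μ.colLen 0 - 1)
    have h3 := hp (μ.colLen 0 - 1)
    have h4 : μ.colLen 0 - 1 + 1 = μ.colLen 0 := by omega
    have h5 := hp (μ.colLen 0)
    have h6 := h0 (μ.colLen 0 - 2)
    have h7 : μ.colLen 0 - 2 + 1 = μ.colLen 0 - 1 := by omega
    rw [h4] at h2
    rw [h7] at h6
    have hr : ∀ i, l.rowLen i = enlargedRows μ (l.rowLen 0 - μ.rowLen 0) (l.rowLen 1 - 1) 0 0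
        (μ.colLen 0) (l.rowLen (μ.colLen 0)) i := by
      intro i
      rcases i with _ | _ | i
      · have : ¬ (0 = μ.colLen 0) := by omega
        simp [enlargedRows, this]
        omega
      · have : ¬ (1 = μ.colLen 0) := by omega
        have := hs 1
        simp [enlargedRows, *]
        omega
      · have h8 : l.rowLen (i + 2) ≤ μ.rowLen (i + 1) := (hs (i + 1)).2
        have h9 := (hs (i + 2)).1
        have h10 := h0 i
        have h11 := hp (i + 1)
        have h12 := hp (i + 2)
        change l.rowLen (i + 2) = enlargedRows _ _ _ _ _ _ _ (i + 2)
        simp [enlargedRows]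
        split_ifs with hi
        · rw [← hi] at h5 ⊢
          omega
        · omega
    have hcard := card_of_rowLen_eq hr
    simp only [zero_add] at h1
    have hl1 := hs 1
    have hb : (l.rowLen (μ.colLen 0), l.rowLen 1 - 1) ∈
        (Finset.range 2 ×ˢ Finset.range (μ.rowLen 0)).filter (fun x => x.1 + x.2 ≤ j) := by
      simp only [Finset.mem_filter, Finset.mem_product, Finset.mem_range]
      omega
    have ha : j - (l.rowLen (μ.colLen 0) + (l.rowLen 1 - 1)) = l.rowLen 0 - μ.rowLen 0 := by omega
    refine ⟨_, hb, rowLen_ext fun i => ?_⟩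
    have := h _ hb
    simp only [ha] at this ⊢
    rw [rowLen_ofRows_enlargedRows this]
    exact (hr i).symm

/-- The horizontal strips over a diagram that contains `(2, 2)` but not `(3, 3, 3)`. In the row
below the rows of length `2` and in the row below the last one, at most one box is added; if these
rows coincide, there are three choices instead of four. -/
theorem stripSum_of_fat (c : YoungDiagram → ℤ) (hc : ∀ l, 2 ≤ l.rowLen 1 → 3 ≤ l.rowLen 2 → c l = 0)
    (j : ℕ) {μ : YoungDiagram} (hμ : 2 ≤ μ.rowLen 1) (hμ2 : μ.rowLen 2 ≤ 2) : stripSum c j μ =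
      ∑ x ∈ ((Finset.range 2 ×ˢ Finset.range 2) ×ˢ
          Finset.range (μ.rowLen 0 - μ.rowLen 1 + 1)).filter
          (fun x => x.1.1 + x.1.2 + x.2 ≤ j ∧ (μ.colLen 1 = μ.colLen 0 → x.1.1 ≤ x.1.2)),
        c (ofRows (enlargedRows μ (j - (x.1.1 + x.1.2 + x.2)) x.2 (μ.colLen 1) x.1.1
          (μ.colLen 0) x.1.2)) := by
  have h0 : ∀ i, μ.rowLen (i + 2) ≤ 2 := fun i => by
    have := μ.rowLen_anti 2 (i + 2) (by omega)
    omega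
  have hp : ∀ i, 0 < μ.rowLen i ↔ i < μ.colLen 0 := fun i => lt_rowLen_iff
  have hq : ∀ i, 1 < μ.rowLen i ↔ i < μ.colLen 1 := fun i => lt_rowLen_iff
  set p := μ.colLen 0
  set q := μ.colLen 1
  have hq1 : 1 < q := by rw [← hq]; omega
  have hpq : q ≤ p := μ.colLen_anti 0 1 (by omega)
  have h00 := μ.rowLen_anti 0 1 (by omega)
  have h : ∀ x ∈ ((Finset.range 2 ×ˢ Finset.range 2) ×ˢ
          Finset.range (μ.rowLen 0 - μ.rowLen 1 + 1)).filter
          (fun x => x.1.1 + x.1.2 + x.2 ≤ j ∧ (q = p → x.1.1 ≤ x.1.2)),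
      ∀ i, enlargedRows μ (j - (x.1.1 + x.1.2 + x.2)) x.2 q x.1.1 p x.1.2 (i + 1)
        ≤ μ.rowLen i := by
    intro x hx i
    simp only [Finset.mem_filter, Finset.mem_product, Finset.mem_range] at hx
    have h1 := hp (i + 1)
    have h2 := hq (i + 1)
    have h3 := hp i
    have h4 := hq i
    have h5 := μ.rowLen_anti i (i + 1) (by omega)
    rcases i with _ | i
    · simp [enlargedRows]
      split_ifs <;> omega
    · have h6 := h0 i
      simp [enlargedRows]
      split_ifs <;> omega
  refine stripSum_eq_sum c j μ _ (fun x : (ℕ × ℕ) × ℕ => ofRows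
    (enlargedRows μ (j - (x.1.1 + x.1.2 + x.2)) x.2 q x.1.1 p x.1.2)) ?_ ?_ ?_
  · intro x hx
    refine ⟨isHStrip_ofRows_enlargedRows (h x hx), ?_⟩
    rw [card_of_rowLen_eq (rowLen_ofRows_enlargedRows (h x hx))]
    simp only [Finset.mem_filter] at hx
    omega
  · intro x hx y hy heq
    have h1 := rowLen_ofRows_enlargedRows (h x hx) 1
    have h2 := rowLen_ofRows_enlargedRows (h x hx) p
    have h3 := rowLen_ofRows_enlargedRows (h x hx) q
    rw [heq, rowLen_ofRows_enlargedRows (h y hy)] at h1 h2 h3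
    simp only [Finset.mem_filter, Finset.mem_product, Finset.mem_range] at hx hy
    have e1 : ¬ (1 = p) := by omega
    have e2 : ¬ (p = 1) := by omega
    have e3 : ¬ (p = 0) := by omega
    have e4 : ¬ (1 = q) := by omega
    have e5 : ¬ (q = 1) := by omega
    have e6 : ¬ (q = 0) := by omega
    simp only [enlargedRows, e1, e2, e3, e4, e5, e6, one_ne_zero, if_true, if_false] at h1 h2 h3
    have : x.1.1 = y.1.1 ∧ x.1.2 = y.1.2 ∧ x.2 = y.2 := by
      by_cases hpq' : q = p
      · simp only [hpq', if_true] at h2 h3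
        omega
      · have : ¬ (p = q) := fun h => hpq' h.symm
        simp only [hpq', this, if_false] at h2 h3
        omega
    exact Prod.ext (Prod.ext this.1 this.2.1) this.2.2
  · intro l hs hl hne
    have hl1 := hs 1
    have hl2 : l.rowLen 2 ≤ 2 := by
      by_contra hlt
      exact hne (hc l (by omega) (by omega))
    have hl0 : ∀ i, l.rowLen (i + 2) ≤ 2 := fun i => by
      have := l.rowLen_anti 2 (i + 2) (by omega)
      omega
    have hlp : ∀ i, 0 < l.rowLen i ↔ i < l.colLen 0 := fun i => lt_rowLen_iff
    have hlq : ∀ i, 1 < l.rowLen i ↔ i < l.colLen 1 := fun i => lt_rowLen_iff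
    have hlpq : l.colLen 1 ≤ l.colLen 0 := l.colLen_anti 0 1 (by omega)
    set p' := l.colLen 0
    set q' := l.colLen 1
    have b1 : p ≤ p' := by
      have i1 := hp (p - 1)
      have i2 := hs (p - 1)
      have i3 := hlp (p - 1)
      omega
    have b2 : q ≤ q' := by
      have i1 := hq (q - 1)
      have i2 := hs (q - 1)
      have i3 := hlq (q - 1)
      omega
    have b3 : p' ≤ p + 1 := by
      have i1 := hp p
      have i2 := hs p
      have i3 := hlp (p + 1)
      omega
    have b4 : q' ≤ q + 1 := by
      have i1 := hq q
      have i2 := hs q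
      have i3 := hlq (q + 1)
      omega
    have h1 := hs 0
    simp only [zero_add] at h1
    have hr : ∀ i, l.rowLen i = enlargedRows μ (l.rowLen 0 - μ.rowLen 0)
        (l.rowLen 1 - μ.rowLen 1) q (q' - q) p (p' - p) i := by
      intro i
      rcases i with _ | _ | i
      · have e1 : ¬ (0 = p) := by omega
        have e2 : ¬ (0 = q) := by omega
        simp [enlargedRows, e1, e2]
        omega
      · have e1 : ¬ (1 = p) := by omega
        have e2 : ¬ (1 = q) := by omega
        simp [enlargedRows, e1, e2]
        omega
      · have i1 := hp (i + 2)
        have i2 := hq (i + 2)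
        have i3 := hlp (i + 2)
        have i4 := hlq (i + 2)
        have i5 := h0 i
        have i6 := hl0 i
        have i7 := hs (i + 2)
        change l.rowLen (i + 2) = enlargedRows _ _ _ _ _ _ _ (i + 2)
        simp [enlargedRows]
        split_ifs <;> omega
    have hcard := card_of_rowLen_eq hr
    have hb : ((q' - q, p' - p), l.rowLen 1 - μ.rowLen 1) ∈
        ((Finset.range 2 ×ˢ Finset.range 2) ×ˢ
          Finset.range (μ.rowLen 0 - μ.rowLen 1 + 1)).filter
          (fun x => x.1.1 + x.1.2 + x.2 ≤ j ∧ (q = p → x.1.1 ≤ x.1.2)) := by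
      simp only [Finset.mem_filter, Finset.mem_product, Finset.mem_range]
      omega
    have ha : j - (q' - q + (p' - p) + (l.rowLen 1 - μ.rowLen 1)) = l.rowLen 0 - μ.rowLen 0 := by
      omega
    refine ⟨_, hb, rowLen_ext fun i => ?_⟩
    have := h _ hb
    simp only [ha] at this ⊢
    rw [rowLen_ofRows_enlargedRows this]
    exact (hr i).symm

theorem filter_range_le (k j : ℕ) :
    (Finset.range (k + 1)).filter (· ≤ j) = Finset.range (min k j + 1) := by
  ext b
  simp only [Finset.mem_filter, Finset.mem_range]
  omega

theorem sum_range_sub_two_mul (n : ℕ) (x : ℤ) :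
    ∑ b ∈ Finset.range n, (x - 2 * (b : ℤ)) = n * (x - n + 1) := by
  induction n with
  | zero => simp
  | succ n ih =>
    rw [Finset.sum_range_succ, ih]
    push_cast
    ring

theorem IsHStrip.rowLen_zero_le {μ l : YoungDiagram} (h : IsHStrip μ l) :
    μ.rowLen 0 ≤ l.rowLen 0 := (h 0).1

theorem stripSum_eq_zero {c : YoungDiagram → ℤ} {j : ℕ} {μ : YoungDiagram}
    (h : ∀ l, IsHStrip μ l → c l = 0) : stripSum c j μ = 0 := by
  classical
  exact Finset.sum_eq_zero fun l hl => h l (Finset.mem_filter.1 hl).2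

theorem rowLen_ofRows_row (μ : YoungDiagram) (hμ : μ.rowLen 1 = 0) {j b : ℕ} (hb : b ≤ μ.rowLen 0)
    (i : ℕ) : (ofRows (enlargedRows μ j b 0 0 0 0)).rowLen i =
      if i = 0 then μ.rowLen 0 + j else if i = 1 then b else 0 := by
  have h0 : ∀ i, μ.rowLen (i + 1) = 0 := fun i => by
    have := μ.rowLen_anti 1 (i + 1) (by omega)
    omega
  rw [rowLen_ofRows_enlargedRows]
  · rcases i with _ | _ | i <;> simp [enlargedRows, h0]
  · intro i
    rcases i with _ | i <;> simp [enlargedRows, h0]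
    omega

theorem rowLen_ofRows_hook (μ : YoungDiagram) (hμ : μ.rowLen 1 = 1) {j b s : ℕ}
    (hb : b < μ.rowLen 0) (hs : s ≤ 1) (i : ℕ) :
    (ofRows (enlargedRows μ j b 0 0 (μ.colLen 0) s)).rowLen i =
      if i = 0 then μ.rowLen 0 + j else if i = 1 then b + 1 else
        if i < μ.colLen 0 + s then 1 else 0 := by
  have h0 : ∀ i, μ.rowLen (i + 1) ≤ 1 := fun i => by
    have := μ.rowLen_anti 1 (i + 1) (by omega)
    omega
  have hp : ∀ i, 0 < μ.rowLen i ↔ i < μ.colLen 0 := fun i => lt_rowLen_iff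
  have hp1 : 1 < μ.colLen 0 := by rw [← hp, hμ]; omega
  have h1 := hp i
  have h2 := hp (i + 1)
  rw [rowLen_ofRows_enlargedRows]
  · rcases i with _ | _ | i
    · have : ¬ (0 = μ.colLen 0) := by omega
      simp [enlargedRows, this]
    · have : ¬ (1 = μ.colLen 0) := by omega
      simp [enlargedRows, this, hμ, add_comm]
    · have h3 := h0 (i + 1)
      simp only [enlargedRows, show ¬ (i + 1 + 1 = 0) by omega, show ¬ (i + 1 + 1 = 1) by omega,
        if_false]
      split_ifs <;> omega
  · intro i
    have h1 := hp i
    have h2 := hp (i + 1)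
    have h3 := h0 i
    rcases i with _ | i
    · simp [enlargedRows, hμ]
      split_ifs <;> omega
    · simp [enlargedRows]
      split_ifs <;> omega

theorem stripSum_coeffOne (j : ℕ) (μ : YoungDiagram) :
    stripSum coeffOne j μ = (if j = 0 then 1 else 0) * coeffOne μ := by
  by_cases hμ : μ.rowLen 0 = 0
  · rw [stripSum_of_rowLen_zero _ _ hμ, coeffOne, coeffOne, rowLen_ofRows_enlargedRows, if_pos hμ]
    · simp [enlargedRows, hμ]
    · intro i
      have := μ.rowLen_anti 0 (i + 1) (by omega)
      simp [enlargedRows]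
      omega
  · rw [coeffOne, if_neg hμ, mul_zero]
    refine stripSum_eq_zero fun l hl => ?_
    have := hl.rowLen_zero_le
    rw [coeffOne, if_neg (by omega)]

theorem stripSum_coeffP (j : ℕ) (μ : YoungDiagram) :
    stripSum coeffP j μ = seriesP j * coeffP μ := by
  rcases Nat.eq_zero_or_pos j with rfl | hj
  · simp [stripSum_zero, seriesP]
  rw [seriesP, if_neg hj.ne']
  obtain ⟨j, rfl⟩ : ∃ j', j = j' + 1 := ⟨j - 1, by omega⟩
  have h10 := μ.rowLen_anti 0 1 (by omega)
  by_cases hμ : μ.rowLen 0 = 0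
  · have := rowLen_ofRows_row μ (by omega) (j := j + 1) (b := 0) (by omega)
    rw [stripSum_of_rowLen_zero _ _ hμ, coeffP, coeffP, this, this]
    simp [hμ]
  by_cases hμ1 : μ.rowLen 1 = 0
  · obtain ⟨k, hk⟩ : ∃ k, μ.rowLen 0 = k + 1 := ⟨μ.rowLen 0 - 1, by omega⟩
    have hval : ∀ b ∈ Finset.range (min (μ.rowLen 0) (j + 1) + 1),
        coeffP (ofRows (enlargedRows μ (j + 1 - b) b 0 0 0 0)) = if b ≤ 1 then 2 else 0 := by
      intro b hb
      rw [Finset.mem_range] at hb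
      have := rowLen_ofRows_row μ hμ1 (j := j + 1 - b) (b := b) (by omega)
      rw [coeffP, this, this]
      simp [hμ]
    rw [stripSum_of_row _ _ hμ1, filter_range_le, Finset.sum_congr rfl hval, hk,
      Nat.add_min_add_right, Finset.sum_range_succ', Finset.sum_range_succ']
    simp [coeffP, hμ, hμ1]
  by_cases hμ2 : μ.rowLen 1 = 1
  · have hval : ∀ x ∈ (Finset.range 2 ×ˢ Finset.range (μ.rowLen 0)).filter
        (fun x => x.1 + x.2 ≤ j + 1), coeffP (ofRows (enlargedRows μ (j + 1 - (x.1 + x.2)) x.2 0 0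
          (μ.colLen 0) x.1)) = if x.2 = 0 then 2 else 0 := by
      intro x hx
      simp only [Finset.mem_filter, Finset.mem_product, Finset.mem_range] at hx
      have := rowLen_ofRows_hook μ hμ2 (j := j + 1 - (x.1 + x.2)) (b := x.2) (s := x.1)
        (by omega) (by omega)
      rw [coeffP, this, this]
      simp [hμ]
    obtain ⟨k, hk⟩ : ∃ k, μ.rowLen 0 = k + 1 := ⟨μ.rowLen 0 - 1, by omega⟩
    rw [stripSum_of_hook _ _ hμ2, Finset.sum_congr rfl hval, Finset.sum_filter, Finset.sum_product,
      hk, Finset.sum_range_succ, Finset.sum_range_one, Finset.sum_range_succ',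
      Finset.sum_range_succ']
    simp [coeffP, hμ, hμ2]
  · have : coeffP μ = 0 := by
      rw [coeffP, if_neg hμ, if_neg (by omega)]
    rw [this, mul_zero]
    refine stripSum_eq_zero fun l hl => ?_
    have h1 := (hl 0).1
    have h2 := (hl 1).1
    rw [coeffP, if_neg (by omega), if_neg (by omega)]

theorem stripSum_coeffPSq_of_row (j : ℕ) {μ : YoungDiagram} (hμ : μ.rowLen 0 ≠ 0)
    (hμ1 : μ.rowLen 1 = 0) :
    stripSum coeffPSq (j + 1) μ = 4 * ((j : ℤ) + 1) * coeffPSq μ := by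
  obtain ⟨k, hk⟩ : ∃ k, μ.rowLen 0 = k + 1 := ⟨μ.rowLen 0 - 1, by omega⟩
  have hcol : μ.colLen 0 = 1 := colLen_eq_of_rowLen fun i => by
    rcases i with _ | i
    · omega
    · have := μ.rowLen_anti 1 (i + 1) (by omega)
      omega
  have hval : ∀ b ∈ Finset.range (min (μ.rowLen 0) (j + 1) + 1),
      coeffPSq (ofRows (enlargedRows μ (j + 1 - b) b 0 0 0 0)) =
        if b = 0 then 4 * ((k : ℤ) + j + 2) else if b = 1 then 4 * (3 * ((k : ℤ) + j) + 2)
        else 16 * ((k : ℤ) + j + 3 - 2 * b) := by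
    intro b hb
    rw [Finset.mem_range] at hb
    have hr := rowLen_ofRows_row μ hμ1 (j := j + 1 - b) (b := b) (by omega)
    set l := ofRows (enlargedRows μ (j + 1 - b) b 0 0 0 0)
    have hbj : ((j + 1 - b : ℕ) : ℤ) = j + 1 - b := by omega
    rw [coeffPSq, hr, hr, hr, hk]
    by_cases hb0 : b = 0
    · have hc : l.colLen 0 = 1 := colLen_eq_of_rowLen fun i => by
        rw [hr, hk]
        rcases i with _ | _ | i <;> simp [hb0]
      subst hb0
      rw [hc]
      simp
      omega
    have hc : l.colLen 0 = 2 := colLen_eq_of_rowLen fun i => by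
      rw [hr, hk]
      rcases i with _ | _ | i <;> simp
      omega
    by_cases hb1 : b = 1
    · subst hb1
      rw [hc]
      simp
      ring
    · have hc1 : l.colLen 1 = 2 := colLen_eq_of_rowLen fun i => by
        rw [hr, hk]
        rcases i with _ | _ | i <;> simp <;> omega
      rw [hc, hc1]
      simp only [if_true, one_ne_zero, if_false]
      rw [if_neg (by omega), if_neg (by omega), if_pos (by simp), if_neg hb0, if_neg hb1]
      push_cast
      rw [hbj]
      ring
  rw [stripSum_of_row _ _ hμ1, filter_range_le, Finset.sum_congr rfl hval, hk,
    Nat.add_min_add_right, Finset.sum_range_succ', Finset.sum_range_succ', coeffPSq, hμ1, hcol, hk]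
  have hs : ∑ b ∈ Finset.range (min k j), (if b + 1 + 1 = 0 then 4 * ((k : ℤ) + j + 2)
      else if b + 1 + 1 = 1 then 4 * (3 * ((k : ℤ) + j) + 2)
      else 16 * ((k : ℤ) + j + 3 - 2 * ((b + 1 + 1 : ℕ) : ℤ))) =
      16 * ∑ b ∈ Finset.range (min k j), ((k : ℤ) + j - 1 - 2 * b) := by
    rw [Finset.mul_sum]
    refine Finset.sum_congr rfl fun b _ => ?_
    rw [if_neg (by omega), if_neg (by omega)]
    push_cast
    ring
  rw [hs, sum_range_sub_two_mul]
  simp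
  rcases le_total k j with h | h
  · rw [min_eq_left (by exact_mod_cast h)]
    ring
  · rw [min_eq_right (by exact_mod_cast h)]
    ring

theorem stripSum_coeffPSq_of_hook (j : ℕ) {μ : YoungDiagram} (hμ1 : μ.rowLen 1 = 1) :
    stripSum coeffPSq (j + 1) μ = 4 * ((j : ℤ) + 1) * coeffPSq μ := by
  have h10 := μ.rowLen_anti 0 1 (by omega)
  obtain ⟨k, hk⟩ : ∃ k, μ.rowLen 0 = k + 1 := ⟨μ.rowLen 0 - 1, by omega⟩
  have hp1 : 1 < μ.colLen 0 := by rw [← lt_rowLen_iff]; omega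
  set p := μ.colLen 0 with hp
  have hval : ∀ s ≤ 1, ∀ n, s + n = j + 1 → ∀ b ∈ Finset.range (min k n + 1),
      coeffPSq (ofRows (enlargedRows μ (j + 1 - (s + b)) b 0 0 p s)) =
        if b = 0 then 4 * (2 * ((k : ℤ) + 1 + n) * (p + s) - (k + 1 + n) - (p + s) + 1)
        else 16 * ((k : ℤ) + 1 + n - 2 * b) * (p + s - 1) := by
    intro s hs n hn b hb
    rw [Finset.mem_range] at hb
    have hr := rowLen_ofRows_hook μ hμ1 (j := j + 1 - (s + b)) (b := b) (s := s)
      (by omega) (by omega)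
    rw [← hp] at hr
    set l := ofRows (enlargedRows μ (j + 1 - (s + b)) b 0 0 p s)
    have hbj : ((j + 1 - (s + b) : ℕ) : ℤ) = n - b := by omega
    have hc : l.colLen 0 = p + s := colLen_eq_of_rowLen fun i => by
      rw [hr, hk]
      split_ifs <;> omega
    have r0 : l.rowLen 0 = k + 1 + (j + 1 - (s + b)) := by rw [hr, hk, if_pos rfl]
    have r1 : l.rowLen 1 = b + 1 := by rw [hr, if_neg one_ne_zero, if_pos rfl]
    have r2 : l.rowLen 2 ≤ 2 := by
      rw [hr, if_neg (by omega), if_neg (by omega)]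
      split_ifs <;> omega
    rw [coeffPSq, hc, r0, r1]
    by_cases hb0 : b = 0
    · subst hb0
      rw [if_neg (by omega), if_pos (by omega), if_pos rfl]
      push_cast
      rw [hbj]
      push_cast
      ring
    · have hbk : b ≤ k := by omega
      have hc1 : l.colLen 1 = 2 := colLen_eq_of_rowLen fun i => by
        rw [hr, hk]
        rcases i with _ | _ | i <;> simp
        · omega
        · omega
        · split_ifs <;> omega
      rw [hc1, if_neg (by omega), if_neg (by omega), if_pos r2, if_neg hb0]
      push_cast
      rw [hbj]
      ring
  have hsum : ∀ s ≤ 1, ∀ n, s + n = j + 1 →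
      (∑ b ∈ Finset.range (k + 1), if s + b ≤ j + 1 then
        coeffPSq (ofRows (enlargedRows μ (j + 1 - (s + b)) b 0 0 p s)) else 0) =
      16 * (n * k) * (p + s - 1) +
        4 * (2 * ((k : ℤ) + 1 + n) * (p + s) - (k + 1 + n) - (p + s) + 1) := by
    intro s hs n hn
    have e1 : ∀ b, s + b ≤ j + 1 ↔ b ≤ n := fun b => by omega
    simp only [e1]
    rw [← Finset.sum_filter, filter_range_le, Finset.sum_congr rfl (hval s hs n hn),
      Finset.sum_range_succ', if_pos rfl]
    congr 1
    have e2 : ∀ b ∈ Finset.range (min k n), (if b + 1 = 0 then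
        4 * (2 * ((k : ℤ) + 1 + n) * (p + s) - (k + 1 + n) - (p + s) + 1)
        else 16 * ((k : ℤ) + 1 + n - 2 * ((b + 1 : ℕ) : ℤ)) * (p + s - 1)) =
        16 * (((k : ℤ) + n - 1) - 2 * b) * (p + s - 1) := by
      intro b _
      rw [if_neg (by omega)]
      push_cast
      ring
    rw [Finset.sum_congr rfl e2, ← Finset.sum_mul, ← Finset.mul_sum, sum_range_sub_two_mul]
    rcases le_total k n with h | h
    · rw [min_eq_left h]
      ring
    · rw [min_eq_right h]
      ring
  rw [stripSum_of_hook _ _ hμ1, Finset.sum_filter, Finset.sum_product, Finset.sum_range_succ,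
    Finset.sum_range_one]
  simp only
  rw [hk, ← hp, hsum 0 (by omega) (j + 1) (by omega), hsum 1 le_rfl j (by omega), coeffPSq, hμ1,
    ← hp, hk, if_neg (by omega), if_pos le_rfl]
  push_cast
  ring

theorem stripSum_coeffPSq_of_fat (j : ℕ) {μ : YoungDiagram} (hμ : 2 ≤ μ.rowLen 1)
    (hμ2 : μ.rowLen 2 ≤ 2) :
    stripSum coeffPSq (j + 1) μ = 4 * ((j : ℤ) + 1) * coeffPSq μ := by
  have h0 : ∀ i, 2 ≤ i → μ.rowLen i ≤ 2 := fun i hi => (μ.rowLen_anti 2 i hi).trans hμ2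
  have hp : ∀ i, 0 < μ.rowLen i ↔ i < μ.colLen 0 := fun i => lt_rowLen_iff
  have hq : ∀ i, 1 < μ.rowLen i ↔ i < μ.colLen 1 := fun i => lt_rowLen_iff
  have h10 := μ.rowLen_anti 0 1 (by omega)
  have hpq : μ.colLen 1 ≤ μ.colLen 0 := μ.colLen_anti 0 1 (by omega)
  rw [stripSum_of_fat coeffPSq (fun l h1 h2 => by
    have := l.rowLen_anti 0 1 (by omega)
    rw [coeffPSq, if_neg (by omega), if_neg (by omega), if_neg (by omega)]) _ hμ hμ2]
  set p := μ.colLen 0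
  set q := μ.colLen 1
  have hq1 : 1 < q := by rw [← hq]; omega
  obtain ⟨D, hD⟩ : ∃ D, μ.rowLen 0 = μ.rowLen 1 + D := ⟨_, (Nat.add_sub_cancel' h10).symm⟩
  have hD' : μ.rowLen 0 - μ.rowLen 1 = D := by omega
  rw [hD']
  -- `b` is the number of boxes added in row `1`, and `r`, `s` count those in the rows `q` and `p`;
  -- `n` boxes remain for the first two rows.
  have hval : ∀ r ≤ 1, ∀ s ≤ 1, (q = p → r ≤ s) → ∀ n, r + s + n = j + 1 →
      ∀ b ∈ Finset.range (min D n + 1),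
      coeffPSq (ofRows (enlargedRows μ (j + 1 - (r + s + b)) b q r p s)) =
        16 * ((D : ℤ) + 1 + n - 2 * b) * (p + s - (q + r) + 1) := by
    intro r hr s hs hrs n hn b hb
    rw [Finset.mem_range] at hb
    have hrow : ∀ i, (ofRows (enlargedRows μ (j + 1 - (r + s + b)) b q r p s)).rowLen i =
        enlargedRows μ (j + 1 - (r + s + b)) b q r p s i := by
      refine rowLen_ofRows_enlargedRows fun i => ?_
      have h1 := hp (i + 1)
      have h2 := hq (i + 1)
      have h3 := hp i
      have h4 := hq i
      have h5 := μ.rowLen_anti i (i + 1) (by omega)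
      rcases i with _ | i
      · simp [enlargedRows]
        split_ifs <;> omega
      · have h6 := h0 (i + 2) (by omega)
        simp [enlargedRows]
        split_ifs <;> omega
    set l := ofRows (enlargedRows μ (j + 1 - (r + s + b)) b q r p s)
    have hbj : ((j + 1 - (r + s + b) : ℕ) : ℤ) = n - b := by omega
    have r0 : l.rowLen 0 = μ.rowLen 0 + (j + 1 - (r + s + b)) := by
      rw [hrow]
      simp [enlargedRows, show ¬ (0 = q) by omega, show ¬ (0 = p) by omega]
    have r1 : l.rowLen 1 = μ.rowLen 1 + b := by
      rw [hrow]
      simp [enlargedRows, show ¬ (1 = q) by omega, show ¬ (1 = p) by omega]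
    have r2 : ∀ i, 2 ≤ i → l.rowLen i = μ.rowLen i + ((if i = q then r else 0) +
        (if i = p then s else 0)) := by
      intro i hi
      rw [hrow]
      simp [enlargedRows, show ¬ (i = 0) by omega, show ¬ (i = 1) by omega]
    have hc : l.colLen 0 = p + s := colLen_eq_of_rowLen fun i => by
      have h1 := hp i
      have h2 := hq i
      rcases i with _ | _ | i
      · omega
      · simp only [zero_add] at h1 h2 ⊢
        omega
      · rw [r2 _ (by omega)]
        split_ifs <;> omega
    have hc1 : l.colLen 1 = q + r := colLen_eq_of_rowLen fun i => by
      have h1 := hp i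
      have h2 := hq i
      rcases i with _ | _ | i
      · omega
      · simp only [zero_add] at h1 h2 ⊢
        omega
      · have h3 := h0 (i + 2) (by omega)
        rw [r2 _ (by omega)]
        split_ifs <;> omega
    have hl2 : l.rowLen 2 ≤ 2 := by
      have h1 := hp 2
      have h2 := hq 2
      rw [r2 _ le_rfl]
      split_ifs <;> omega
    rw [coeffPSq, hc, hc1, if_neg (by omega), if_neg (by omega), if_pos hl2, r0, r1, hD]
    push_cast
    rw [hbj]
    ring
  have hsum : ∀ r ≤ 1, ∀ s ≤ 1, (∑ b ∈ Finset.range (D + 1),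
      if r + s + b ≤ j + 1 ∧ (q = p → r ≤ s) then
        coeffPSq (ofRows (enlargedRows μ (j + 1 - (r + s + b)) b q r p s)) else 0) =
      16 * ((D + 1) * ((j : ℤ) + 2 - r - s)) * (p + s - (q + r) + 1) := by
    intro r hr s hs
    by_cases hrs : q = p → r ≤ s
    · rcases Nat.lt_or_ge (j + 1) (r + s) with hlt | hge
      · have e : (j : ℤ) + 2 - r - s = 0 := by omega
        rw [e, Finset.sum_eq_zero]
        · ring
        · intro b _
          rw [if_neg fun h => by omega]
      · obtain ⟨n, hn⟩ := Nat.exists_eq_add_of_le hge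
        have e1 : ∀ b, (r + s + b ≤ j + 1 ∧ (q = p → r ≤ s)) ↔ b ≤ n :=
          fun b => ⟨fun h => by omega, fun h => ⟨by omega, hrs⟩⟩
        simp only [e1]
        rw [← Finset.sum_filter, filter_range_le,
          Finset.sum_congr rfl (hval r hr s hs hrs n hn.symm), ← Finset.sum_mul, ← Finset.mul_sum,
          sum_range_sub_two_mul]
        have e2 : (j : ℤ) + 2 - r - s = n + 1 := by omega
        rw [e2]
        rcases le_total D n with h | h
        · rw [min_eq_left h]
          push_cast
          ring
        · rw [min_eq_right h]
          push_cast
          ring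
    · have e : (p : ℤ) + s - (q + r) + 1 = 0 := by
        rw [Classical.not_imp] at hrs
        omega
      rw [e, mul_zero]
      refine Finset.sum_eq_zero fun b _ => ?_
      rw [if_neg fun h => hrs h.2]
  rw [Finset.sum_filter, Finset.sum_product, Finset.sum_product]
  have hsum' : ∀ r ∈ Finset.range 2, ∀ s ∈ Finset.range 2, (∑ b ∈ Finset.range (D + 1),
      if r + s + b ≤ j + 1 ∧ (q = p → r ≤ s) then
        coeffPSq (ofRows (enlargedRows μ (j + 1 - (r + s + b)) b q r p s)) else 0) =
      16 * ((D + 1) * ((j : ℤ) + 2 - r - s)) * (p + s - (q + r) + 1) := fun r hr s hs =>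
    hsum r (Nat.le_of_lt_succ (Finset.mem_range.1 hr)) s (Nat.le_of_lt_succ (Finset.mem_range.1 hs))
  refine (Finset.sum_congr rfl fun r hr =>
    Finset.sum_congr rfl fun s hs => hsum' r hr s hs).trans ?_
  have hfat : coeffPSq μ = 16 * ((D : ℤ) + 1) * ((p : ℤ) - q + 1) := by
    rw [coeffPSq, if_neg (by omega), if_neg (by omega), if_pos hμ2, hD]
    push_cast
    ring
  rw [hfat]
  simp only [Finset.sum_range_succ, Finset.sum_range_zero]
  push_cast
  ring

theorem stripSum_coeffPSq (j : ℕ) (μ : YoungDiagram) :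
    stripSum coeffPSq j μ = seriesPSq j * coeffPSq μ := by
  rcases Nat.eq_zero_or_pos j with rfl | hj
  · simp [stripSum_zero, seriesPSq]
  rw [seriesPSq, if_neg hj.ne']
  obtain ⟨j, rfl⟩ : ∃ j', j = j' + 1 := ⟨j - 1, by omega⟩
  push_cast
  have h10 := μ.rowLen_anti 0 1 (by omega)
  by_cases hμ : μ.rowLen 0 = 0
  · have := rowLen_ofRows_row μ (by omega) (j := j + 1) (b := 0) (by omega)
    have hc : (ofRows (enlargedRows μ (j + 1) 0 0 0 0 0)).colLen 0 = 1 :=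
      colLen_eq_of_rowLen fun i => by
        rw [this]
        rcases i with _ | _ | i <;> simp
    rw [stripSum_of_rowLen_zero _ _ hμ, coeffPSq, coeffPSq, this, this, hc]
    simp [hμ]
    ring
  by_cases hμ1 : μ.rowLen 1 = 0
  · exact stripSum_coeffPSq_of_row j hμ hμ1
  by_cases hμ1' : μ.rowLen 1 = 1
  · exact stripSum_coeffPSq_of_hook j hμ1'
  by_cases hμ2 : μ.rowLen 2 ≤ 2
  · exact stripSum_coeffPSq_of_fat j (by omega) hμ2
  · have hz : ∀ l, IsHStrip μ l → coeffPSq l = 0 := by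
      intro l hl
      have h0 := (hl 0).1
      have h1 := (hl 1).1
      have h2 := (hl 2).1
      rw [coeffPSq, if_neg (by omega), if_neg (by omega), if_neg (by omega)]
    rw [stripSum_eq_zero hz, hz μ fun i => ⟨le_rfl, μ.rowLen_anti _ _ (by omega)⟩, mul_zero]

/-! ### The multiplicities -/

/-- The diagram `l` with the last box of row `i` removed. -/
def removeBox (l : YoungDiagram) (i : ℕ) : YoungDiagram :=
  ofRows fun j => l.rowLen j - if j = i then 1 else 0

theorem rowLen_removeBox {l : YoungDiagram} {i : ℕ} (h : l.rowLen (i + 1) < l.rowLen i) (j : ℕ) :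
    (removeBox l i).rowLen j = l.rowLen j - if j = i then 1 else 0 := by
  refine rowLen_ofRows (f := fun j => l.rowLen j - if j = i then 1 else 0)
    (antitone_nat_of_succ_le fun j => ?_) (N := l.colLen 0) ?_ j
  · have := l.rowLen_anti j (j + 1) (by omega)
    by_cases hj : j = i
    · subst hj
      simp
      omega
    · simp only [hj, if_false]
      omega
  · rw [rowLen_colLen_zero]
    simp

theorem colLen_removeBox {l : YoungDiagram} {i : ℕ} (h : l.rowLen (i + 1) < l.rowLen i) (j : ℕ) :
    (removeBox l i).colLen j = l.colLen j - if l.rowLen i = j + 1 then 1 else 0 := by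
  refine colLen_eq_of_rowLen fun k => ?_
  rw [rowLen_removeBox h]
  have h1 : j < l.rowLen k ↔ k < l.colLen j := lt_rowLen_iff
  have h2 : j < l.rowLen i ↔ i < l.colLen j := lt_rowLen_iff
  have h3 : j < l.rowLen (i + 1) ↔ i + 1 < l.colLen j := lt_rowLen_iff
  by_cases hk : k = i
  · subst hk
    rw [if_pos rfl]
    split_ifs <;> omega
  · rw [if_neg hk]
    split_ifs <;> omega

theorem boxSum_eq_sum_removeBox (c : YoungDiagram → ℤ) (l : YoungDiagram) :
    boxSum c l = ∑ i ∈ Finset.range (l.colLen 0),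
      if l.rowLen (i + 1) < l.rowLen i then c (removeBox l i) else 0 := by
  classical
  rw [boxSum, ← Finset.sum_filter]
  have hbox : ∀ i, l.rowLen (i + 1) < l.rowLen i → IsBoxAt i (removeBox l i) l := by
    intro i hi j
    rw [rowLen_removeBox hi]
    split_ifs with hj
    · subst hj
      omega
    · omega
  symm
  refine Finset.sum_bij (fun i _ => removeBox l i) ?_ ?_ ?_ fun _ _ => rfl
  · intro i hi
    have h := hbox i (Finset.mem_filter.1 hi).2
    refine Finset.mem_filter.2 ⟨mem_partitions.2 ?_, i, h⟩
    have := h.card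
    omega
  · intro i hi i' hi' heq
    have h1 := hbox i (Finset.mem_filter.1 hi).2 i
    have h2 := hbox i' (Finset.mem_filter.1 hi').2 i
    rw [heq] at h1
    by_contra hne
    rw [if_pos rfl] at h1
    rw [if_neg hne] at h2
    omega
  · intro ν hν
    obtain ⟨-, i, hi⟩ := Finset.mem_filter.1 hν
    have h1 := hi i
    have h2 := hi (i + 1)
    have h3 := ν.rowLen_anti i (i + 1) (by omega)
    rw [if_pos rfl] at h1
    rw [if_neg (by omega)] at h2
    have hlt : l.rowLen (i + 1) < l.rowLen i := by omega
    refine ⟨i, Finset.mem_filter.2 ⟨Finset.mem_range.2 ?_, hlt⟩, rowLen_ext fun j => ?_⟩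
    · rw [← lt_rowLen_iff]
      omega
    · rw [rowLen_removeBox hlt, hi j]
      omega

/-- Four times the Schur coefficients of `1 + P + (t₁ + t₂ + ⋯ - 1) (1 + P) ^ 2 / 4`. -/
def fourMult (μ : YoungDiagram) : ℤ :=
  4 * coeffOne μ + 4 * coeffP μ + boxSum coeffOne μ + 2 * boxSum coeffP μ + boxSum coeffPSq μ -
    coeffOne μ - 2 * coeffP μ - coeffPSq μ

theorem fourMult_of_empty {l : YoungDiagram} (h : l.rowLen 0 = 0) : fourMult l = 4 := by
  have h0 : l.colLen 0 = 0 := by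
    have := rowLen_eq_zero_iff.1 h
    omega
  rw [fourMult, boxSum_eq_sum_removeBox, boxSum_eq_sum_removeBox, boxSum_eq_sum_removeBox, h0,
    coeffOne, coeffP, coeffPSq]
  simp [h]

theorem boxSum_of_row (c : YoungDiagram → ℤ) {l : YoungDiagram} (h : l.rowLen 0 ≠ 0)
    (h1 : l.rowLen 1 = 0) : boxSum c l = c (removeBox l 0) := by
  have h0 : l.colLen 0 = 1 := by
    have := rowLen_eq_zero_iff.1 h1
    have := rowLen_eq_zero_iff.not.1 h
    omega
  rw [boxSum_eq_sum_removeBox, h0, Finset.sum_range_one, if_pos (by simp only [zero_add]; omega)]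

theorem fourMult_of_row {l : YoungDiagram} (h : l.rowLen 0 ≠ 0) (h1 : l.rowLen 1 = 0) :
    fourMult l = 4 := by
  have h0 : l.colLen 0 = 1 := by
    have := rowLen_eq_zero_iff.1 h1
    have := rowLen_eq_zero_iff.not.1 h
    omega
  have hlt : l.rowLen (0 + 1) < l.rowLen 0 := by simp only [zero_add]; omega
  obtain ⟨k, hk⟩ : ∃ k, l.rowLen 0 = k + 1 := ⟨l.rowLen 0 - 1, by omega⟩
  have r0 : (removeBox l 0).rowLen 0 = k := by
    rw [rowLen_removeBox hlt, hk, if_pos rfl, Nat.add_sub_cancel]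
  have r1 : (removeBox l 0).rowLen 1 = 0 := by rw [rowLen_removeBox hlt, h1, Nat.zero_sub]
  have hc : (removeBox l 0).colLen 0 = if k = 0 then 0 else 1 := by
    rw [colLen_removeBox hlt, hk, h0]
    split_ifs <;> omega
  rw [fourMult, boxSum_of_row _ h h1, boxSum_of_row _ h h1, boxSum_of_row _ h h1]
  simp only [coeffOne, coeffP, coeffPSq, r0, r1, hc, h1, h0, hk]
  by_cases hk0 : k = 0
  · subst hk0
    simp
  · simp [hk0]
    ring

theorem boxSum_of_hook (c : YoungDiagram → ℤ) {l : YoungDiagram} (h1 : l.rowLen 1 = 1) :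
    boxSum c l = (if 1 < l.rowLen 0 then c (removeBox l 0) else 0) +
      c (removeBox l (l.colLen 0 - 1)) := by
  have hp : ∀ i, 0 < l.rowLen i ↔ i < l.colLen 0 := fun i => lt_rowLen_iff
  have hp1 := hp 1
  have hle : ∀ i, l.rowLen (i + 1) ≤ 1 := fun i => by
    have := l.rowLen_anti 1 (i + 1) (by omega)
    omega
  obtain ⟨p, hp2⟩ : ∃ p, l.colLen 0 = p + 2 := ⟨l.colLen 0 - 2, by omega⟩
  rw [boxSum_eq_sum_removeBox, hp2, Finset.sum_range_succ, Finset.sum_range_succ',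
    Finset.sum_eq_zero, zero_add, zero_add, h1]
  · congr 1
    rw [if_pos]
    · rfl
    · have := hp (p + 1)
      have := hp (p + 1 + 1)
      omega
  · intro i hi
    rw [Finset.mem_range] at hi
    have i1 := hp (i + 1)
    have i2 := hp (i + 1 + 1)
    have i3 := hle i
    rw [if_neg (by omega)]

theorem fourMult_of_hook {l : YoungDiagram} (h1 : l.rowLen 1 = 1) :
    fourMult l = if l.rowLen 0 = 1 then 4 else
      4 * (2 * (l.rowLen 0 : ℤ) * l.colLen 0 - 3 * l.rowLen 0 - 3 * l.colLen 0 + 6) := by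
  have h10 := l.rowLen_anti 0 1 (by omega)
  have hp : ∀ i, 0 < l.rowLen i ↔ i < l.colLen 0 := fun i => lt_rowLen_iff
  have hp1 := hp 1
  have hle : ∀ i, l.rowLen (i + 1) ≤ 1 := fun i => by
    have := l.rowLen_anti 1 (i + 1) (by omega)
    omega
  obtain ⟨p, hp2⟩ : ∃ p, l.colLen 0 = p + 2 := ⟨l.colLen 0 - 2, by omega⟩
  obtain ⟨k, hk⟩ : ∃ k, l.rowLen 0 = k + 1 := ⟨l.rowLen 0 - 1, by omega⟩
  have hlast : l.rowLen (p + 1 + 1) < l.rowLen (p + 1) := by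
    have := hp (p + 1)
    have := hp (p + 1 + 1)
    omega
  have hl1 : l.rowLen (p + 1) = 1 := by
    have := hle p
    omega
  have s0 : (removeBox l (p + 1)).rowLen 0 = k + 1 := by
    rw [rowLen_removeBox hlast, hk, if_neg (by omega), Nat.sub_zero]
  have s1 : (removeBox l (p + 1)).rowLen 1 ≤ 1 := by
    rw [rowLen_removeBox hlast, h1]
    omega
  have sc : (removeBox l (p + 1)).colLen 0 = p + 1 := by
    rw [colLen_removeBox hlast, hl1, if_pos rfl, hp2]
    omega
  rw [fourMult, boxSum_of_hook _ h1, boxSum_of_hook _ h1, boxSum_of_hook _ h1, hp2,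
    show p + 2 - 1 = p + 1 by omega]
  by_cases hk0 : k = 0
  · subst hk0
    simp [coeffOne, coeffP, coeffPSq, h1, hp2, hk, s0, s1, sc]
    ring
  · have hlt : l.rowLen (0 + 1) < l.rowLen 0 := by simp only [zero_add]; omega
    have r0 : (removeBox l 0).rowLen 0 = k := by
      rw [rowLen_removeBox hlt, hk, if_pos rfl, Nat.add_sub_cancel]
    have r1 : (removeBox l 0).rowLen 1 = 1 := by rw [rowLen_removeBox hlt, h1]; rfl
    have rc : (removeBox l 0).colLen 0 = p + 2 := by
      rw [colLen_removeBox hlt, hk, if_neg (by omega), hp2, Nat.sub_zero]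
    have hk1 : 0 < k := by omega
    simp [coeffOne, coeffP, coeffPSq, h1, hp2, hk, s0, s1, sc, r0, r1, rc, hk0, hk1]
    ring

theorem boxSum_of_fat (c : YoungDiagram → ℤ) {l : YoungDiagram} (h1 : 2 ≤ l.rowLen 1)
    (h2 : l.rowLen 2 ≤ 2) :
    boxSum c l = (if l.rowLen 1 < l.rowLen 0 then c (removeBox l 0) else 0) +
      (if l.rowLen 2 < l.rowLen 1 then c (removeBox l 1) else 0) +
      (if 2 < l.colLen 1 then c (removeBox l (l.colLen 1 - 1)) else 0) +
      (if l.colLen 1 < l.colLen 0 then c (removeBox l (l.colLen 0 - 1)) else 0) := by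
  have hp : ∀ i, 0 < l.rowLen i ↔ i < l.colLen 0 := fun i => lt_rowLen_iff
  have hq : ∀ i, 1 < l.rowLen i ↔ i < l.colLen 1 := fun i => lt_rowLen_iff
  have hpq : l.colLen 1 ≤ l.colLen 0 := l.colLen_anti 0 1 (by omega)
  have hle : ∀ i, 2 ≤ i → l.rowLen i ≤ 2 := fun i hi => (l.rowLen_anti 2 i hi).trans h2
  have hq1 := hq 1
  set p := l.colLen 0
  set q := l.colLen 1
  have key : ∀ i ∈ Finset.range p,
      (if l.rowLen (i + 1) < l.rowLen i then c (removeBox l i) else 0) =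
      (if i = 0 then (if l.rowLen 1 < l.rowLen 0 then c (removeBox l 0) else 0) else 0) +
      (if i = 1 then (if l.rowLen 2 < l.rowLen 1 then c (removeBox l 1) else 0) else 0) +
      (if i = q - 1 then (if 2 < q then c (removeBox l (q - 1)) else 0) else 0) +
      (if i = p - 1 then (if q < p then c (removeBox l (p - 1)) else 0) else 0) := by
    intro i hi
    rw [Finset.mem_range] at hi
    rcases i with _ | _ | i
    · have e1 : ¬ (0 = q - 1) := by omega
      have e2 : ¬ (0 = p - 1) := by omega
      simp [e1, e2]
    · have e1 : ¬ (1 = p - 1 ∧ q < p) := by omega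
      have e2 : ¬ (1 = q - 1 ∧ 2 < q) := by omega
      simp only [← ite_and, zero_add, e1, e2, if_false, one_ne_zero, false_and, true_and]
      simp
    · have i1 := hp (i + 2)
      have i2 := hq (i + 2)
      have i3 := hle (i + 2) (by omega)
      have i4 := hp (i + 3)
      have i5 := hq (i + 3)
      have i6 := hle (i + 3) (by omega)
      have e1 : ¬ (i + 2 = 0) := by omega
      have e2 : ¬ (i + 2 = 1) := by omega
      change (if l.rowLen (i + 3) < l.rowLen (i + 2) then c (removeBox l (i + 2)) else 0) =
        (if i + 2 = 0 then _ else _) + (if i + 2 = 1 then _ else _) +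
        (if i + 2 = q - 1 then _ else _) + (if i + 2 = p - 1 then _ else _)
      rw [if_neg e1, if_neg e2]
      by_cases hqi : i + 2 = q - 1
      · have e3 : ¬ (i + 2 = p - 1 ∧ q < p) := by omega
        rw [if_pos hqi, ← ite_and (i + 2 = p - 1), if_neg e3, ← hqi, if_pos (by omega),
          if_pos (by omega)]
        simp
      · rw [if_neg hqi]
        by_cases hpi : i + 2 = p - 1
        · rw [if_pos hpi, ← hpi, if_pos (by omega), if_pos (by omega)]
          simp
        · rw [if_neg hpi, if_neg (by omega)]
          simp
  rw [boxSum_eq_sum_removeBox, Finset.sum_congr rfl key]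
  simp only [Finset.sum_add_distrib, Finset.sum_ite_eq', Finset.mem_range]
  rw [if_pos (show 0 < p by omega), if_pos (show 1 < p by omega),
    if_pos (show q - 1 < p by omega), if_pos (show p - 1 < p by omega)]

theorem fourMult_of_fat {l : YoungDiagram} (h1 : 2 ≤ l.rowLen 1) (h2 : l.rowLen 2 ≤ 2)
    {D L : ℤ} (hD : (l.rowLen 0 : ℤ) = l.rowLen 1 + D) (hL : (l.colLen 0 : ℤ) = l.colLen 1 + L) :
    fourMult l =
      16 * (D * (L + 1) + (D + 1) * L - (D + 1) * (L + 1)) +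
      (if 2 < l.colLen 1 then 16 * ((D + 1) * (L + 2)) else 0) +
      (if 2 < l.rowLen 1 then 16 * ((D + 2) * (L + 1))
        else if 2 < l.colLen 1 then 0 else
          4 * (2 * (l.rowLen 0 : ℤ) * l.colLen 0 - l.rowLen 0 - l.colLen 0 + 1) + 4) := by
  have hp : ∀ i, 0 < l.rowLen i ↔ i < l.colLen 0 := fun i => lt_rowLen_iff
  have hq : ∀ i, 1 < l.rowLen i ↔ i < l.colLen 1 := fun i => lt_rowLen_iff
  have hpq : l.colLen 1 ≤ l.colLen 0 := l.colLen_anti 0 1 (by omega)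
  have hle : ∀ i, 2 ≤ i → l.rowLen i ≤ 2 := fun i hi => (l.rowLen_anti 2 i hi).trans h2
  have h10 := l.rowLen_anti 0 1 (by omega)
  have hq1 := hq 1
  have hcPSq : coeffPSq l = 16 * ((D + 1) * (L + 1)) := by
    rw [coeffPSq, if_neg (by omega), if_neg (by omega), if_pos h2, hD, hL]
    ring
  have hcP : coeffP l = 0 := by rw [coeffP, if_neg (by omega), if_neg (by omega)]
  have hcO : coeffOne l = 0 := by rw [coeffOne, if_neg (by omega)]
  -- A box can be removed from the rows `0`, `1`, the last row of length `2` and the last row.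
  have t0 : l.rowLen 1 < l.rowLen 0 → coeffOne (removeBox l 0) = 0 ∧ coeffP (removeBox l 0) = 0 ∧
      coeffPSq (removeBox l 0) = 16 * (D * (L + 1)) := by
    intro hlt
    have r := rowLen_removeBox (l := l) (i := 0) hlt
    have s := colLen_removeBox (l := l) (i := 0) hlt
    have r0 : (removeBox l 0).rowLen 0 = l.rowLen 0 - 1 := by rw [r, if_pos rfl]
    have r1 : (removeBox l 0).rowLen 1 = l.rowLen 1 := by rw [r, if_neg (by omega), Nat.sub_zero]
    have r2 : (removeBox l 0).rowLen 2 = l.rowLen 2 := by rw [r, if_neg (by omega), Nat.sub_zero]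
    have s0 : (removeBox l 0).colLen 0 = l.colLen 0 := by rw [s, if_neg (by omega), Nat.sub_zero]
    have s1 : (removeBox l 0).colLen 1 = l.colLen 1 := by rw [s, if_neg (by omega), Nat.sub_zero]
    rw [coeffOne, coeffP, coeffPSq, r0, r1, r2, s0, s1, if_neg (by omega), if_neg (by omega),
      if_neg (by omega), if_neg (by omega), if_neg (by omega), if_pos h2, hL,
      Nat.cast_sub (by omega), hD]
    refine ⟨rfl, rfl, ?_⟩
    push_cast
    ring
  have t1 : l.rowLen 2 < l.rowLen 1 → coeffOne (removeBox l 1) = 0 ∧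
      (coeffP (removeBox l 1) = if 2 < l.rowLen 1 then 0 else 2) ∧
      coeffPSq (removeBox l 1) = if 2 < l.rowLen 1 then 16 * ((D + 2) * (L + 1)) else
          4 * (2 * (l.rowLen 0 : ℤ) * l.colLen 0 - l.rowLen 0 - l.colLen 0 + 1) := by
    intro hlt
    have r := rowLen_removeBox (l := l) (i := 1) hlt
    have s := colLen_removeBox (l := l) (i := 1) hlt
    have r0 : (removeBox l 1).rowLen 0 = l.rowLen 0 := by rw [r, if_neg (by omega), Nat.sub_zero]
    have r1 : (removeBox l 1).rowLen 1 = l.rowLen 1 - 1 := by rw [r, if_pos rfl]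
    have r2 : (removeBox l 1).rowLen 2 = l.rowLen 2 := by rw [r, if_neg (by omega), Nat.sub_zero]
    have s0 : (removeBox l 1).colLen 0 = l.colLen 0 := by rw [s, if_neg (by omega), Nat.sub_zero]
    rw [coeffOne, coeffP, coeffPSq, r0, r1, r2, s0]
    by_cases hb : 2 < l.rowLen 1
    · have s1 : (removeBox l 1).colLen 1 = l.colLen 1 := by rw [s, if_neg (by omega), Nat.sub_zero]
      rw [s1, if_pos hb, if_pos hb, if_neg (by omega), if_neg (by omega),
        if_neg (by omega), if_neg (by omega), if_neg (by omega), if_pos h2, hL,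
        Nat.cast_sub (by omega), hD]
      refine ⟨rfl, rfl, ?_⟩
      push_cast
      ring
    · rw [if_neg hb, if_neg hb, if_neg (by omega), if_neg (by omega), if_pos (by omega),
        if_neg (by omega), if_pos (by omega)]
      exact ⟨rfl, rfl, rfl⟩
  have t2 : 2 < l.colLen 1 → coeffOne (removeBox l (l.colLen 1 - 1)) = 0 ∧
      coeffP (removeBox l (l.colLen 1 - 1)) = 0 ∧
      coeffPSq (removeBox l (l.colLen 1 - 1)) = 16 * ((D + 1) * (L + 2)) := by
    intro hlt
    obtain ⟨q, hq'⟩ : ∃ q, l.colLen 1 = q + 3 := ⟨l.colLen 1 - 3, by omega⟩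
    have e1 : l.colLen 1 - 1 = q + 2 := by omega
    have i1 := hq (q + 2)
    have i2 := hq (q + 2 + 1)
    have i3 := hle (q + 2) (by omega)
    have r := rowLen_removeBox (l := l) (i := q + 2) (by omega)
    have s := colLen_removeBox (l := l) (i := q + 2) (by omega)
    have r0 : (removeBox l (q + 2)).rowLen 0 = l.rowLen 0 := by
      rw [r, if_neg (by omega), Nat.sub_zero]
    have r1 : (removeBox l (q + 2)).rowLen 1 = l.rowLen 1 := by
      rw [r, if_neg (by omega), Nat.sub_zero]
    have r2 : (removeBox l (q + 2)).rowLen 2 ≤ 2 := by rw [r]; omega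
    have s0 : (removeBox l (q + 2)).colLen 0 = l.colLen 0 := by
      rw [s, if_neg (by omega), Nat.sub_zero]
    have s1 : (removeBox l (q + 2)).colLen 1 = l.colLen 1 - 1 := by rw [s, if_pos (by omega)]
    rw [e1, coeffOne, coeffP, coeffPSq, r0, r1, s0, s1, if_neg (by omega), if_neg (by omega),
      if_neg (by omega), if_neg (by omega), if_neg (by omega), if_pos r2, hL,
      Nat.cast_sub (by omega), hD]
    refine ⟨rfl, rfl, ?_⟩
    push_cast
    ring
  have t3 : l.colLen 1 < l.colLen 0 → coeffOne (removeBox l (l.colLen 0 - 1)) = 0 ∧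
      coeffP (removeBox l (l.colLen 0 - 1)) = 0 ∧
      coeffPSq (removeBox l (l.colLen 0 - 1)) = 16 * ((D + 1) * L) := by
    intro hlt
    obtain ⟨p, hp'⟩ : ∃ p, l.colLen 0 = p + 3 := ⟨l.colLen 0 - 3, by omega⟩
    have e1 : l.colLen 0 - 1 = p + 2 := by omega
    have i1 := hp (p + 2)
    have i2 := hp (p + 2 + 1)
    have i3 := hq (p + 2)
    have r := rowLen_removeBox (l := l) (i := p + 2) (by omega)
    have s := colLen_removeBox (l := l) (i := p + 2) (by omega)
    have r0 : (removeBox l (p + 2)).rowLen 0 = l.rowLen 0 := by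
      rw [r, if_neg (by omega), Nat.sub_zero]
    have r1 : (removeBox l (p + 2)).rowLen 1 = l.rowLen 1 := by
      rw [r, if_neg (by omega), Nat.sub_zero]
    have r2 : (removeBox l (p + 2)).rowLen 2 ≤ 2 := by rw [r]; omega
    have s0 : (removeBox l (p + 2)).colLen 0 = l.colLen 0 - 1 := by rw [s, if_pos (by omega)]
    have s1 : (removeBox l (p + 2)).colLen 1 = l.colLen 1 := by
      rw [s, if_neg (by omega), Nat.sub_zero]
    rw [e1, coeffOne, coeffP, coeffPSq, r0, r1, s0, s1, if_neg (by omega), if_neg (by omega),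
      if_neg (by omega), if_neg (by omega), if_neg (by omega), if_pos r2,
      Nat.cast_sub (by omega), hL, hD]
    refine ⟨rfl, rfl, ?_⟩
    push_cast
    ring
  rw [fourMult, boxSum_of_fat _ h1 h2, boxSum_of_fat _ h1 h2, boxSum_of_fat _ h1 h2, hcPSq, hcP,
    hcO]
  have u0 : (if l.rowLen 1 < l.rowLen 0 then coeffPSq (removeBox l 0) else 0) =
      16 * (D * (L + 1)) := by
    split_ifs with h
    · exact (t0 h).2.2
    · have : D = 0 := by omega
      rw [this]
      ring
  have u0' : (if l.rowLen 1 < l.rowLen 0 then coeffP (removeBox l 0) else 0) = 0 := by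
    split_ifs with h
    · exact (t0 h).2.1
    · rfl
  have u0'' : (if l.rowLen 1 < l.rowLen 0 then coeffOne (removeBox l 0) else 0) = 0 := by
    split_ifs with h
    · exact (t0 h).1
    · rfl
  have u3 : (if l.colLen 1 < l.colLen 0 then coeffPSq (removeBox l (l.colLen 0 - 1)) else 0) =
      16 * ((D + 1) * L) := by
    split_ifs with h
    · exact (t3 h).2.2
    · have : L = 0 := by omega
      rw [this]
      ring
  have u3' : (if l.colLen 1 < l.colLen 0 then coeffP (removeBox l (l.colLen 0 - 1)) else 0) =
      0 := by
    split_ifs with h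
    · exact (t3 h).2.1
    · rfl
  have u3'' : (if l.colLen 1 < l.colLen 0 then coeffOne (removeBox l (l.colLen 0 - 1)) else 0) =
      0 := by
    split_ifs with h
    · exact (t3 h).1
    · rfl
  rw [u0, u0', u0'', u3, u3', u3'']
  have i2 := hq 2
  by_cases hq2 : 2 < l.colLen 1
  · rw [(t2 hq2).1, (t2 hq2).2.1, (t2 hq2).2.2]
    simp only [hq2, if_true]
    by_cases hb : 2 < l.rowLen 1
    · have hlt : l.rowLen 2 < l.rowLen 1 := by omega
      rw [(t1 hlt).1, (t1 hlt).2.1, (t1 hlt).2.2]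
      simp only [hlt, hb, if_true]
      ring
    · have hlt : ¬ (l.rowLen 2 < l.rowLen 1) := by omega
      simp only [hlt, hb, if_false]
      ring
  · have hlt : l.rowLen 2 < l.rowLen 1 := by omega
    rw [(t1 hlt).1, (t1 hlt).2.1, (t1 hlt).2.2]
    simp only [hlt, hq2, if_true, if_false]
    split_ifs <;> ring

/-- A diagram that contains `(3, 3, 3)` has the coefficient `0` in `P ^ 2`, but it may arise by
adding a box to one that does not. -/
theorem fourMult_of_three {l : YoungDiagram} (h2 : 3 ≤ l.rowLen 2) :
    fourMult l = if l.rowLen 2 = 3 ∧ l.rowLen 3 ≤ 2 then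
      16 * (((l.rowLen 0 : ℤ) - l.rowLen 1 + 1) * ((l.colLen 0 : ℤ) - l.colLen 1 + 1)) else 0 := by
  have h21 := l.rowLen_anti 1 2 (by omega)
  have h10 := l.rowLen_anti 0 1 (by omega)
  have h32 := l.rowLen_anti 2 3 (by omega)
  have hp : 0 < l.rowLen 2 ↔ 2 < l.colLen 0 := lt_rowLen_iff
  have hz : ∀ ν : YoungDiagram, 2 ≤ ν.rowLen 1 → 3 ≤ ν.rowLen 2 →
      coeffOne ν = 0 ∧ coeffP ν = 0 ∧ coeffPSq ν = 0 := by
    intro ν h h'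
    have := ν.rowLen_anti 0 1 (by omega)
    rw [coeffOne, coeffP, coeffPSq, if_neg (by omega), if_neg (by omega), if_neg (by omega),
      if_neg (by omega), if_neg (by omega), if_neg (by omega)]
    exact ⟨rfl, rfl, rfl⟩
  have hb : ∀ c : YoungDiagram → ℤ, (∀ ν : YoungDiagram, 2 ≤ ν.rowLen 1 → 3 ≤ ν.rowLen 2 →
      c ν = 0) → boxSum c l =
      if l.rowLen 2 = 3 ∧ l.rowLen 3 ≤ 2 then c (removeBox l 2) else 0 := by
    intro c hc
    rw [boxSum_eq_sum_removeBox]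
    rw [Finset.sum_eq_single_of_mem 2 (Finset.mem_range.2 (by omega))]
    · by_cases h3 : l.rowLen 2 = 3
      · simp only [h3, true_and]
        congr 1
        rw [eq_iff_iff]
        have : l.rowLen (2 + 1) = l.rowLen 3 := rfl
        omega
      · rw [if_neg (c := l.rowLen 2 = 3 ∧ l.rowLen 3 ≤ 2) (fun h => h3 h.1)]
        split_ifs with hlt
        · refine hc _ ?_ ?_ <;> rw [rowLen_removeBox hlt]
          · rw [if_neg (by omega)]
            omega
          · rw [if_pos rfl]
            omega
        · rfl
    · intro i _ hi
      split_ifs with hlt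
      · refine hc _ ?_ ?_ <;> rw [rowLen_removeBox hlt]
        · split_ifs <;> omega
        · rw [if_neg (Ne.symm hi)]
          omega
      · rfl
  have hz' := hz l (by omega) h2
  rw [fourMult, hb _ fun ν h h' => (hz ν h h').1, hb _ fun ν h h' => (hz ν h h').2.1,
    hb _ fun ν h h' => (hz ν h h').2.2, hz'.1, hz'.2.1, hz'.2.2]
  split_ifs with h
  · have hlt : l.rowLen (2 + 1) < l.rowLen 2 := by simp only [Nat.reduceAdd]; omega
    have r := rowLen_removeBox hlt
    have s := colLen_removeBox hlt
    have r0 : (removeBox l 2).rowLen 0 = l.rowLen 0 := by rw [r, if_neg (by omega), Nat.sub_zero]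
    have r1 : (removeBox l 2).rowLen 1 = l.rowLen 1 := by rw [r, if_neg (by omega), Nat.sub_zero]
    have r2 : (removeBox l 2).rowLen 2 = 2 := by rw [r, if_pos rfl]; omega
    have s0 : (removeBox l 2).colLen 0 = l.colLen 0 := by rw [s, if_neg (by omega), Nat.sub_zero]
    have s1 : (removeBox l 2).colLen 1 = l.colLen 1 := by rw [s, if_neg (by omega), Nat.sub_zero]
    rw [coeffOne, coeffP, coeffPSq, r0, r1, r2, s0, s1, if_neg (by omega), if_neg (by omega),
      if_neg (by omega), if_neg (by omega), if_neg (by omega), if_pos le_rfl]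
    ring
  · ring

/-- The multiplicity of a diagram in the cocharacter of `UT₂(E)`. -/
def mult (μ : YoungDiagram) : ℕ := (fourMult μ / 4).toNat

theorem mult_eq {μ : YoungDiagram} {x : ℤ} (h : fourMult μ = 4 * x) (hx : 0 ≤ x) :
    (mult μ : ℤ) = x := by
  rw [mult, h, Int.mul_ediv_cancel_left _ (by norm_num), Int.toNat_of_nonneg hx]

theorem mult_of_empty {μ : YoungDiagram} (h : μ.rowLen 0 = 0) : (mult μ : ℤ) = 1 :=
  mult_eq (by rw [fourMult_of_empty h]; norm_num) (by norm_num)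

theorem mult_of_row {μ : YoungDiagram} (h : μ.rowLen 0 ≠ 0) (h1 : μ.rowLen 1 = 0) :
    (mult μ : ℤ) = 1 :=
  mult_eq (by rw [fourMult_of_row h h1]; norm_num) (by norm_num)

theorem mult_of_column {μ : YoungDiagram} (h : μ.rowLen 0 = 1) (h1 : μ.rowLen 1 = 1) :
    (mult μ : ℤ) = 1 :=
  mult_eq (by rw [fourMult_of_hook h1, if_pos h]; norm_num) (by norm_num)

theorem mult_of_hook {μ : YoungDiagram} {k p : ℕ} (h : μ.rowLen 0 = k + 2) (h1 : μ.rowLen 1 = 1)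
    (hp : μ.colLen 0 = p + 2) : (mult μ : ℤ) = 2 * k * p + k + p + 2 := by
  refine mult_eq ?_ (by positivity)
  rw [fourMult_of_hook h1, if_neg (by omega), h, hp]
  push_cast
  ring

theorem mult_of_fat {μ : YoungDiagram} {D L : ℕ} (h2 : μ.rowLen 2 ≤ 2) (h1 : 2 ≤ μ.rowLen 1)
    (hD : μ.rowLen 0 = μ.rowLen 1 + D) (hL : μ.colLen 0 = μ.colLen 1 + L) :
    (mult μ : ℤ) = if 2 < μ.rowLen 1 then
        (if 2 < μ.colLen 1 then 12 * ((D : ℤ) + 1) * (L + 1) else 4 * ((D : ℤ) + 1) * (2 * L + 1))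
      else if 2 < μ.colLen 1 then 4 * (2 * (D : ℤ) + 1) * (L + 1)
        else 6 * (D : ℤ) * L + 3 * D + 3 * L + 2 := by
  have hq : 1 < μ.rowLen 1 ↔ 1 < μ.colLen 1 := lt_rowLen_iff
  have := fourMult_of_fat h1 h2 (D := D) (L := L) (by omega) (by omega)
  refine mult_eq ?_ (by split_ifs <;> positivity)
  rw [this]
  by_cases hb : 2 < μ.rowLen 1 <;> by_cases hc : 2 < μ.colLen 1 <;>
    simp only [hb, hc, if_true, if_false]
  · ring
  · ring
  · ring
  · have e1 : μ.rowLen 0 = D + 2 := by omega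
    have e2 : μ.colLen 0 = L + 2 := by omega
    rw [e1, e2]
    push_cast
    ring

theorem mult_of_three {μ : YoungDiagram} {D L : ℕ} (h2 : μ.rowLen 2 = 3) (h3 : μ.rowLen 3 ≤ 2)
    (hD : μ.rowLen 0 = μ.rowLen 1 + D) (hL : μ.colLen 0 = μ.colLen 1 + L) :
    (mult μ : ℤ) = 4 * ((D : ℤ) + 1) * (L + 1) := by
  refine mult_eq ?_ (by positivity)
  rw [fourMult_of_three h2.ge, if_pos ⟨h2, h3⟩, hD, hL]
  push_cast
  ring

theorem mult_of_big {μ : YoungDiagram} (h2 : 3 ≤ μ.rowLen 2)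
    (h3 : ¬ (μ.rowLen 2 = 3 ∧ μ.rowLen 3 ≤ 2)) : (mult μ : ℤ) = 0 :=
  mult_eq (by rw [fourMult_of_three h2, if_neg h3]; norm_num) le_rfl

theorem four_mul_mult (μ : YoungDiagram) : 4 * (mult μ : ℤ) = fourMult μ := by
  have h10 := μ.rowLen_anti 0 1 (by omega)
  have hc10 := μ.colLen_anti 0 1 (by omega)
  obtain ⟨D, hD⟩ : ∃ D, μ.rowLen 0 = μ.rowLen 1 + D := ⟨_, (Nat.add_sub_cancel' h10).symm⟩
  obtain ⟨L, hL⟩ : ∃ L, μ.colLen 0 = μ.colLen 1 + L := ⟨_, (Nat.add_sub_cancel' hc10).symm⟩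
  have key : ∃ x : ℕ, fourMult μ = 4 * x := by
    by_cases h0 : μ.rowLen 0 = 0
    · exact ⟨1, by rw [fourMult_of_empty h0]; norm_num⟩
    by_cases h1 : μ.rowLen 1 = 0
    · exact ⟨1, by rw [fourMult_of_row h0 h1]; norm_num⟩
    by_cases h1' : μ.rowLen 1 = 1
    · rw [fourMult_of_hook h1']
      have hp : 0 < μ.rowLen 1 ↔ 1 < μ.colLen 0 := lt_rowLen_iff
      split_ifs with hk
      · exact ⟨1, by norm_num⟩
      · obtain ⟨k, hk⟩ : ∃ k, μ.rowLen 0 = k + 2 := ⟨μ.rowLen 0 - 2, by omega⟩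
        obtain ⟨p, hp⟩ : ∃ k, μ.colLen 0 = k + 2 := ⟨μ.colLen 0 - 2, by omega⟩
        refine ⟨2 * k * p + k + p + 2, ?_⟩
        rw [hk, hp]
        push_cast
        ring
    by_cases h2 : μ.rowLen 2 ≤ 2
    · have hq : 1 < μ.rowLen 1 ↔ 1 < μ.colLen 1 := lt_rowLen_iff
      rw [fourMult_of_fat (by omega) h2 (D := D) (L := L) (by omega) (by omega)]
      by_cases hb : 2 < μ.rowLen 1 <;> by_cases hc : 2 < μ.colLen 1 <;>
        simp only [hb, hc, if_true, if_false]
      · exact ⟨12 * (D + 1) * (L + 1), by push_cast; ring⟩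
      · exact ⟨4 * (D + 1) * (2 * L + 1), by push_cast; ring⟩
      · exact ⟨4 * (2 * D + 1) * (L + 1), by push_cast; ring⟩
      · have e1 : μ.rowLen 0 = D + 2 := by omega
        have e2 : μ.colLen 0 = L + 2 := by omega
        rw [e1, e2]
        exact ⟨6 * D * L + 3 * D + 3 * L + 2, by push_cast; ring⟩
    · rw [fourMult_of_three (by omega), hD, hL]
      split_ifs
      · exact ⟨4 * (D + 1) * (L + 1), by push_cast; ring⟩
      · exact ⟨0, by norm_num⟩
  obtain ⟨x, hx⟩ := key
  rw [mult_eq hx (by positivity), hx]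

theorem getD_rowLens (μ : YoungDiagram) (i : ℕ) : μ.rowLens.getD i 0 = μ.rowLen i := by
  rw [List.getD_eq_getElem?_getD]
  by_cases h : i < μ.colLen 0
  · rw [List.getElem?_eq_getElem (by rwa [YoungDiagram.length_rowLens]), Option.getD_some]
    exact YoungDiagram.get_rowLens
  · rw [List.getElem?_eq_none (by rw [YoungDiagram.length_rowLens]; omega), Option.getD_none]
    exact (rowLen_eq_zero_iff.2 (by omega)).symm

theorem rowLens_eq_of_rowLen {μ : YoungDiagram} {w : List ℕ} (hlen : w.length = μ.colLen 0)
    (h : ∀ i, μ.rowLen i = w.getD i 0) : μ.rowLens = w := by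
  refine List.ext_getElem (by rw [YoungDiagram.length_rowLens, hlen]) fun i h1 h2 => ?_
  have := h i
  rw [List.getD_eq_getElem _ _ h2] at this
  rw [← this]
  exact YoungDiagram.get_rowLens

theorem getD_replicate_append (r l i : ℕ) :
    (List.replicate r 2 ++ List.replicate l 1).getD i 0 =
      if i < r then 2 else if i < r + l then 1 else 0 := by
  rw [List.getD_eq_getElem?_getD, List.getElem?_append, List.length_replicate]
  simp only [List.getElem?_replicate]
  split_ifs <;> first | rfl | omega

/-- The row and column lengths of `(k₁, k₂, 2^r, 1^l)`. -/
theorem shape_of_rowLens {μ : YoungDiagram} {k₁ k₂ r l : ℕ} (h12 : k₂ ≤ k₁) (h2 : 2 ≤ k₂)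
    (h : μ.rowLens = k₁ :: k₂ :: (List.replicate r 2 ++ List.replicate l 1)) :
    μ.rowLen 0 = k₁ ∧ μ.rowLen 1 = k₂ ∧ μ.rowLen 2 ≤ 2 ∧ μ.colLen 0 = 2 + r + l ∧
      μ.colLen 1 = 2 + r := by
  have hr : ∀ i, μ.rowLen (i + 2) = if i < r then 2 else if i < r + l then 1 else 0 := by
    intro i
    rw [← getD_rowLens, h, List.getD_cons_succ, List.getD_cons_succ, getD_replicate_append]
  have h0 : μ.rowLen 0 = k₁ := by rw [← getD_rowLens, h]; rfl
  have h1 : μ.rowLen 1 = k₂ := by rw [← getD_rowLens, h]; rfl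
  refine ⟨h0, h1, ?_, ?_, ?_⟩
  · rw [hr 0]
    split_ifs <;> omega
  · rw [← YoungDiagram.length_rowLens, h]
    simp
    omega
  · refine colLen_eq_of_rowLen fun i => ?_
    rcases i with _ | _ | i
    · omega
    · rw [zero_add]
      omega
    · rw [hr]
      split_ifs <;> omega

/-- The row and column lengths of `(k₁, k₂, 3, 2^r, 1^l)`. -/
theorem shape_of_rowLens_three {μ : YoungDiagram} {k₁ k₂ r l : ℕ} (h12 : k₂ ≤ k₁) (h2 : 3 ≤ k₂)
    (h : μ.rowLens = k₁ :: k₂ :: 3 :: (List.replicate r 2 ++ List.replicate l 1)) :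
    μ.rowLen 0 = k₁ ∧ μ.rowLen 1 = k₂ ∧ μ.rowLen 2 = 3 ∧ μ.rowLen 3 ≤ 2 ∧
      μ.colLen 0 = 3 + r + l ∧ μ.colLen 1 = 3 + r := by
  have hr : ∀ i, μ.rowLen (i + 3) = if i < r then 2 else if i < r + l then 1 else 0 := by
    intro i
    rw [← getD_rowLens, h, List.getD_cons_succ, List.getD_cons_succ, List.getD_cons_succ,
      getD_replicate_append]
  have h0 : μ.rowLen 0 = k₁ := by rw [← getD_rowLens, h]; rfl
  have h1 : μ.rowLen 1 = k₂ := by rw [← getD_rowLens, h]; rfl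
  have h2 : μ.rowLen 2 = 3 := by rw [← getD_rowLens, h]; rfl
  refine ⟨h0, h1, h2, ?_, ?_, ?_⟩
  · rw [hr 0]
    split_ifs <;> omega
  · rw [← YoungDiagram.length_rowLens, h]
    simp
    omega
  · refine colLen_eq_of_rowLen fun i => ?_
    rcases i with _ | _ | _ | i
    · omega
    · rw [zero_add]
      omega
    · change 2 < 3 + r ↔ 1 < μ.rowLen 2
      omega
    · rw [hr]
      split_ifs <;> omega

/-- The row and column lengths of `(k, 1^l)`. -/
theorem shape_of_rowLens_hook {μ : YoungDiagram} {k l : ℕ}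
    (h : μ.rowLens = k :: List.replicate l 1) :
    μ.rowLen 0 = k ∧ μ.rowLen 1 = min l 1 ∧ μ.colLen 0 = l + 1 := by
  refine ⟨by rw [← getD_rowLens, h]; rfl, ?_, ?_⟩
  · rw [← getD_rowLens, h]
    rcases l with _ | l
    · rfl
    · simp [List.replicate_succ]
  · rw [← YoungDiagram.length_rowLens, h]
    simp

/-- The shapes of nonzero multiplicity. -/
theorem shape_of_mult_ne_zero {μ : YoungDiagram} (h : mult μ ≠ 0) :
    μ.rowLens = [] ∨
    (∃ k l : ℕ, μ.rowLens = k :: List.replicate l 1) ∨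
    (∃ k₁ k₂ r l : ℕ, 2 ≤ k₂ ∧ k₂ ≤ k₁ ∧
      μ.rowLens = k₁ :: k₂ :: (List.replicate r 2 ++ List.replicate l 1)) ∨
    (∃ k₁ k₂ r l : ℕ, 3 ≤ k₂ ∧ k₂ ≤ k₁ ∧
      μ.rowLens = k₁ :: k₂ :: 3 :: (List.replicate r 2 ++ List.replicate l 1)) := by
  have h10 := μ.rowLen_anti 0 1 (by omega)
  have h21 := μ.rowLen_anti 1 2 (by omega)
  have hp : ∀ i, 0 < μ.rowLen i ↔ i < μ.colLen 0 := fun i => lt_rowLen_iff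
  have hq : ∀ i, 1 < μ.rowLen i ↔ i < μ.colLen 1 := fun i => lt_rowLen_iff
  have hpq : μ.colLen 1 ≤ μ.colLen 0 := μ.colLen_anti 0 1 (by omega)
  have p0 := hp 0
  have p1 := hp 1
  have p2 := hp 2
  have q1 := hq 1
  have q2 := hq 2
  by_cases h0 : μ.rowLen 0 = 0
  · left
    rw [← List.length_eq_zero_iff, YoungDiagram.length_rowLens]
    omega
  by_cases h1 : μ.rowLen 1 ≤ 1
  · right; left
    refine ⟨μ.rowLen 0, μ.colLen 0 - 1, rowLens_eq_of_rowLen ?_ fun i => ?_⟩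
    · simp
      omega
    · rcases i with _ | i
      · rfl
      · have := μ.rowLen_anti 1 (i + 1) (by omega)
        have := hp (i + 1)
        rw [List.getD_cons_succ, List.getD_eq_getElem?_getD, List.getElem?_replicate]
        split_ifs
        · rw [Option.getD_some]
          omega
        · rw [Option.getD_none]
          omega
  by_cases h2 : μ.rowLen 2 ≤ 2
  · right; right; left
    refine ⟨μ.rowLen 0, μ.rowLen 1, μ.colLen 1 - 2, μ.colLen 0 - μ.colLen 1, by omega, h10,
      rowLens_eq_of_rowLen ?_ fun i => ?_⟩
    · simp
      omega
    · rcases i with _ | _ | i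
      · rfl
      · rfl
      · have := μ.rowLen_anti 2 (i + 2) (by omega)
        have := hp (i + 2)
        have := hq (i + 2)
        rw [List.getD_cons_succ, List.getD_cons_succ, getD_replicate_append]
        change μ.rowLen (i + 2) = _
        split_ifs <;> omega
  · right; right; right
    by_cases h3 : μ.rowLen 2 = 3 ∧ μ.rowLen 3 ≤ 2
    · refine ⟨μ.rowLen 0, μ.rowLen 1, μ.colLen 1 - 3, μ.colLen 0 - μ.colLen 1, by omega, h10,
        rowLens_eq_of_rowLen ?_ fun i => ?_⟩
      · simp
        omega
      · rcases i with _ | _ | _ | i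
        · rfl
        · rfl
        · exact h3.1
        · have := μ.rowLen_anti 3 (i + 3) (by omega)
          have := hp (i + 3)
          have := hq (i + 3)
          rw [List.getD_cons_succ, List.getD_cons_succ, List.getD_cons_succ,
            getD_replicate_append]
          change μ.rowLen (i + 3) = _
          split_ifs <;> omega
    · have := mult_of_big (by omega) h3
      omega

/-- The explicit values of the multiplicities. -/
theorem mult_values :
    (∀ (μ : YoungDiagram) (k₁ k₂ r l : ℕ), 3 ≤ k₂ → k₂ ≤ k₁ → 1 ≤ r →
        μ.rowLens = k₁ :: k₂ :: (List.replicate r 2 ++ List.replicate l 1) →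
        (mult μ : ℤ) = 12 * ((k₁ : ℤ) - k₂ + 1) * (l + 1)) ∧
    (∀ (μ : YoungDiagram) (k₁ k₂ l : ℕ), 3 ≤ k₂ → k₂ ≤ k₁ →
        μ.rowLens = k₁ :: k₂ :: List.replicate l 1 →
        (mult μ : ℤ) = 4 * ((k₁ : ℤ) - k₂ + 1) * (2 * l + 1)) ∧
    (∀ (μ : YoungDiagram) (k₁ r l : ℕ), 2 ≤ k₁ → 1 ≤ r →
        μ.rowLens = k₁ :: 2 :: (List.replicate r 2 ++ List.replicate l 1) →
        (mult μ : ℤ) = 8 * ((k₁ : ℤ) - 2) * (l + 1) + 4 * (l + 1)) ∧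
    (∀ (μ : YoungDiagram) (k₁ l : ℕ), 2 ≤ k₁ →
        μ.rowLens = k₁ :: 2 :: List.replicate l 1 →
        (mult μ : ℤ) = 3 * ((k₁ : ℤ) - 2) * (2 * l + 1) + 3 * l + 2) ∧
    (∀ (μ : YoungDiagram) (k₁ l : ℕ), 2 ≤ k₁ → 1 ≤ l →
        μ.rowLens = k₁ :: List.replicate l 1 →
        (mult μ : ℤ) = ((k₁ : ℤ) - 2) * (2 * l - 1) + l + 1) ∧
    (∀ (μ : YoungDiagram) (l : ℕ), μ.rowLens = List.replicate l 1 → mult μ = 1) ∧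
    (∀ (μ : YoungDiagram) (k : ℕ), μ.rowLens = [k] → mult μ = 1) ∧
    (∀ (μ : YoungDiagram) (k₁ k₂ r l : ℕ), 3 ≤ k₂ → k₂ ≤ k₁ →
        μ.rowLens = k₁ :: k₂ :: 3 :: (List.replicate r 2 ++ List.replicate l 1) →
        (mult μ : ℤ) = 4 * ((k₁ : ℤ) - k₂ + 1) * (l + 1)) := by
  have hfat : ∀ (μ : YoungDiagram) (k₁ k₂ r l : ℕ), 2 ≤ k₂ → k₂ ≤ k₁ →
      μ.rowLens = k₁ :: k₂ :: (List.replicate r 2 ++ List.replicate l 1) →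
      (mult μ : ℤ) = if 2 < k₂ then
        (if 0 < r then 12 * (((k₁ - k₂ : ℕ) : ℤ) + 1) * (l + 1)
          else 4 * (((k₁ - k₂ : ℕ) : ℤ) + 1) * (2 * l + 1))
      else if 0 < r then 4 * (2 * ((k₁ - k₂ : ℕ) : ℤ) + 1) * (l + 1)
        else 6 * ((k₁ - k₂ : ℕ) : ℤ) * l + 3 * ((k₁ - k₂ : ℕ) : ℤ) + 3 * l + 2 := by
    intro μ k₁ k₂ r l h2 h12 h
    obtain ⟨a0, a1, a2, a3, a4⟩ := shape_of_rowLens h12 h2 h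
    rw [mult_of_fat (D := k₁ - k₂) (L := l) a2 (by omega) (by omega) (by omega), a1, a4]
    have e : 2 < 2 + r ↔ 0 < r := by omega
    simp only [e]
  refine ⟨?_, ?_, ?_, ?_, ?_, ?_, ?_, ?_⟩
  · intro μ k₁ k₂ r l h2 h12 hr h
    rw [hfat μ k₁ k₂ r l (by omega) h12 h, if_pos (by omega), if_pos (by omega), Nat.cast_sub h12]
  · intro μ k₁ k₂ l h2 h12 h
    rw [hfat μ k₁ k₂ 0 l (by omega) h12 (by simpa using h), if_pos (by omega), if_neg (by omega),
      Nat.cast_sub h12]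
  · intro μ k₁ r l h12 hr h
    rw [hfat μ k₁ 2 r l le_rfl h12 h, if_neg (by omega), if_pos (by omega), Nat.cast_sub h12]
    push_cast
    ring
  · intro μ k₁ l h12 h
    rw [hfat μ k₁ 2 0 l le_rfl h12 (by simpa using h), if_neg (by omega), if_neg (by omega),
      Nat.cast_sub h12]
    push_cast
    ring
  · intro μ k₁ l h1 hl h
    obtain ⟨a0, a1, a2⟩ := shape_of_rowLens_hook h
    rw [mult_of_hook (k := k₁ - 2) (p := l - 1) (by omega) (by omega) (by omega),
      Nat.cast_sub h1, Nat.cast_sub hl]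
    push_cast
    ring
  · intro μ l h
    have key : (mult μ : ℤ) = 1 := by
      rcases l with _ | _ | l
      · refine mult_of_empty ?_
        rw [← getD_rowLens, h]
        rfl
      · obtain ⟨a0, a1, -⟩ := shape_of_rowLens_hook (k := 1) (l := 0) h
        exact mult_of_row (by omega) (by omega)
      · obtain ⟨a0, a1, -⟩ := shape_of_rowLens_hook (k := 1) (l := l + 1) h
        exact mult_of_column (by omega) (by omega)
    exact_mod_cast key
  · intro μ k h
    obtain ⟨a0, a1, a2⟩ := shape_of_rowLens_hook (k := k) (l := 0) h
    have hk : 0 < k := μ.pos_of_mem_rowLens k (by rw [h]; simp)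
    exact_mod_cast mult_of_row (by omega) (by omega)
  · intro μ k₁ k₂ r l h2 h12 h
    obtain ⟨a0, a1, a2, a3, a4, a5⟩ := shape_of_rowLens_three h12 h2 h
    rw [mult_of_three (D := k₁ - k₂) (L := l) a2 a3 (by omega) (by omega), Nat.cast_sub h12]

/-- The Schur coefficients of the Hilbert series: `∑ m_λ S_λ` in terms of the products of
`(1 + t) / (1 - t)` over the variables. -/
theorem four_mul_schurSum_mult (d : ℕ) (α : Fin d → ℕ) :
    4 * schurSum d (fun μ => (mult μ : ℤ)) α =
      3 * (if ∀ k, α k = 0 then 1 else 0) + 2 * ∏ k, seriesP (α k) - ∏ k, seriesPSq (α k) +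
      (∑ k, if α k = 0 then 0 else
        ((if ∀ i, α i - (if i = k then 1 else 0) = 0 then 1 else 0) +
        2 * (∏ i, seriesP (α i - if i = k then 1 else 0)) +
        ∏ i, seriesPSq (α i - if i = k then 1 else 0))) := by
  have e0 : (⊥ : YoungDiagram).rowLen 0 = 0 := by
    by_contra h
    exact YoungDiagram.notMem_bot (0, 0) (YoungDiagram.mem_iff_lt_rowLen.2 (Nat.pos_of_ne_zero h))
  have hone : ∀ β : Fin d → ℕ, (∏ k, (if β k = 0 then (1 : ℤ) else 0)) =
      if ∀ k, β k = 0 then 1 else 0 := by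
    intro β
    split_ifs with h
    · exact Finset.prod_eq_one fun k _ => if_pos (h k)
    · push Not at h
      obtain ⟨k, hk⟩ := h
      exact Finset.prod_eq_zero (Finset.mem_univ k) (if_neg hk)
  have b0 : coeffOne ⊥ = 1 := by rw [coeffOne, if_pos e0]
  have b1 : coeffP ⊥ = 1 := by rw [coeffP, if_pos e0]
  have b2 : coeffPSq ⊥ = 1 := by rw [coeffPSq, if_pos e0]
  rw [← schurSum_smul]
  have : (fun μ => 4 * (mult μ : ℤ)) = fun μ => 3 * coeffOne μ + (2 * coeffP μ +
      ((-1) * coeffPSq μ + (boxSum coeffOne μ + (2 * boxSum coeffP μ + boxSum coeffPSq μ)))) := by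
    funext μ
    rw [four_mul_mult, fourMult]
    ring
  rw [this]
  simp only [schurSum_add, schurSum_smul]
  rw [schurSum_eq_prod stripSum_coeffOne, schurSum_eq_prod stripSum_coeffP,
    schurSum_eq_prod stripSum_coeffPSq, schurSum_boxSum stripSum_coeffOne,
    schurSum_boxSum stripSum_coeffP, schurSum_boxSum stripSum_coeffPSq, b0, b1, b2]
  simp only [hone, mul_one]
  have hs : ∀ f g h : Fin d → ℤ, (∑ k, if α k = 0 then 0 else (f k + 2 * g k + h k)) =
      (∑ k, if α k = 0 then 0 else f k) + 2 * (∑ k, if α k = 0 then 0 else g k) +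
        ∑ k, if α k = 0 then 0 else h k := by
    intro f g h
    rw [Finset.mul_sum, ← Finset.sum_add_distrib, ← Finset.sum_add_distrib]
    refine Finset.sum_congr rfl fun k _ => ?_
    split_ifs <;> simp
  rw [hs]
  ring

/-! ### Characters summed over stabilizers of words -/

/-- If the fibres of the invariants of a finite group are separated by a map `π`, then the average
of the character is the rank of `π`. -/
theorem sum_trace_eq_card_mul_finrank {F G V W : Type*} [Field F] [CharZero F] [Group G] [Fintype G]
    [AddCommGroup V] [Module F V] [FiniteDimensional F V] [AddCommGroup W] [Module F W]
    (ρ : Representation F G V) (π : V →ₗ[F] W) (h1 : ∀ g v, π (ρ g v) = π v)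
    (h2 : ∀ v, π v = 0 → ∑ g, ρ g v = 0) :
    ∑ g, LinearMap.trace F V (ρ g) =
      (Fintype.card G : F) * Module.finrank F (LinearMap.range π) := by
  have hc : (Fintype.card G : F) ≠ 0 := Nat.cast_ne_zero.2 Fintype.card_ne_zero
  -- The projection onto the invariants.
  set p : V →ₗ[F] V := (Fintype.card G : F)⁻¹ • ∑ g, ρ g with hp
  have hpv : ∀ v, p v = (Fintype.card G : F)⁻¹ • ∑ g, ρ g v := fun v => by
    simp [hp, LinearMap.sum_apply]
  have hfix : ∀ v, (∀ g, ρ g v = v) → p v = v := by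
    intro v hv
    rw [hpv, Finset.sum_congr rfl fun g _ => hv g, Finset.sum_const, Finset.card_univ,
      ← Nat.cast_smul_eq_nsmul F, smul_smul, inv_mul_cancel₀ hc, one_smul]
  have hinv : ∀ v g, ρ g (p v) = p v := by
    intro v g
    rw [hpv, map_smul, map_sum]
    congr 1
    simp only [← Module.End.mul_apply, ← map_mul]
    exact Fintype.sum_equiv (Equiv.mulLeft g) _ _ fun _ => rfl
  have hproj : LinearMap.IsProj (LinearMap.range p) p := by
    refine ⟨fun v => ⟨v, rfl⟩, ?_⟩
    rintro _ ⟨v, rfl⟩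
    exact hfix _ (hinv v)
  have htr : LinearMap.trace F V p = Module.finrank F (LinearMap.range p) := hproj.trace
  have hker : LinearMap.ker p = LinearMap.ker π := by
    ext v
    rw [LinearMap.mem_ker, LinearMap.mem_ker]
    constructor
    · intro hv
      have h3 : π (p v) = π v := by
        rw [hpv, map_smul, map_sum, Finset.sum_congr rfl fun g _ => h1 g v, Finset.sum_const,
          Finset.card_univ, ← Nat.cast_smul_eq_nsmul F, smul_smul, inv_mul_cancel₀ hc, one_smul]
      rw [← h3, hv, map_zero]
    · intro hv
      rw [hpv, h2 v hv, smul_zero]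
  have hrank : Module.finrank F (LinearMap.range p) = Module.finrank F (LinearMap.range π) := by
    have e1 := LinearMap.finrank_range_add_finrank_ker p
    have e2 := LinearMap.finrank_range_add_finrank_ker π
    rw [hker] at e1
    omega
  rw [← hrank, ← htr, hp, map_smul, map_sum, smul_eq_mul, mul_inv_cancel_left₀ hc]

/-- The permutations of the positions that fix a word. -/
def wordStabilizer {ι κ : Type*} (g : ι → κ) : Subgroup (Equiv.Perm ι) where
  carrier := {τ | g ∘ τ = g}
  one_mem' := rfl
  mul_mem' {σ τ} hσ hτ := by
    simp only [Set.mem_ofPred_eq] at hσ hτ ⊢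
    rw [Equiv.Perm.coe_mul, ← Function.comp_assoc, hσ, hτ]
  inv_mem' {σ} hσ := by
    simp only [Set.mem_ofPred_eq] at hσ ⊢
    funext i
    have := congrFun hσ (σ⁻¹ i)
    simpa using this.symm

theorem mem_wordStabilizer {ι κ : Type*} {g : ι → κ} {τ : Equiv.Perm ι} :
    τ ∈ wordStabilizer g ↔ ∀ i, g (τ i) = g i := funext_iff

/-- Two words with the same content differ by a permutation of the positions. -/
theorem exists_equiv_of_card_fiber_eq {ι ι' κ : Type*} [Fintype ι] [Fintype ι'] [DecidableEq κ]
    {f : ι → κ} {f' : ι' → κ}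
    (h : ∀ k, (Finset.univ.filter fun i => f i = k).card =
      (Finset.univ.filter fun i => f' i = k).card) :
    ∃ τ : ι ≃ ι', ∀ i, f' (τ i) = f i := by
  have e : ∀ k, Nonempty ({i // f i = k} ≃ {i // f' i = k}) := by
    intro k
    rw [← Fintype.card_eq, Fintype.card_subtype, Fintype.card_subtype, h]
  exact ⟨Equiv.ofFiberEquiv fun k => (e k).some, fun i => Equiv.ofFiberEquiv_map _ i⟩

/-! ### Class functions are determined by their sums over stabilizers of words -/

open Classical in
theorem image_support_cycleFactorsFinset {ι : Type*} [Fintype ι] (σ : Equiv.Perm ι) :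
    σ.cycleFactorsFinset.image Equiv.Perm.support =
      Finset.univ.filter fun s : Finset ι => ∃ x y, x ≠ y ∧ σ.SameCycle x y ∧
        s = Finset.univ.filter fun z => σ.SameCycle x z := by
  have key : ∀ x, x ∈ σ.support →
      (σ.cycleOf x).support = Finset.univ.filter fun z => σ.SameCycle x z := by
    intro x hx
    ext z
    rw [Equiv.Perm.mem_support_cycleOf_iff' (Equiv.Perm.mem_support.1 hx)]
    simp
  ext s
  simp only [Finset.mem_image, Finset.mem_filter, Finset.mem_univ, true_and]
  constructor
  · rintro ⟨c, hc, rfl⟩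
    obtain ⟨x, hx⟩ := (Equiv.Perm.mem_cycleFactorsFinset_iff.1 hc).1.nonempty_support
    have hcx : c = σ.cycleOf x := Equiv.Perm.cycle_is_cycleOf hx hc
    have hxs : x ∈ σ.support := Equiv.Perm.mem_cycleFactorsFinset_support_le hc hx
    refine ⟨x, σ x, (Equiv.Perm.mem_support.1 hxs).symm,
      Equiv.Perm.sameCycle_apply_right.2 (Equiv.Perm.SameCycle.refl σ x), ?_⟩
    rw [hcx, key x hxs]
  · rintro ⟨x, y, hxy, hs, rfl⟩
    have hx : x ∈ σ.support := by
      rw [Equiv.Perm.mem_support]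
      intro hx
      exact hxy (hs.eq_of_left hx)
    exact ⟨σ.cycleOf x, Equiv.Perm.cycleOf_mem_cycleFactorsFinset_iff.2 hx, key x hx⟩

theorem isConj_of_sameCycle_iff {ι : Type*} [Fintype ι] {σ τ : Equiv.Perm ι}
    (h : ∀ x y, σ.SameCycle x y ↔ τ.SameCycle x y) : IsConj σ τ := by
  classical
  rw [Equiv.Perm.isConj_iff_cycleType_eq]
  have key : ∀ ρ : Equiv.Perm ι, ρ.cycleType =
      (ρ.cycleFactorsFinset.image Equiv.Perm.support).val.map Finset.card := by
    intro ρ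
    rw [Finset.image_val_of_injOn, Multiset.map_map, Equiv.Perm.cycleType_def]
    intro c hc c' hc' hcc
    by_contra hne
    have hd := Equiv.Perm.cycleFactorsFinset_pairwise_disjoint ρ hc hc' hne
    rw [Equiv.Perm.disjoint_iff_disjoint_support] at hd
    rw [← hcc, disjoint_self] at hd
    have := (Equiv.Perm.mem_cycleFactorsFinset_iff.1 hc).1.nonempty_support
    rw [hd] at this
    exact Finset.not_nonempty_empty this
  rw [key, key, image_support_cycleFactorsFinset, image_support_cycleFactorsFinset]
  simp only [h]

open Classical in
/-- A class function on a symmetric group vanishes if its sums over all stabilizers of words vanish: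
the permutations that preserve the cycles of `τ` are conjugate to `τ` or have more cycles. -/
theorem classFunction_eq_zero {F : Type*} [Field F] [CharZero F] {n : ℕ}
    (f : Equiv.Perm (Fin n) → F) (hf : ∀ σ τ, IsConj σ τ → f σ = f τ)
    (h : ∀ g : Fin n → Fin n, ∑ τ with ∀ i, g (τ i) = g i, f τ = 0) (τ : Equiv.Perm (Fin n)) :
    f τ = 0 := by
  -- Induction on `n - c τ`, where `c τ` is the number of cycles, fixed points included.
  let c : Equiv.Perm (Fin n) → ℕ := fun σ =>
    Fintype.card (Quotient (Equiv.Perm.SameCycle.setoid σ))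
  have hcn : ∀ σ, c σ ≤ n := fun σ => by
    simpa using Fintype.card_quotient_le (Equiv.Perm.SameCycle.setoid σ)
  induction hk : n - c τ using Nat.strong_induction_on generalizing τ with
  | _ k ih =>
    -- The word `g` is constant exactly on the cycles of `τ`.
    let g : Fin n → Fin n := fun i =>
      (Quotient.mk (Equiv.Perm.SameCycle.setoid τ) i).out
    have hg : ∀ i j, g i = g j ↔ τ.SameCycle i j := by
      intro i j
      constructor
      · intro hij
        have := congrArg (Quotient.mk (Equiv.Perm.SameCycle.setoid τ)) hij
        rw [Quotient.out_eq, Quotient.out_eq] at this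
        exact Quotient.exact this
      · intro hij
        exact congrArg Quotient.out (Quotient.sound
          (s := Equiv.Perm.SameCycle.setoid τ) hij)
    have key : ∀ σ ∈ Finset.univ.filter (fun σ : Equiv.Perm (Fin n) => ∀ i, g (σ i) = g i),
        f σ = if IsConj σ τ then f τ else 0 := by
      intro σ hσ
      have hσ' := (Finset.mem_filter.1 hσ).2
      have hsub : ∀ i j, σ.SameCycle i j → τ.SameCycle i j := by
        have : wordStabilizer g ≥ Subgroup.zpowers σ :=
          (Subgroup.zpowers_le).2 (mem_wordStabilizer.2 hσ')
        rintro i j ⟨z, rfl⟩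
        exact ((hg _ _).1 (mem_wordStabilizer.1 (this ⟨z, rfl⟩) i)).symm
      split_ifs with hc
      · exact hf σ τ hc
      · let q : Quotient (Equiv.Perm.SameCycle.setoid σ) →
            Quotient (Equiv.Perm.SameCycle.setoid τ) := Quotient.map id hsub
        have hq : Function.Surjective q := by
          rintro ⟨i⟩
          exact ⟨Quotient.mk _ i, rfl⟩
        have hle : c τ ≤ c σ := Fintype.card_le_of_surjective q hq
        have hne : c τ ≠ c σ := by
          intro heq
          have hinj := ((Fintype.bijective_iff_surjective_and_card q).2 ⟨hq, heq.symm⟩).1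
          refine hc (isConj_of_sameCycle_iff fun x y => ⟨hsub x y, fun hxy => ?_⟩)
          exact Quotient.exact (hinj (a₁ := Quotient.mk _ x) (a₂ := Quotient.mk _ y)
            (Quotient.sound (s := Equiv.Perm.SameCycle.setoid τ) hxy))
        have := hcn σ
        exact ih (n - c σ) (by omega) σ rfl
    have h0 := h g
    rw [Finset.sum_congr rfl key, ← Finset.sum_filter, Finset.sum_const, nsmul_eq_mul,
      mul_eq_zero] at h0
    refine h0.resolve_left ?_
    rw [Nat.cast_eq_zero, Finset.card_eq_zero, ← ne_eq, ← Finset.nonempty_iff_ne_empty]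
    refine ⟨τ, ?_⟩
    simp only [Finset.mem_filter, Finset.mem_univ, true_and]
    exact ⟨fun i => (hg _ _).2 (Equiv.Perm.sameCycle_apply_left.2
      (Equiv.Perm.SameCycle.refl τ i)), IsConj.refl τ⟩

/-! ### Bideterminants and straightening -/

/-- The monomial `∏_c X(row of c, t(c))` of a filling `t` of a Young diagram. -/
def cellMonomial (F : Type*) [Field F] {d : ℕ} {μ : YoungDiagram} (t : μ.cells → Fin d) :
    MvPolynomial (ℕ × Fin d) F :=
  ∏ c, MvPolynomial.X (c.1.1, t c)

/-- The bideterminant of a filling `t` of a Young diagram with letters: the product over the columns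
of the minors `det X(i, t(i', j))` of the generic matrix, written as a signed sum over the column
stabilizer. -/
def bidet (F : Type*) [Field F] {d : ℕ} {μ : YoungDiagram} (t : μ.cells → Fin d) :
    MvPolynomial (ℕ × Fin d) F :=
  ∑ q : Equiv.Perm μ.cells with ∀ c, (q c).1.2 = c.1.2,
    ((Equiv.Perm.sign q : ℤ) : F) • cellMonomial F (t ∘ q)

theorem sign_mul_self (F : Type*) [Field F] {ι : Type*} [Fintype ι] [DecidableEq ι]
    (σ : Equiv.Perm ι) :
    ((Equiv.Perm.sign σ : ℤ) : F) * ((Equiv.Perm.sign σ : ℤ) : F) = 1 := by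
  rcases Int.units_eq_one_or (Equiv.Perm.sign σ) with h | h <;> simp [h]

theorem bidet_comp (F : Type*) [Field F] {d : ℕ} {μ : YoungDiagram} (t : μ.cells → Fin d)
    (s : Equiv.Perm μ.cells) (hs : ∀ c, (s c).1.2 = c.1.2) :
    bidet F (t ∘ s) = ((Equiv.Perm.sign s : ℤ) : F) • bidet F t := by
  rw [bidet, bidet, Finset.smul_sum]
  refine Finset.sum_equiv (Equiv.mulLeft s) ?_ ?_
  · intro q
    simp [hs]
  · intro q _
    rw [smul_smul, Equiv.coe_mulLeft, map_mul, Units.val_mul, Int.cast_mul, ← mul_assoc,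
      sign_mul_self, one_mul]
    rfl

/-- The Garnir relation: the antisymmetrization of a bideterminant over a set `G` of cells vanishes
if every column permutation moves two cells of the same row into `G`. -/
theorem garnir (F : Type*) [Field F] [CharZero F] {d : ℕ} {μ : YoungDiagram}
    (t : μ.cells → Fin d) (G : Finset μ.cells)
    (hG : ∀ q : Equiv.Perm μ.cells, (∀ c, (q c).1.2 = c.1.2) →
      ∃ c c', c ≠ c' ∧ c.1.1 = c'.1.1 ∧ q c ∈ G ∧ q c' ∈ G) :
    ∑ σ : Equiv.Perm μ.cells with ∀ c, c ∉ G → σ c = c,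
      ((Equiv.Perm.sign σ : ℤ) : F) • bidet F (t ∘ σ) = 0 := by
  simp only [bidet, Finset.smul_sum]
  rw [Finset.sum_comm]
  refine Finset.sum_eq_zero fun q hq => ?_
  obtain ⟨c, c', hne, hrow, hc, hc'⟩ := hG q (Finset.mem_filter.1 hq).2
  have hne' : q c ≠ q c' := fun h => hne (q.injective h)
  let s := Equiv.swap (q c) (q c')
  have hmon : ∀ σ : Equiv.Perm μ.cells,
      cellMonomial F ((t ∘ ⇑(σ * s)) ∘ q) = cellMonomial F ((t ∘ σ) ∘ q) := by
    intro σ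
    refine Fintype.prod_equiv (Equiv.swap c c') _ _ fun x => ?_
    have h1 : (Equiv.swap c c' x).1.1 = x.1.1 := by
      by_cases hx : x = c
      · rw [hx, Equiv.swap_apply_left, hrow]
      · by_cases hx' : x = c'
        · rw [hx', Equiv.swap_apply_right, hrow]
        · rw [Equiv.swap_apply_of_ne_of_ne hx hx']
    have h2 : q (Equiv.swap c c' x) = s (q x) := by
      by_cases hx : x = c
      · rw [hx, Equiv.swap_apply_left, Equiv.swap_apply_left]
      · by_cases hx' : x = c'
        · rw [hx', Equiv.swap_apply_right, Equiv.swap_apply_right]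
        · rw [Equiv.swap_apply_of_ne_of_ne hx hx', Equiv.swap_apply_of_ne_of_ne
            (fun h => hx (q.injective h)) (fun h => hx' (q.injective h))]
    simp only [Function.comp_apply, h1, h2, Equiv.Perm.coe_mul]
  set Sm := ∑ σ : Equiv.Perm μ.cells with ∀ c, c ∉ G → σ c = c,
      ((Equiv.Perm.sign σ : ℤ) : F) • ((Equiv.Perm.sign q : ℤ) : F) •
        cellMonomial F ((t ∘ σ) ∘ q) with hS
  -- Multiplication by the transposition of two cells of `G` in one row changes the sign only.
  have hneg : Sm = -Sm := by
    rw [hS, ← Finset.sum_neg_distrib]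
    refine Finset.sum_equiv (Equiv.mulRight s) ?_ ?_
    · intro σ
      simp only [Finset.mem_filter, Finset.mem_univ, true_and, Equiv.coe_mulRight,
        Equiv.Perm.coe_mul, Function.comp_apply]
      refine forall_congr' fun x => imp_congr_right fun hx => ?_
      rw [Equiv.swap_apply_of_ne_of_ne (fun h => hx (by rw [h]; exact hc))
        (fun h => hx (by rw [h]; exact hc'))]
    · intro σ _
      rw [Equiv.coe_mulRight, hmon, map_mul, Equiv.Perm.sign_swap hne']
      simp
  have h2 : (2 : F) • Sm = 0 := by
    rw [two_smul]
    nth_rewrite 2 [hneg]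
    exact add_neg_cancel Sm
  exact (smul_eq_zero.1 h2).resolve_left two_ne_zero

theorem sum_mul_lt_sum_mul_swap {C : Type*} [Fintype C] [DecidableEq C] (w t : C → ℕ) {c c' : C}
    (hw : w c < w c') (ht : t c' < t c) :
    ∑ x, w x * t x < ∑ x, w x * t (Equiv.swap c c' x) := by
  have hne : c ≠ c' := fun h => by subst h; exact lt_irrefl _ hw
  have hc' : c' ∈ Finset.univ.erase c := by simp [hne.symm]
  rw [← Finset.add_sum_erase _ _ (Finset.mem_univ c), ← Finset.add_sum_erase _ _ hc',
    ← Finset.add_sum_erase _ (fun x => w x * t (Equiv.swap c c' x)) (Finset.mem_univ c),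
    ← Finset.add_sum_erase _ (fun x => w x * t (Equiv.swap c c' x)) hc',
    Equiv.swap_apply_left, Equiv.swap_apply_right]
  have h : ∑ x ∈ (Finset.univ.erase c).erase c', w x * t (Equiv.swap c c' x) =
      ∑ x ∈ (Finset.univ.erase c).erase c', w x * t x := by
    refine Finset.sum_congr rfl fun x hx => ?_
    simp only [Finset.mem_erase, Finset.mem_univ, and_true] at hx
    rw [Equiv.swap_apply_of_ne_of_ne hx.2 hx.1]
  rw [h]
  obtain ⟨a, ha⟩ := Nat.exists_eq_add_of_lt hw
  obtain ⟨b, hb⟩ := Nat.exists_eq_add_of_lt ht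
  rw [ha, hb]
  nlinarith

/-- The filling underlying a tableau. -/
def filling {d : ℕ} {μ : YoungDiagram} {α : Fin d → ℕ} (T : Tableaux d μ α) (c : μ.cells) :
    Fin d := ⟨T.1 c.1.1 c.1.2, T.2.1 c.1 c.2⟩

theorem card_filter_cells {μ : YoungDiagram} (p : ℕ × ℕ → Prop) [DecidablePred p] :
    (Finset.univ.filter fun c : μ.cells => p c.1).card = (μ.cells.filter p).card := by
  rw [← Finset.card_map (Function.Embedding.subtype _)]
  congr 1
  ext c
  simp only [Finset.mem_map, Finset.mem_filter, Finset.mem_univ, true_and,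
    Function.Embedding.subtype_apply, Subtype.exists, exists_and_right, exists_eq_right]
  constructor
  · rintro ⟨h1, h2⟩
    exact ⟨h1, h2⟩
  · rintro ⟨h1, h2⟩
    exact ⟨h1, h2⟩

theorem card_filling {d : ℕ} {μ : YoungDiagram} {α : Fin d → ℕ} (T : Tableaux d μ α) (k : Fin d) :
    (Finset.univ.filter fun c => filling T c = k).card = α k := by
  rw [← T.2.2 k, ← card_filter_cells]
  congr 1
  ext c
  simp [filling, Fin.ext_iff]

/-- A filling with weakly increasing rows and strictly increasing columns underlies a tableau. -/
theorem exists_filling_eq {d : ℕ} {μ : YoungDiagram} {α : Fin d → ℕ} (t : μ.cells → Fin d)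
    (hα : ∀ k, (Finset.univ.filter fun c => t c = k).card = α k)
    (hcol : ∀ c c' : μ.cells, c.1.2 = c'.1.2 → c.1.1 < c'.1.1 → t c < t c')
    (hrow : ∀ c c' : μ.cells, c.1.1 = c'.1.1 → c'.1.2 = c.1.2 + 1 → t c ≤ t c') :
    ∃ T : Tableaux d μ α, filling T = t := by
  classical
  have hmem : ∀ {i j}, (i, j) ∈ μ → (i, j) ∈ μ.cells := fun h => (YoungDiagram.mem_cells _).2 h
  let e : ℕ → ℕ → ℕ := fun i j => if h : (i, j) ∈ μ then t ⟨(i, j), hmem h⟩ else 0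
  have he : ∀ {i j} (h : (i, j) ∈ μ), e i j = t ⟨(i, j), hmem h⟩ := fun h => dif_pos h
  have hrow' : ∀ i j k, (i, j + k) ∈ μ → e i j ≤ e i (j + k) := by
    intro i j k
    induction k with
    | zero => intro _; exact le_rfl
    | succ k ih =>
      intro h
      have h1 : (i, j + k) ∈ μ := μ.up_left_mem le_rfl (by omega) h
      refine (ih h1).trans ?_
      rw [he h1, he h]
      exact hrow _ _ rfl rfl
  let T : SemistandardYoungTableau μ :=
    { entry := e
      row_weak' := by
        intro i j1 j2 hj hc
        obtain ⟨k, rfl⟩ := Nat.exists_eq_add_of_le hj.le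
        exact hrow' i j1 k hc
      col_strict' := by
        intro i1 i2 j hi hc
        have h1 : (i1, j) ∈ μ := μ.up_left_mem hi.le le_rfl hc
        rw [he h1, he hc]
        exact hcol _ _ rfl hi
      zeros' := fun hc => dif_neg hc }
  have hT : ∀ c : μ.cells, T c.1.1 c.1.2 = t c := fun c => he ((YoungDiagram.mem_cells _).1 c.2)
  refine ⟨⟨T, fun c hc => ?_, fun k => ?_⟩, funext fun c => Fin.ext (hT c)⟩
  · rw [hT ⟨c, hc⟩]
    exact (t ⟨c, hc⟩).2
  · rw [← hα k, ← card_filter_cells]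
    congr 1
    ext c
    simp [hT, Fin.ext_iff]

theorem card_filter_comp_equiv {ι κ : Type*} [Fintype ι] [DecidableEq κ] (t : ι → κ)
    (s : Equiv.Perm ι) (k : κ) :
    (Finset.univ.filter fun c => (t ∘ s) c = k).card =
      (Finset.univ.filter fun c => t c = k).card :=
  Finset.card_equiv s (by simp)

/-- The inequality behind straightening: permuting the cells of a Garnir set moves larger letters
to the right. -/
theorem sum_col_mul_lt {C : Type*} [Fintype C] (col t : C → ℕ) (σ : Equiv.Perm C) (G : Finset C)
    {j v : ℕ} (hσ : ∀ c, c ∉ G → σ c = c) (hG : ∀ c ∈ G, col c = j ∧ v < t c ∨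
      col c = j + 1 ∧ t c ≤ v) (hcol : ¬ ∀ c, col (σ c) = col c) :
    ∑ c, col c * t c < ∑ c, col c * t (σ c) := by
  have hmaps : ∀ c ∈ G, σ c ∈ G := by
    intro c hc
    by_contra h
    have h2 := σ.injective (hσ _ h)
    rw [h2] at h
    exact h hc
  have h0 : ∑ c, ((col c : ℤ) - col (σ c)) = 0 := by
    rw [Finset.sum_sub_distrib, Equiv.sum_comp σ fun c => (col c : ℤ), sub_self]
  have hnn : ∀ c, 0 ≤ ((col c : ℤ) - col (σ c)) * (t (σ c) - v) ∧
      (0 < (col c : ℤ) - col (σ c) → 0 < ((col c : ℤ) - col (σ c)) * (t (σ c) - v)) := by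
    intro c
    by_cases hc : c ∈ G
    · rcases hG c hc with ⟨h1, h2⟩ | ⟨h1, h2⟩ <;>
      rcases hG _ (hmaps c hc) with ⟨h3, h4⟩ | ⟨h3, h4⟩ <;>
      rw [h1, h3] <;> push_cast <;> constructor <;> intros <;> nlinarith
    · simp [hσ c hc]
  have hpos : ∃ c, 0 < (col c : ℤ) - col (σ c) := by
    by_contra hno
    push Not at hno
    refine hcol fun c => ?_
    have := (Finset.sum_eq_zero_iff_of_nonpos fun c _ => hno c).1 h0 c (Finset.mem_univ c)
    omega
  obtain ⟨c₀, hc₀⟩ := hpos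
  have h1 : 0 < ∑ c, ((col c : ℤ) - col (σ c)) * (t (σ c) - v) :=
    Finset.sum_pos' (fun c _ => (hnn c).1) ⟨c₀, Finset.mem_univ _, (hnn c₀).2 hc₀⟩
  have h2 : ∑ c, ((col c : ℤ) - col (σ c)) * (t (σ c) - v) =
      ∑ c, (col c : ℤ) * t (σ c) - ∑ c, (col c : ℤ) * t c := by
    have e1 := Equiv.sum_comp σ fun c => (col c : ℤ) * t c
    have e2 := Equiv.sum_comp σ fun c => (col c : ℤ) * v
    simp only [mul_sub, sub_mul, Finset.sum_sub_distrib]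
    linarith
  rw [h2] at h1
  have : (∑ c, (col c : ℤ) * t c) < ∑ c, (col c : ℤ) * t (σ c) := by omega
  exact_mod_cast this

/-- Every column permutation moves two cells of the same row into the Garnir set that consists of
the lower part of a column and the upper part of the next column. -/
theorem exists_row_eq_of_garnir {μ : YoungDiagram} {i j : ℕ} (hij : (i, j + 1) ∈ μ)
    (q : Equiv.Perm μ.cells) (hq : ∀ c, (q c).1.2 = c.1.2) :
    ∃ c c' : μ.cells, c ≠ c' ∧ c.1.1 = c'.1.1 ∧
      ((q c).1.2 = j ∧ i ≤ (q c).1.1 ∨ (q c).1.2 = j + 1 ∧ (q c).1.1 ≤ i) ∧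
      ((q c').1.2 = j ∧ i ≤ (q c').1.1 ∨ (q c').1.2 = j + 1 ∧ (q c').1.1 ≤ i) := by
  classical
  set L := μ.colLen j with hL
  have hiL : i < L := by
    rw [hL, ← YoungDiagram.mem_iff_lt_colLen]
    exact μ.up_left_mem le_rfl (Nat.le_succ j) hij
  have hj : ∀ k, k < L → (k, j) ∈ μ.cells := fun k hk =>
    (YoungDiagram.mem_cells _).2 (YoungDiagram.mem_iff_lt_colLen.2 hk)
  have hj1 : ∀ k, k ≤ i → (k, j + 1) ∈ μ.cells := fun k hk =>
    (YoungDiagram.mem_cells _).2 (μ.up_left_mem hk le_rfl hij)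
  let f : Fin (L + 1) → μ.cells := fun k =>
    if h : (k : ℕ) ≤ i then ⟨(k, j + 1), hj1 k h⟩
    else ⟨((k : ℕ) - 1, j), hj _ (by have := k.2; omega)⟩
  have hf : ∀ k, (f k).1.2 = j ∧ i ≤ (f k).1.1 ∨ (f k).1.2 = j + 1 ∧ (f k).1.1 ≤ i := by
    intro k
    by_cases h : (k : ℕ) ≤ i
    · right
      simp only [f, dif_pos h, true_and]
      exact h
    · left
      simp only [f, dif_neg h, true_and]
      omega
  have hfinj : Function.Injective f := by
    intro k k' hkk
    by_cases h : (k : ℕ) ≤ i <;> by_cases h' : (k' : ℕ) ≤ i <;>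
      simp only [f, h, h', dite_true, dite_false, Subtype.mk.injEq, Prod.mk.injEq] at hkk <;>
      apply Fin.ext <;> omega
  have hlt : ∀ k, (q.symm (f k)).1.1 < L := by
    intro k
    have h1 : (q.symm (f k)).1.2 = (f k).1.2 := by
      rw [← hq (q.symm (f k)), Equiv.apply_symm_apply]
    have h2 : (q.symm (f k)).1 ∈ μ := (YoungDiagram.mem_cells _).1 (q.symm (f k)).2
    rw [hL, ← YoungDiagram.mem_iff_lt_colLen]
    refine μ.up_left_mem le_rfl ?_ h2
    rw [h1]
    rcases hf k with h | h <;> omega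
  obtain ⟨k, -, k', -, hne, heq⟩ := Finset.exists_ne_map_eq_of_card_lt_of_maps_to
    (s := (Finset.univ : Finset (Fin (L + 1)))) (t := Finset.range L) (by simp)
    (f := fun k => (q.symm (f k)).1.1) (fun k _ => by simpa using hlt k)
  refine ⟨q.symm (f k), q.symm (f k'), fun h => hne (hfinj (q.symm.injective h)), heq, ?_, ?_⟩
  · rw [Equiv.apply_symm_apply]; exact hf k
  · rw [Equiv.apply_symm_apply]; exact hf k'

/-- Straightening: the bideterminants of the semistandard fillings span those of all fillings with
the same content. -/
theorem bidet_mem_span (F : Type*) [Field F] [CharZero F] {d : ℕ} {μ : YoungDiagram}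
    {α : Fin d → ℕ} (t : μ.cells → Fin d)
    (hα : ∀ k, (Finset.univ.filter fun c => t c = k).card = α k) :
    bidet F t ∈ Submodule.span F (Set.range fun T : Tableaux d μ α => bidet F (filling T)) := by
  classical
  set S := Submodule.span F (Set.range fun T : Tableaux d μ α => bidet F (filling T)) with hS
  by_contra hbad
  -- Among the fillings outside the span, take one that is maximal for the pair of weights
  -- `∑ (column) · t`, `∑ (row) · t`, ordered lexicographically.
  let B : Finset (μ.cells → Fin d) := Finset.univ.filter fun t =>
    (∀ k, (Finset.univ.filter fun c => t c = k).card = α k) ∧ bidet F t ∉ S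
  let M : (μ.cells → Fin d) → ℕ ×ₗ ℕ := fun t =>
    toLex (∑ c, c.1.2 * (t c : ℕ), ∑ c, c.1.1 * (t c : ℕ))
  obtain ⟨t, ht, hmax⟩ := B.exists_max_image M
    ⟨t, Finset.mem_filter.2 ⟨Finset.mem_univ _, hα, hbad⟩⟩
  obtain ⟨-, hα, hbad⟩ := Finset.mem_filter.1 ht
  clear ht
  have hgood : ∀ s : Equiv.Perm μ.cells, M t < M (t ∘ s) → bidet F (t ∘ s) ∈ S := by
    intro s hs
    by_contra hno
    refine absurd (hmax (t ∘ s) (Finset.mem_filter.2 ⟨Finset.mem_univ _, fun k => ?_, hno⟩))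
      (not_le.2 hs)
    rw [card_filter_comp_equiv, hα]
  -- The columns of `t` are strictly increasing.
  have hcol : ∀ c c' : μ.cells, c.1.2 = c'.1.2 → c.1.1 < c'.1.1 → t c < t c' := by
    intro c c' h1 h2
    by_contra h3
    have hne : c ≠ c' := fun h => by rw [h] at h2; exact lt_irrefl _ h2
    have hs : ∀ x, (Equiv.swap c c' x).1.2 = x.1.2 := by
      intro x
      by_cases hx : x = c
      · rw [hx, Equiv.swap_apply_left, h1]
      · by_cases hx' : x = c'
        · rw [hx', Equiv.swap_apply_right, h1]
        · rw [Equiv.swap_apply_of_ne_of_ne hx hx']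
    have hb := bidet_comp F t (Equiv.swap c c') hs
    rw [Equiv.Perm.sign_swap hne] at hb
    simp only [Units.val_neg, Units.val_one, Int.cast_neg, Int.cast_one, neg_smul, one_smul] at hb
    rcases (not_lt.1 h3).lt_or_eq with h4 | h4
    · have hM : M t < M (t ∘ Equiv.swap c c') := by
        rw [Prod.Lex.toLex_lt_toLex]
        right
        constructor
        · rw [← Equiv.sum_comp (Equiv.swap c c')]
          refine Finset.sum_congr rfl fun x _ => ?_
          rw [hs]
          rfl
        · exact sum_mul_lt_sum_mul_swap (fun x : μ.cells => x.1.1) (fun x => (t x : ℕ)) h2 h4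
      have := hgood _ hM
      rw [hb] at this
      exact hbad (by simpa using S.neg_mem this)
    · have ht : t ∘ Equiv.swap c c' = t := by
        funext x
        by_cases hx : x = c
        · rw [Function.comp_apply, hx, Equiv.swap_apply_left, h4]
        · by_cases hx' : x = c'
          · rw [Function.comp_apply, hx', Equiv.swap_apply_right, h4]
          · rw [Function.comp_apply, Equiv.swap_apply_of_ne_of_ne hx hx']
      rw [ht] at hb
      have h2 : (2 : F) • bidet F t = 0 := by
        rw [two_smul]
        nth_rewrite 2 [hb]
        exact add_neg_cancel _
      refine hbad ?_
      rw [(smul_eq_zero.1 h2).resolve_left two_ne_zero]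
      exact S.zero_mem
  -- The rows of `t` are weakly increasing.
  have hrow : ∀ c c' : μ.cells, c.1.1 = c'.1.1 → c'.1.2 = c.1.2 + 1 → t c ≤ t c' := by
    rintro ⟨⟨i, j⟩, hc⟩ ⟨⟨i', j'⟩, hc'⟩ h1 h2
    simp only at h1 h2
    subst h1 h2
    by_contra hlt
    rw [not_le] at hlt
    set G : Finset μ.cells := Finset.univ.filter fun c =>
      c.1.2 = j ∧ i ≤ c.1.1 ∨ c.1.2 = j + 1 ∧ c.1.1 ≤ i with hGdef
    have hgar := garnir F t G fun q hq => by
      obtain ⟨c, c', h1, h2, h3, h4⟩ :=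
        exists_row_eq_of_garnir ((YoungDiagram.mem_cells _).1 hc') q hq
      exact ⟨c, c', h1, h2, Finset.mem_filter.2 ⟨Finset.mem_univ _, h3⟩,
        Finset.mem_filter.2 ⟨Finset.mem_univ _, h4⟩⟩
    have hGle : ∀ c ∈ G, c.1.2 = j ∧ (t ⟨(i, j + 1), hc'⟩ : ℕ) < t c ∨
        c.1.2 = j + 1 ∧ (t c : ℕ) ≤ t ⟨(i, j + 1), hc'⟩ := by
      intro c hcG
      rcases (Finset.mem_filter.1 hcG).2 with ⟨h1, h2⟩ | ⟨h1, h2⟩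
      · refine Or.inl ⟨h1, ?_⟩
        have : t ⟨(i, j), hc⟩ ≤ t c := by
          rcases h2.lt_or_eq with h3 | h3
          · exact (hcol ⟨(i, j), hc⟩ c h1.symm h3).le
          · exact le_of_eq (congrArg t (Subtype.ext (Prod.ext h3 h1.symm)))
        exact lt_of_lt_of_le hlt this
      · refine Or.inr ⟨h1, ?_⟩
        rcases h2.lt_or_eq with h3 | h3
        · exact (hcol c ⟨(i, j + 1), hc'⟩ h1 h3).le
        · exact le_of_eq (congrArg (fun c => (t c : ℕ)) (Subtype.ext (Prod.ext h3 h1)))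
    rw [← Finset.sum_filter_add_sum_filter_not _
      (fun σ : Equiv.Perm μ.cells => ∀ c, (σ c).1.2 = c.1.2)] at hgar
    -- In the Garnir relation, the permutations that preserve the columns contribute a multiple of
    -- `bidet F t`; all others increase the first weight.
    have hrest : ∑ σ ∈ (Finset.univ.filter fun σ : Equiv.Perm μ.cells =>
          ∀ c, c ∉ G → σ c = c).filter
          (fun σ => ¬ ∀ c, (σ c).1.2 = c.1.2),
        ((Equiv.Perm.sign σ : ℤ) : F) • bidet F (t ∘ σ) ∈ S := by
      refine S.sum_mem fun σ hσ => S.smul_mem _ (hgood σ ?_)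
      simp only [Finset.mem_filter, Finset.mem_univ, true_and] at hσ
      rw [Prod.Lex.toLex_lt_toLex]
      exact Or.inl (sum_col_mul_lt (fun c : μ.cells => c.1.2) (fun c => (t c : ℕ)) σ G
        hσ.1 hGle hσ.2)
    have hmain : ∑ σ ∈ (Finset.univ.filter fun σ : Equiv.Perm μ.cells =>
          ∀ c, c ∉ G → σ c = c).filter (fun σ => ∀ c, (σ c).1.2 = c.1.2),
        ((Equiv.Perm.sign σ : ℤ) : F) • bidet F (t ∘ σ) =
        (((Finset.univ.filter fun σ : Equiv.Perm μ.cells =>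
          ∀ c, c ∉ G → σ c = c).filter (fun σ => ∀ c, (σ c).1.2 = c.1.2)).card : F) •
          bidet F t := by
      rw [Finset.sum_congr rfl fun σ hσ => ?_, Finset.sum_const, Nat.cast_smul_eq_nsmul]
      rw [bidet_comp F t σ (Finset.mem_filter.1 hσ).2, smul_smul, sign_mul_self, one_smul]
    rw [hmain] at hgar
    refine hbad ?_
    have hN : (((Finset.univ.filter fun σ : Equiv.Perm μ.cells =>
          ∀ c, c ∉ G → σ c = c).filter (fun σ => ∀ c, (σ c).1.2 = c.1.2)).card : F) ≠ 0 := by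
      rw [Nat.cast_ne_zero]
      exact Finset.card_ne_zero_of_mem (a := 1) (by simp)
    rw [← S.smul_mem_iff hN, eq_neg_of_add_eq_zero_left hgar]
    exact S.neg_mem hrest
  obtain ⟨T, hT⟩ := exists_filling_eq (α := α) t hα hcol hrow
  exact hbad (Submodule.subset_span ⟨T, by rw [← hT]⟩)

/-! ### Semistandard bideterminants are independent -/

/-- The exponent of the monomial of a filling: the number of times a letter occurs in a row. -/
def fillingExp {d : ℕ} {μ : YoungDiagram} (t : μ.cells → Fin d) : (ℕ × Fin d) →₀ ℕ :=
  ∑ c, Finsupp.single (c.1.1, t c) 1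

theorem cellMonomial_eq (F : Type*) [Field F] {d : ℕ} {μ : YoungDiagram} (t : μ.cells → Fin d) :
    cellMonomial F t = MvPolynomial.monomial (fillingExp t) 1 := by
  rw [cellMonomial, fillingExp, MvPolynomial.monomial_sum_one]
  rfl

theorem fillingExp_apply {d : ℕ} {μ : YoungDiagram} (t : μ.cells → Fin d) (i : ℕ) (k : Fin d) :
    fillingExp t (i, k) = (Finset.univ.filter fun c : μ.cells => c.1.1 = i ∧ t c = k).card := by
  rw [fillingExp, Finsupp.finsetSum_apply, Finset.card_filter]
  refine Finset.sum_congr rfl fun c _ => ?_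
  rw [Finsupp.single_apply]
  simp only [Prod.mk.injEq]

/-- The weight `∑_c (row of c) · t(c)`, which is a function of the monomial of `t`. -/
theorem sum_row_mul_eq {d : ℕ} {μ : YoungDiagram} {t t' : μ.cells → Fin d}
    (h : fillingExp t = fillingExp t') :
    ∑ c, c.1.1 * (t c : ℕ) = ∑ c, c.1.1 * (t' c : ℕ) := by
  have key : ∀ t : μ.cells → Fin d, ∑ c, c.1.1 * (t c : ℕ) =
      (fillingExp t).sum fun x m => m * (x.1 * (x.2 : ℕ)) := by
    intro t
    rw [fillingExp, ← Finsupp.sum_finsetSum_index (by simp) (by intros; ring)]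
    refine Finset.sum_congr rfl fun c _ => ?_
    rw [Finsupp.sum_single_index (by simp), one_mul]
  rw [key, key, h]

/-- Among the column rearrangements of a filling with strictly increasing columns, the filling
itself has the largest weight. -/
theorem sum_row_mul_comp_lt {d : ℕ} {μ : YoungDiagram} {t : μ.cells → Fin d}
    (hcol : ∀ c c' : μ.cells, c.1.2 = c'.1.2 → c.1.1 < c'.1.1 → t c < t c')
    (q : Equiv.Perm μ.cells) (hq : ∀ c, (q c).1.2 = c.1.2) (hne : q ≠ 1) :
    ∑ c, c.1.1 * (t (q c) : ℕ) < ∑ c, c.1.1 * (t c : ℕ) := by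
  classical
  let Q := Finset.univ.filter fun q : Equiv.Perm μ.cells => ∀ c, (q c).1.2 = c.1.2
  -- A column permutation of maximal weight is the identity.
  have hmaxone : ∀ p ∈ Q, (∀ q ∈ Q, ∑ c, c.1.1 * (t (q c) : ℕ) ≤ ∑ c, c.1.1 * (t (p c) : ℕ)) →
      p = 1 := by
    intro p hp hmax
    have hp' := (Finset.mem_filter.1 hp).2
    have hmono : ∀ c c' : μ.cells, c.1.2 = c'.1.2 → c.1.1 < c'.1.1 →
        (p c).1.1 < (p c').1.1 := by
      intro c c' h1 h2
      by_contra h3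
      have hne : c ≠ c' := fun h => by rw [h] at h2; exact lt_irrefl _ h2
      have h4 : (p c').1.1 < (p c).1.1 := by
        refine lt_of_le_of_ne (not_lt.1 h3) fun h => hne (p.injective (Subtype.ext ?_))
        exact Prod.ext h.symm (by rw [hp', hp', h1])
      have h5 : t (p c') < t (p c) := hcol _ _ (by rw [hp', hp', h1]) h4
      have hs : ∀ x, (Equiv.swap c c' x).1.2 = x.1.2 := by
        intro x
        by_cases hx : x = c
        · rw [hx, Equiv.swap_apply_left, h1]
        · by_cases hx' : x = c'
          · rw [hx', Equiv.swap_apply_right, h1]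
          · rw [Equiv.swap_apply_of_ne_of_ne hx hx']
      have h6 := sum_mul_lt_sum_mul_swap (fun x : μ.cells => x.1.1)
        (fun x => (t (p x) : ℕ)) h2 h5
      have h7 := hmax (p * Equiv.swap c c') (Finset.mem_filter.2 ⟨Finset.mem_univ _, fun x => by
        rw [Equiv.Perm.coe_mul, Function.comp_apply, hp', hs]⟩)
      exact absurd h7 (not_le.2 h6)
    have hge : ∀ (i j : ℕ) (h : (i, j) ∈ μ.cells), i ≤ (p ⟨(i, j), h⟩).1.1 := by
      intro i j
      induction i with
      | zero => intro _; exact Nat.zero_le _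
      | succ i ih =>
        intro h
        have h1 : (i, j) ∈ μ.cells := (YoungDiagram.mem_cells _).2
          (μ.up_left_mem (Nat.le_succ i) le_rfl ((YoungDiagram.mem_cells _).1 h))
        have := hmono ⟨(i, j), h1⟩ ⟨(i + 1, j), h⟩ rfl (Nat.lt_succ_self i)
        have := ih h1
        omega
    have hsum : ∑ c : μ.cells, c.1.1 = ∑ c, (p c).1.1 :=
      (Equiv.sum_comp p fun c => c.1.1).symm
    have heq := (Finset.sum_eq_sum_iff_of_le fun c _ => hge c.1.1 c.1.2 c.2).1 hsum
    ext1 c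
    exact Subtype.ext (Prod.ext (heq c (Finset.mem_univ c)).symm (hp' c))
  have hone : (1 : Equiv.Perm μ.cells) ∈ Q := Finset.mem_filter.2 ⟨Finset.mem_univ _, fun _ => rfl⟩
  obtain ⟨p, hp, hmax⟩ := Q.exists_max_image (fun q => ∑ c, c.1.1 * (t (q c) : ℕ)) ⟨1, hone⟩
  have hp1 := hmaxone p hp hmax
  subst hp1
  have hqQ : q ∈ Q := Finset.mem_filter.2 ⟨Finset.mem_univ _, hq⟩
  refine lt_of_le_of_ne (hmax q hqQ) fun h => hne (hmaxone q hqQ fun r hr => ?_)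
  rw [h]
  exact hmax r hr

theorem filling_injective {d : ℕ} {μ : YoungDiagram} {α : Fin d → ℕ} :
    Function.Injective (filling : Tableaux d μ α → μ.cells → Fin d) := by
  intro T T' h
  refine Subtype.ext (SemistandardYoungTableau.ext fun i j => ?_)
  by_cases hc : (i, j) ∈ μ
  · exact congrArg Fin.val (congrFun h ⟨(i, j), (YoungDiagram.mem_cells _).2 hc⟩)
  · rw [T.1.zeros hc, T'.1.zeros hc]

/-- A tableau is determined by the contents of its rows. -/
theorem fillingExp_injective {d : ℕ} {μ : YoungDiagram} {α : Fin d → ℕ} {T T' : Tableaux d μ α}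
    (h : fillingExp (filling T) = fillingExp (filling T')) : T = T' := by
  classical
  -- The number of entries `≤ k` in a row determines the row.
  have hcard : ∀ (T : Tableaux d μ α) (i k : ℕ),
      (Finset.univ.filter fun c : μ.cells => c.1.1 = i ∧ (filling T c : ℕ) ≤ k).card =
        ∑ k' ∈ Finset.univ.filter (fun k' : Fin d => (k' : ℕ) ≤ k),
          fillingExp (filling T) (i, k') := by
    intro T i k
    rw [Finset.card_eq_sum_card_fiberwise (f := filling T)
      (t := Finset.univ.filter fun k' : Fin d => (k' : ℕ) ≤ k)]
    · refine Finset.sum_congr rfl fun k' hk' => ?_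
      rw [fillingExp_apply, Finset.filter_filter]
      congr 1
      ext c
      simp only [Finset.mem_filter, Finset.mem_univ, true_and] at hk' ⊢
      constructor
      · rintro ⟨⟨h1, -⟩, h2⟩
        exact ⟨h1, h2⟩
      · rintro ⟨h1, h2⟩
        exact ⟨⟨h1, h2 ▸ hk'⟩, h2⟩
    · intro c hc
      simpa using (by simpa using hc : _ ∧ _).2
  have hlt : ∀ (T : Tableaux d μ α) (c : μ.cells) (k : ℕ), (filling T c : ℕ) ≤ k ↔
      c.1.2 < (Finset.univ.filter fun c' : μ.cells =>
        c'.1.1 = c.1.1 ∧ (filling T c' : ℕ) ≤ k).card := by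
    intro T c k
    have hrow : ∀ c' : μ.cells, c'.1.1 = c.1.1 → c'.1.2 ≤ c.1.2 →
        (filling T c' : ℕ) ≤ filling T c := by
      intro c' h1 h2
      have h3 : (c.1.1, c.1.2) ∈ μ := (YoungDiagram.mem_cells _).1 c.2
      have := T.1.row_weak_of_le h2 h3
      change T.1 c'.1.1 c'.1.2 ≤ T.1 c.1.1 c.1.2
      rw [h1]
      exact this
    have hrow' : ∀ c' : μ.cells, c'.1.1 = c.1.1 → c.1.2 ≤ c'.1.2 →
        (filling T c : ℕ) ≤ filling T c' := by
      intro c' h1 h2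
      have h3 : (c'.1.1, c'.1.2) ∈ μ := (YoungDiagram.mem_cells _).1 c'.2
      have := T.1.row_weak_of_le h2 h3
      change T.1 c.1.1 c.1.2 ≤ T.1 c'.1.1 c'.1.2
      rw [← h1]
      exact this
    constructor
    · intro hk
      let e : Fin (c.1.2 + 1) ↪ μ.cells :=
        ⟨fun j => ⟨(c.1.1, j), (YoungDiagram.mem_cells _).2 (μ.up_left_mem le_rfl
          (Nat.lt_succ_iff.1 j.2) ((YoungDiagram.mem_cells _).1 c.2))⟩, fun j j' hjj => by
            simpa [Fin.ext_iff] using hjj⟩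
      have h1 : (Finset.univ.map e) ⊆ Finset.univ.filter fun c' : μ.cells =>
          c'.1.1 = c.1.1 ∧ (filling T c' : ℕ) ≤ k := by
        intro x hx
        obtain ⟨j, -, rfl⟩ := Finset.mem_map.1 hx
        exact Finset.mem_filter.2 ⟨Finset.mem_univ _, rfl,
          (hrow (e j) rfl (Nat.lt_succ_iff.1 j.2)).trans hk⟩
      have h2 := Finset.card_le_card h1
      rw [Finset.card_map, Finset.card_univ, Fintype.card_fin] at h2
      exact h2
    · intro hk
      by_contra hno
      have h1 : (Finset.univ.filter fun c' : μ.cells =>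
          c'.1.1 = c.1.1 ∧ (filling T c' : ℕ) ≤ k).card ≤ (Finset.range c.1.2).card := by
        refine Finset.card_le_card_of_injOn (fun c' => c'.1.2) ?_ ?_
        · intro c' hc'
          simp only [Finset.coe_filter, Finset.mem_univ, true_and, Set.mem_ofPred_eq] at hc'
          simp only [Finset.coe_range, Set.mem_Iio]
          by_contra h3
          have := hrow' c' hc'.1 (not_lt.1 h3)
          omega
        · intro c' hc' c'' hc'' hcc
          simp only [Finset.coe_filter, Finset.mem_univ, true_and, Set.mem_ofPred_eq] at hc' hc''
          exact Subtype.ext (Prod.ext (hc'.1.trans hc''.1.symm) hcc)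
      rw [Finset.card_range] at h1
      omega
  refine filling_injective (funext fun c => Fin.ext ?_)
  have key : ∀ k, (filling T c : ℕ) ≤ k ↔ (filling T' c : ℕ) ≤ k := by
    intro k
    rw [hlt, hlt, hcard, hcard, h]
  have h1 := (key (filling T c)).1 le_rfl
  have h2 := (key (filling T' c)).2 le_rfl
  omega

theorem filling_col_strict {d : ℕ} {μ : YoungDiagram} {α : Fin d → ℕ} (T : Tableaux d μ α)
    (c c' : μ.cells) (h1 : c.1.2 = c'.1.2) (h2 : c.1.1 < c'.1.1) :
    filling T c < filling T c' := by
  have h3 : (c'.1.1, c'.1.2) ∈ μ := (YoungDiagram.mem_cells _).1 c'.2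
  have := T.1.col_strict h2 h3
  change T.1 c.1.1 c.1.2 < T.1 c'.1.1 c'.1.2
  rw [h1]
  exact this

theorem linearIndependent_bidet (F : Type*) [Field F] [CharZero F] (d : ℕ) (μ : YoungDiagram)
    (α : Fin d → ℕ) :
    LinearIndependent F fun T : Tableaux d μ α => bidet F (filling T) := by
  classical
  have : Fintype (Tableaux d μ α) := Fintype.ofFinite _
  rw [Fintype.linearIndependent_iff]
  intro a ha
  by_contra! hne
  -- In a linear relation, take the tableau of the largest weight: its leading monomial occurs in no
  -- other bideterminant of the relation.
  let wt : Tableaux d μ α → ℕ := fun T => ∑ c, c.1.1 * (filling T c : ℕ)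
  obtain ⟨T₀, hT₀, hmax⟩ := (Finset.univ.filter fun T => a T ≠ 0).exists_max_image wt (by
    obtain ⟨T, hT⟩ := hne
    exact ⟨T, Finset.mem_filter.2 ⟨Finset.mem_univ _, hT⟩⟩)
  have ha₀ := (Finset.mem_filter.1 hT₀).2
  have hcoeff : ∀ T, a T ≠ 0 → (bidet F (filling T)).coeff (fillingExp (filling T₀)) =
      if T = T₀ then 1 else 0 := by
    intro T hT
    have hle := hmax T (Finset.mem_filter.2 ⟨Finset.mem_univ _, hT⟩)
    rw [bidet, MvPolynomial.coeff_sum]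
    simp only [MvPolynomial.coeff_smul, cellMonomial_eq, MvPolynomial.coeff_monomial, smul_eq_mul,
      mul_ite, mul_one, mul_zero]
    rw [Finset.sum_eq_single_of_mem 1 (by simp)]
    · simp only [Equiv.Perm.sign_one, Units.val_one, Int.cast_one, Equiv.Perm.coe_one,
        Function.comp_id]
      by_cases hTT : T = T₀
      · rw [if_pos hTT, if_pos (by rw [hTT])]
      · rw [if_neg hTT, if_neg fun h => hTT (fillingExp_injective h)]
    · intro q hq hq1
      rw [if_neg]
      intro h
      have h1 := sum_row_mul_comp_lt (filling_col_strict T) q (Finset.mem_filter.1 hq).2 hq1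
      have h2 := sum_row_mul_eq h
      simp only [Function.comp_apply] at h2
      have h3 : wt T₀ < wt T := by rw [h2] at h1; exact h1
      omega
  have h0 := congrArg (MvPolynomial.coeff (fillingExp (filling T₀))) ha
  rw [MvPolynomial.coeff_sum, MvPolynomial.coeff_zero] at h0
  rw [Finset.sum_eq_single T₀] at h0
  · rw [MvPolynomial.coeff_smul, hcoeff T₀ ha₀, if_pos rfl, smul_eq_mul, mul_one] at h0
    exact ha₀ h0
  · intro T _ hTT
    rw [MvPolynomial.coeff_smul]
    by_cases hT : a T = 0
    · rw [hT, zero_smul]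
    · rw [hcoeff T hT, if_neg hTT, smul_zero]
  · intro h
    exact absurd (Finset.mem_univ _) h

/-- The bideterminants of the fillings of content `α` span a space of dimension the Kostka
number. -/
theorem finrank_span_bidet (F : Type*) [Field F] [CharZero F] (d : ℕ) (μ : YoungDiagram)
    (α : Fin d → ℕ) :
    Module.finrank F (Submodule.span F (bidet F '' {t : μ.cells → Fin d |
      ∀ k, (Finset.univ.filter fun c => t c = k).card = α k})) = kostka d μ α := by
  have : Fintype (Tableaux d μ α) := Fintype.ofFinite _
  have h : Submodule.span F (bidet F '' {t : μ.cells → Fin d |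
      ∀ k, (Finset.univ.filter fun c => t c = k).card = α k}) =
      Submodule.span F (Set.range fun T : Tableaux d μ α => bidet F (filling T)) := by
    apply le_antisymm
    · rw [Submodule.span_le]
      rintro _ ⟨t, ht, rfl⟩
      exact bidet_mem_span F t ht
    · refine Submodule.span_mono ?_
      rintro _ ⟨T, rfl⟩
      exact ⟨filling T, card_filling T, rfl⟩
  rw [h, finrank_span_eq_card (linearIndependent_bidet F d μ α), kostka, Nat.card_eq_fintype_card]

/-! ### Young's rule for Specht modules -/

/-- The map from row assignments to polynomials in a generic matrix given by a word `g`: the number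
`i` in row `r i` becomes the variable `X(r i, g i)`. -/
def tabloidMap (F : Type*) [Field F] {n d : ℕ} (g : Fin n → Fin d) :
    ((Fin n → ℕ) →₀ F) →ₗ[F] MvPolynomial (ℕ × Fin d) F :=
  Finsupp.linearCombination F fun r => ∏ i, MvPolynomial.X (r i, g i)

theorem tabloidMap_single (F : Type*) [Field F] {n d : ℕ} (g : Fin n → Fin d) (r : Fin n → ℕ) :
    tabloidMap F g (Finsupp.single r 1) = ∏ i, MvPolynomial.X (r i, g i) := by
  rw [tabloidMap, Finsupp.linearCombination_single, one_smul]

theorem tabloidRep_single (F : Type*) [Field F] {n : ℕ} (σ : Equiv.Perm (Fin n)) (r : Fin n → ℕ) :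
    tabloidRep F n σ (Finsupp.single r 1) = Finsupp.single (r ∘ ⇑σ⁻¹) 1 := by
  simp [tabloidRep]

theorem tabloidMap_tabloidRep (F : Type*) [Field F] {n d : ℕ} (g : Fin n → Fin d)
    (σ : Equiv.Perm (Fin n)) (hσ : σ ∈ wordStabilizer g) (v : (Fin n → ℕ) →₀ F) :
    tabloidMap F g (tabloidRep F n σ v) = tabloidMap F g v := by
  have h : tabloidMap F g ∘ₗ tabloidRep F n σ = tabloidMap F g := by
    refine Finsupp.lhom_ext' fun r => LinearMap.ext_ring ?_
    simp only [LinearMap.comp_apply, Finsupp.lsingle_apply]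
    rw [tabloidRep_single, tabloidMap_single, tabloidMap_single]
    refine (Fintype.prod_equiv σ _ _ fun i => ?_).symm
    rw [mem_wordStabilizer.1 hσ i]
    simp
  exact LinearMap.congr_fun h v

/-- Row assignments with the same monomial are conjugate under the stabilizer of the word. -/
theorem exists_comp_eq_of_prod_X_eq (F : Type*) [Field F] {n d : ℕ} (g : Fin n → Fin d)
    {r r' : Fin n → ℕ}
    (h : ∏ i, (MvPolynomial.X (r i, g i) : MvPolynomial (ℕ × Fin d) F) =
      ∏ i, MvPolynomial.X (r' i, g i)) :
    ∃ σ ∈ wordStabilizer g, r' ∘ σ = r := by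
  classical
  have hexp : ∀ r : Fin n → ℕ, ∏ i, (MvPolynomial.X (r i, g i) : MvPolynomial (ℕ × Fin d) F) =
      MvPolynomial.monomial (∑ i, Finsupp.single (r i, g i) 1) 1 := by
    intro r
    rw [MvPolynomial.monomial_sum_one]
    rfl
  rw [hexp, hexp] at h
  have h1 := MvPolynomial.monomial_left_injective (one_ne_zero (α := F)) h
  obtain ⟨σ, hσ⟩ := exists_equiv_of_card_fiber_eq (f := fun i => (r i, g i))
    (f' := fun i => (r' i, g i)) (by
      intro k
      have h2 := DFunLike.congr_fun h1 k
      simp only [Finsupp.finsetSum_apply, Finsupp.single_apply] at h2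
      rw [Finset.card_filter, Finset.card_filter]
      exact h2)
  exact ⟨σ, mem_wordStabilizer.2 fun i => congrArg Prod.snd (hσ i),
    funext fun i => congrArg Prod.fst (hσ i)⟩

open Classical in
theorem sum_tabloidRep_eq_zero (F : Type*) [Field F] {n d : ℕ} (g : Fin n → Fin d)
    (v : (Fin n → ℕ) →₀ F) (hv : tabloidMap F g v = 0) :
    ∑ σ : wordStabilizer g, tabloidRep F n σ v = 0 := by
  let m : (Fin n → ℕ) → (ℕ × Fin d →₀ ℕ) := fun r => ∑ i, Finsupp.single (r i, g i) 1
  have hm : ∀ r, ∏ i, (MvPolynomial.X (r i, g i) : MvPolynomial (ℕ × Fin d) F) =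
      MvPolynomial.monomial (m r) 1 := by
    intro r
    rw [MvPolynomial.monomial_sum_one]
    rfl
  let A : ((Fin n → ℕ) →₀ F) →ₗ[F] ((Fin n → ℕ) →₀ F) :=
    ∑ σ : wordStabilizer g, tabloidRep F n σ
  -- The stabilizer sum factors through `tabloidMap`: on basis vectors it depends only on the
  -- monomial.
  let s : MvPolynomial (ℕ × Fin d) F →ₗ[F] ((Fin n → ℕ) →₀ F) :=
    (MvPolynomial.basisMonomials _ F).constr F fun e =>
      if h : ∃ r, m r = e then A (Finsupp.single h.choose 1) else 0
  have hs : s ∘ₗ tabloidMap F g = A := by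
    refine Finsupp.lhom_ext' fun r => LinearMap.ext_ring ?_
    simp only [LinearMap.comp_apply, Finsupp.lsingle_apply]
    have hex : ∃ r', m r' = m r := ⟨r, rfl⟩
    have h1 : s (MvPolynomial.monomial (m r) 1) = A (Finsupp.single hex.choose 1) := by
      have := (MvPolynomial.basisMonomials _ F).constr_basis F (fun e =>
        if h : ∃ r, m r = e then A (Finsupp.single h.choose 1) else 0) (m r)
      rw [MvPolynomial.coe_basisMonomials, dif_pos hex] at this
      exact this
    rw [tabloidMap_single, hm, h1]
    obtain ⟨τ, hτ, hr⟩ := exists_comp_eq_of_prod_X_eq F g (r := hex.choose) (r' := r) (by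
      rw [hm, hm, hex.choose_spec])
    rw [← hr]
    simp only [A, LinearMap.sum_apply, tabloidRep_single]
    refine Fintype.sum_equiv (Equiv.mulRight (⟨τ, hτ⟩⁻¹ : wordStabilizer g)) _ _ fun σ => ?_
    simp [Function.comp_assoc]
  have h2 := LinearMap.congr_fun hs v
  rw [LinearMap.comp_apply, hv, map_zero] at h2
  simpa [A, LinearMap.sum_apply] using h2.symm

open Classical in
theorem tabloidMap_polytabloid (F : Type*) [Field F] {n d : ℕ} {μ : YoungDiagram}
    (g : Fin n → Fin d) (T : Fin n ≃ μ.cells) :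
    tabloidMap F g (polytabloid F T) = bidet F (g ∘ T.symm) := by
  rw [polytabloid, bidet, map_sum]
  refine Finset.sum_equiv T.permCongr ?_ ?_
  · intro q
    simp only [Finset.mem_filter, Finset.mem_univ, true_and, Equiv.permCongr_apply]
    constructor
    · intro h c
      rw [h, Equiv.apply_symm_apply]
    · intro h i
      simpa using h (T i)
  · intro q _
    rw [map_smul, tabloidRep_single, tabloidMap_single, Equiv.Perm.sign_permCongr]
    congr 1
    refine (Fintype.prod_equiv (T.symm.trans q) _ _ fun c => ?_).symm
    simp

instance finiteDimensional_specht (F : Type*) [Field F] (n : ℕ) (μ : YoungDiagram) :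
    FiniteDimensional F (specht F n μ) := by
  have : Finite (Fin n ≃ μ.cells) := inferInstance
  exact FiniteDimensional.span_of_finite F (Set.finite_range _)

theorem sum_trace_subrepresentation {F G V W : Type*} [Field F] [CharZero F] [Group G]
    [AddCommGroup V] [Module F V] [AddCommGroup W] [Module F W] (ρ : Representation F G V)
    (S : Submodule F V) (hS : ∀ g, S ≤ S.comap (ρ g)) [FiniteDimensional F S] (H : Subgroup G)
    [Fintype H] (π : V →ₗ[F] W) (h1 : ∀ g ∈ H, ∀ v, π (ρ g v) = π v)
    (h2 : ∀ v, π v = 0 → ∑ g : H, ρ g v = 0) :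
    ∑ g : H, LinearMap.trace F S (ρ.subrepresentation S hS g) =
      (Fintype.card H : F) * Module.finrank F (S.map π) := by
  have h := sum_trace_eq_card_mul_finrank ((ρ.subrepresentation S hS).comp H.subtype)
    (π.comp S.subtype) (fun g v => h1 g.1 g.2 v.1) (fun v hv => by
      refine Subtype.ext ?_
      rw [Submodule.coe_sum]
      exact h2 v.1 hv)
  rw [LinearMap.range_comp, Submodule.range_subtype] at h
  exact h

/-- The images of the Specht module under the maps attached to words are spanned by
bideterminants. -/
theorem map_tabloidMap_specht (F : Type*) [Field F] {n d : ℕ} (μ : YoungDiagram)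
    (g : Fin n → Fin d) :
    (specht F n μ).map (tabloidMap F g) =
      Submodule.span F (bidet F '' {t : μ.cells → Fin d | ∀ k,
        (Finset.univ.filter fun c => t c = k).card =
          (Finset.univ.filter fun i => g i = k).card}) := by
  rw [specht, Submodule.map_span]
  congr 1
  ext p
  constructor
  · rintro ⟨_, ⟨T, rfl⟩, rfl⟩
    refine ⟨g ∘ T.symm, fun k => ?_, (tabloidMap_polytabloid F g T).symm⟩
    exact Finset.card_equiv T.symm (by simp)
  · rintro ⟨t, ht, rfl⟩
    obtain ⟨T, hT⟩ := exists_equiv_of_card_fiber_eq (f := g) (f' := t) fun k => (ht k).symm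
    refine ⟨_, ⟨T, rfl⟩, ?_⟩
    rw [tabloidMap_polytabloid]
    congr 1
    funext c
    rw [Function.comp_apply, ← hT, Equiv.apply_symm_apply]

open Classical in
/-- Young's rule: the average of `χ_μ` over the stabilizer of a word is a Kostka number. -/
theorem sum_irreducibleCharacter (F : Type*) [Field F] [CharZero F] {n d : ℕ} (μ : YoungDiagram)
    (g : Fin n → Fin d) :
    ∑ σ : wordStabilizer g, irreducibleCharacter F n μ σ =
      (Fintype.card (wordStabilizer g) : F) *
        kostka d μ fun k => (Finset.univ.filter fun i => g i = k).card := by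
  rw [← finrank_span_bidet F, ← map_tabloidMap_specht]
  exact sum_trace_subrepresentation (tabloidRep F n) (specht F n μ) (specht_stable F n μ)
    (wordStabilizer g) (tabloidMap F g) (fun σ hσ v => tabloidMap_tabloidRep F g σ hσ v)
    (sum_tabloidRep_eq_zero F g)

theorem trace_eq_of_isConj {F G V : Type*} [Field F] [Group G] [AddCommMonoid V] [Module F V]
    (ρ : Representation F G V) {σ τ : G} (h : IsConj σ τ) :
    LinearMap.trace F V (ρ σ) = LinearMap.trace F V (ρ τ) := by
  obtain ⟨c, rfl⟩ := isConj_iff.1 h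
  rw [map_mul, LinearMap.trace_mul_comm, ← map_mul, inv_mul_cancel_left]

/-! ### Cocharacters and Hilbert series -/

theorem mem_identities {F A X : Type*} [Field F] [Ring A] [Algebra F A] {f : FreeAlgebra F X} :
    f ∈ identities F A X ↔ ∀ φ : FreeAlgebra F X →ₐ[F] A, φ f = 0 := by
  simp [identities, Submodule.mem_iInf]

/-- Polynomial identities are preserved by substitutions. -/
theorem map_mem_identities {F A X Y : Type*} [Field F] [Ring A] [Algebra F A]
    (φ : FreeAlgebra F X →ₐ[F] FreeAlgebra F Y) {f : FreeAlgebra F X}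
    (hf : f ∈ identities F A X) : φ f ∈ identities F A Y :=
  mem_identities.2 fun ψ => mem_identities.1 hf (ψ.comp φ)

/-- The substitution `x_i ↦ x_{g i}`. -/
def renameVariables (F : Type*) [Field F] {X Y : Type*} (g : X → Y) :
    FreeAlgebra F X →ₐ[F] FreeAlgebra F Y :=
  FreeAlgebra.lift F fun x => FreeAlgebra.ι F (g x)

theorem renameVariables_monomial (F : Type*) [Field F] {X Y : Type*} (g : X → Y) (w : List X) :
    renameVariables F g (monomial F w) = monomial F (w.map g) := by
  rw [renameVariables, monomial, monomial, map_list_prod, List.map_map, List.map_map]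
  congr 2
  funext x
  simp

theorem renameVariables_permuteVariables (F : Type*) [Field F] {X Y : Type*} {g : X → Y}
    {σ : Equiv.Perm X} (hσ : σ ∈ wordStabilizer g) (f : FreeAlgebra F X) :
    renameVariables F g (permuteVariables F X σ f) = renameVariables F g f := by
  have h : (renameVariables F g).comp (FreeAlgebra.lift F fun x => FreeAlgebra.ι F (σ x)) =
      renameVariables F g := by
    ext x
    simp [renameVariables, mem_wordStabilizer.1 hσ x]
  exact DFunLike.congr_fun h f

theorem lift_monomial_ofFn {F A X : Type*} [Field F] [Ring A] [Algebra F A] (y : X → A) {n : ℕ}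
    (w : Fin n → X) :
    FreeAlgebra.lift F y (monomial F (List.ofFn w)) =
      MultilinearMap.mkPiAlgebraFin F n A fun j => y (w j) := by
  rw [MultilinearMap.mkPiAlgebraFin_apply, monomial, map_list_prod, List.map_map, List.map_ofFn]
  congr 2
  funext j
  simp

open Classical in
/-- Full linearization of polynomials in which the variable `x_k` has degree `|g⁻¹(k)|`, by
inclusion and exclusion. -/
def linearization (F : Type*) [Field F] {n d : ℕ} (g : Fin n → Fin d) :
    FreeAlgebra F (Fin d) →ₗ[F] FreeAlgebra F (Fin n) :=
  ∑ T : Finset (Fin n), ((-1) ^ T.card : F) • (FreeAlgebra.lift F fun k =>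
    ∑ i with i ∉ T ∧ g i = k, FreeAlgebra.ι F i).toLinearMap

open Classical in
theorem linearization_monomial (F : Type*) [Field F] {n d : ℕ} (g : Fin n → Fin d)
    (σ : Equiv.Perm (Fin n)) :
    linearization F g (renameVariables F g (monomial F (List.ofFn σ))) =
      ∑ τ : wordStabilizer g, permuteVariables F (Fin n) τ (monomial F (List.ofFn σ)) := by
  let y : (Fin n → Fin n) → FreeAlgebra F (Fin n) := fun r => monomial F (List.ofFn r)
  have hT : ∀ T : Finset (Fin n), (FreeAlgebra.lift F fun k =>
      ∑ i with i ∉ T ∧ g i = k, FreeAlgebra.ι F i)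
        (renameVariables F g (monomial F (List.ofFn σ))) =
      ∑ r : Fin n → Fin n, if (∀ j, g (r j) = g (σ j)) ∧ (∀ j, r j ∉ T) then y r else 0 := by
    intro T
    rw [renameVariables_monomial, List.map_ofFn, lift_monomial_ofFn,
      MultilinearMap.map_sum_finset, ← Finset.sum_filter]
    refine Finset.sum_congr ?_ fun r _ => ?_
    · ext r
      simp only [Fintype.mem_piFinset, Finset.mem_filter, Finset.mem_univ, true_and,
        Function.comp_apply]
      exact ⟨fun h => ⟨fun j => (h j).2, fun j => (h j).1⟩, fun h j => ⟨h.2 j, h.1 j⟩⟩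
    · rw [MultilinearMap.mkPiAlgebraFin_apply]
      simp only [y, monomial, List.map_ofFn]
      rfl
  simp only [linearization, LinearMap.sum_apply, LinearMap.smul_apply, AlgHom.toLinearMap_apply, hT,
    Finset.smul_sum]
  rw [Finset.sum_comm]
  -- The alternating sum over `T` leaves only the surjective `r`, that is the permutations.
  have hr : ∀ r : Fin n → Fin n, ∑ T : Finset (Fin n), ((-1) ^ T.card : F) •
      (if (∀ j, g (r j) = g (σ j)) ∧ (∀ j, r j ∉ T) then y r else 0) =
      if (∀ j, g (r j) = g (σ j)) ∧ Function.Surjective r then y r else 0 := by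
    intro r
    by_cases h1 : ∀ j, g (r j) = g (σ j)
    · have h2 : ∀ T : Finset (Fin n), (∀ j, r j ∉ T) ↔ T ∈ (Finset.univ.image r)ᶜ.powerset := by
        intro T
        rw [Finset.mem_powerset]
        constructor
        · intro h x hx
          rw [Finset.mem_compl, Finset.mem_image]
          rintro ⟨j, -, rfl⟩
          exact h j hx
        · intro h j hj
          exact Finset.mem_compl.1 (h hj) (Finset.mem_image_of_mem _ (Finset.mem_univ j))
      simp only [h1, implies_true, true_and, h2, smul_ite, smul_zero]
      rw [← Finset.sum_filter, Finset.filter_univ_mem, ← Finset.sum_smul]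
      have h3 := Finset.sum_powerset_neg_one_pow_card (x := (Finset.univ.image r)ᶜ)
      have h4 : ∑ T ∈ (Finset.univ.image r)ᶜ.powerset, ((-1) ^ T.card : F) =
          if Function.Surjective r then 1 else 0 := by
        have h5 := congrArg (Int.cast : ℤ → F) h3
        push_cast at h5
        rw [h5]
        refine if_congr ?_ rfl rfl
        rw [Finset.compl_eq_empty_iff, Finset.eq_univ_iff_forall]
        simp [Function.Surjective]
      rw [h4, ite_smul, one_smul, zero_smul]
    · simp [h1]
  rw [Finset.sum_congr rfl fun r _ => hr r, ← Finset.sum_filter]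
  symm
  refine Finset.sum_bij (fun τ _ => τ.1 ∘ σ) ?_ ?_ ?_ ?_
  · intro τ _
    simp only [Finset.mem_filter, Finset.mem_univ, true_and]
    exact ⟨fun j => mem_wordStabilizer.1 τ.2 _, τ.1.surjective.comp σ.surjective⟩
  · intro τ _ τ' _ h
    refine Subtype.ext (Equiv.ext fun i => ?_)
    simpa using congrFun h (σ.symm i)
  · intro r hr
    simp only [Finset.mem_filter, Finset.mem_univ, true_and] at hr
    have hbij : Function.Bijective r := ⟨Finite.injective_iff_surjective.2 hr.2, hr.2⟩
    have he : ∀ i, Equiv.ofBijective r hbij i = r i := fun _ => rfl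
    refine ⟨⟨σ.symm.trans (Equiv.ofBijective r hbij), mem_wordStabilizer.2 fun i => ?_⟩,
      Finset.mem_univ _, ?_⟩
    · rw [Equiv.trans_apply, he, hr.1, Equiv.apply_symm_apply]
    · funext j
      rw [Function.comp_apply, Equiv.trans_apply, he, Equiv.symm_apply_apply]
  · intro τ _
    rw [permuteVariables_monomial, List.map_ofFn]

theorem linearization_mem_identities {F A : Type*} [Field F] [Ring A] [Algebra F A] {n d : ℕ}
    (g : Fin n → Fin d) {f : FreeAlgebra F (Fin d)} (hf : f ∈ identities F A (Fin d)) :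
    linearization F g f ∈ identities F A (Fin n) := by
  rw [linearization, LinearMap.sum_apply]
  exact Submodule.sum_mem _ fun T _ => Submodule.smul_mem _ _ (map_mem_identities _ hf)

open Classical in
theorem linearization_renameVariables (F : Type*) [Field F] {n d : ℕ} (g : Fin n → Fin d)
    {f : FreeAlgebra F (Fin n)} (hf : f ∈ multilinear F n) :
    linearization F g (renameVariables F g f) =
      ∑ τ : wordStabilizer g, permuteVariables F (Fin n) τ f := by
  let A : FreeAlgebra F (Fin n) →ₗ[F] FreeAlgebra F (Fin n) :=
    ∑ τ : wordStabilizer g, permuteVariables F (Fin n) τ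
  have hA : ∀ f, A f = ∑ τ : wordStabilizer g, permuteVariables F (Fin n) τ f := fun f => by
    rw [LinearMap.sum_apply]
  rw [← hA]
  refine LinearMap.eqOn_span' (f := (linearization F g).comp (renameVariables F g).toLinearMap)
    (g := A) ?_ hf
  rintro _ ⟨σ, rfl⟩
  rw [hA]
  exact linearization_monomial F g σ

/-- The map from `Vₙ(A)` to the relatively free algebra induced by `x_i ↦ x_{g i}`. -/
def cocharacterMap (F A : Type*) [Field F] [Ring A] [Algebra F A] {n d : ℕ} (g : Fin n → Fin d) :
    (multilinear F n ⧸ multilinearIdentities F A n) →ₗ[F]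
      (FreeAlgebra F (Fin d) ⧸ identities F A (Fin d)) :=
  (multilinearIdentities F A n).mapQ (identities F A (Fin d))
    ((renameVariables F g).toLinearMap.comp (multilinear F n).subtype)
    fun _ hf => map_mem_identities (renameVariables F g) hf

theorem count_ofFn {κ : Type*} [DecidableEq κ] {n : ℕ} (w : Fin n → κ) (k : κ) :
    (List.ofFn w).count k = (Finset.univ.filter fun i => w i = k).card := by
  induction n with
  | zero => simp
  | succ n ih =>
    rw [List.ofFn_succ, List.count_cons, ih, Fin.card_filter_univ_succ', add_comm]
    simp

theorem range_cocharacterMap (F A : Type*) [Field F] [Ring A] [Algebra F A] {n d : ℕ}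
    (g : Fin n → Fin d) (α : Fin d →₀ ℕ)
    (hα : ∀ k, (Finset.univ.filter fun i => g i = k).card = α k) :
    LinearMap.range (cocharacterMap F A g) =
      (multihomogeneous F d α).map (identities F A (Fin d)).mkQ := by
  have hr : LinearMap.range (cocharacterMap F A g) = ((multilinear F n).map
      (renameVariables F g).toLinearMap).map (identities F A (Fin d)).mkQ := by
    ext x
    constructor
    · rintro ⟨v, rfl⟩
      obtain ⟨f, rfl⟩ := Submodule.mkQ_surjective _ v
      exact ⟨_, ⟨f.1, f.2, rfl⟩, rfl⟩
    · rintro ⟨_, ⟨f, hf, rfl⟩, rfl⟩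
      exact ⟨(multilinearIdentities F A n).mkQ ⟨f, hf⟩, rfl⟩
  rw [hr]
  congr 1
  rw [multilinear, multihomogeneous, Submodule.map_span]
  congr 1
  ext f
  constructor
  · rintro ⟨_, ⟨σ, rfl⟩, rfl⟩
    refine ⟨List.ofFn (g ∘ σ), fun k => ?_, ?_⟩
    · rw [count_ofFn, card_filter_comp_equiv, hα]
    · exact (renameVariables_monomial F g _).trans (by rw [List.map_ofFn])
  · rintro ⟨w, hw, rfl⟩
    have hlen : w.length = n := by
      have h1 := Finset.card_eq_sum_card_fiberwise (f := g) (s := Finset.univ) (t := Finset.univ)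
        (by simp)
      have h2 := Finset.card_eq_sum_card_fiberwise (f := w.get) (s := Finset.univ)
        (t := Finset.univ) (by simp)
      rw [Finset.card_univ, Fintype.card_fin] at h1 h2
      rw [h1, h2]
      refine Finset.sum_congr rfl fun k _ => ?_
      rw [hα, ← hw, ← count_ofFn, List.ofFn_get]
    subst hlen
    obtain ⟨σ, hσ⟩ := exists_equiv_of_card_fiber_eq (f := w.get) (f' := g) fun k => by
      rw [hα, ← hw, ← count_ofFn, List.ofFn_get]
    refine ⟨_, ⟨σ, rfl⟩, ?_⟩
    refine (renameVariables_monomial F g _).trans ?_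
    rw [List.map_ofFn]
    congr 1
    conv_rhs => rw [← List.ofFn_get w]
    congr 1
    funext i
    exact hσ i

instance finiteDimensional_multilinear (F : Type*) [Field F] (n : ℕ) :
    FiniteDimensional F (multilinear F n) :=
  FiniteDimensional.span_of_finite F (Set.finite_range _)

open Classical in
/-- The average of the cocharacter over the stabilizer of a word is a coefficient of the Hilbert
series. -/
theorem sum_cocharacter (F A : Type*) [Field F] [CharZero F] [Ring A] [Algebra F A] {n d : ℕ}
    (g : Fin n → Fin d) (α : Fin d →₀ ℕ)
    (hα : ∀ k, (Finset.univ.filter fun i => g i = k).card = α k) :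
    ∑ σ : wordStabilizer g, cocharacter F A n σ =
      (Fintype.card (wordStabilizer g) : F) *
        Module.finrank F ((multihomogeneous F d α).map (identities F A (Fin d)).mkQ) := by
  rw [← range_cocharacterMap F A g α hα]
  refine sum_trace_eq_card_mul_finrank ((cocharacterRep F A n).comp (wordStabilizer g).subtype)
    (cocharacterMap F A g) ?_ ?_
  · intro σ v
    obtain ⟨f, rfl⟩ := Submodule.mkQ_surjective _ v
    exact congrArg (identities F A (Fin d)).mkQ (renameVariables_permuteVariables F σ.2 f.1)
  · intro v hv
    obtain ⟨f, rfl⟩ := Submodule.mkQ_surjective _ v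
    have h1 : renameVariables F g f.1 ∈ identities F A (Fin d) := by
      rw [← Submodule.Quotient.mk_eq_zero]
      exact hv
    have h2 := linearization_mem_identities g h1
    rw [linearization_renameVariables F g f.2] at h2
    have h3 : ∀ σ : wordStabilizer g, ((cocharacterRep F A n).comp (wordStabilizer g).subtype) σ
        ((multilinearIdentities F A n).mkQ f) =
          (multilinearIdentities F A n).mkQ (multilinearRep F n σ f) := fun σ => rfl
    rw [Finset.sum_congr rfl fun σ _ => h3 σ, ← map_sum, Submodule.mkQ_apply,
      Submodule.Quotient.mk_eq_zero]
    change ((∑ σ : wordStabilizer g, multilinearRep F n σ f : multilinear F n) :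
      FreeAlgebra F (Fin n)) ∈ identities F A (Fin n)
    rw [Submodule.coe_sum]
    exact h2

/-- The Hilbert series determines the cocharacters: equal multiplicities in the Schur functions
and in the irreducible characters. -/
theorem cocharacter_eq_sum (F A : Type*) [Field F] [CharZero F] [Ring A] [Algebra F A]
    (m : YoungDiagram → ℕ) (n : ℕ)
    (hm : ∀ α : Fin n →₀ ℕ, ∑ k, α k = n →
      Module.finrank F ((multihomogeneous F n α).map (identities F A (Fin n)).mkQ) =
        ∑ μ ∈ partitions n, m μ * kostka n μ α) (σ : Equiv.Perm (Fin n)) :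
    cocharacter F A n σ = ∑ μ ∈ partitions n, (m μ : F) * irreducibleCharacter F n μ σ := by
  classical
  rw [← sub_eq_zero]
  refine classFunction_eq_zero (fun σ => cocharacter F A n σ -
    ∑ μ ∈ partitions n, (m μ : F) * irreducibleCharacter F n μ σ) ?_ ?_ σ
  · intro σ τ h
    have h1 : cocharacter F A n σ = cocharacter F A n τ := trace_eq_of_isConj _ h
    have h2 : ∀ μ, irreducibleCharacter F n μ σ = irreducibleCharacter F n μ τ := fun μ =>
      trace_eq_of_isConj _ h
    simp only [h1, h2]
  · intro g
    let α : Fin n →₀ ℕ := Finsupp.equivFunOnFinite.symm fun k =>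
      (Finset.univ.filter fun i => g i = k).card
    have hα : ∀ k, (Finset.univ.filter fun i => g i = k).card = α k := fun k => rfl
    have hn : ∑ k, α k = n := by
      have h1 := Finset.card_eq_sum_card_fiberwise (f := g) (s := Finset.univ) (t := Finset.univ)
        (by simp)
      rw [Finset.card_univ, Fintype.card_fin] at h1
      exact h1.symm
    have hsub : ∀ f : Equiv.Perm (Fin n) → F, ∑ τ with ∀ i, g (τ i) = g i, f τ =
        ∑ τ : wordStabilizer g, f τ := by
      intro f
      rw [← Finset.sum_subtype_eq_sum_filter]
      refine Finset.sum_bij' (fun τ _ => ⟨τ.1, mem_wordStabilizer.2 τ.2⟩)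
        (fun τ _ => ⟨τ.1, mem_wordStabilizer.1 τ.2⟩) ?_ ?_ ?_ ?_ ?_ <;> simp
    rw [hsub, Finset.sum_sub_distrib, sum_cocharacter F A g α hα, hm α hn, Finset.sum_comm]
    simp only [← Finset.mul_sum, sum_irreducibleCharacter]
    push_cast
    rw [Finset.mul_sum, sub_eq_zero]
    refine Finset.sum_congr rfl fun μ _ => ?_
    have h3 : kostka n μ (fun k => (Finset.univ.filter fun i => g i = k).card) = kostka n μ α := rfl
    rw [h3]
    ring

/-! ### The Grassmann algebra -/

/-- The basis monomial `e_S` of the Grassmann algebra. -/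
def gmon (F : Type*) [Field F] : Module.Basis (Finset ℕ) F (Grassmann F) :=
  (Finsupp.basisSingleOne (R := F) (ι := ℕ)).ExteriorAlgebra

/-- The generator `e_i` of the Grassmann algebra. -/
def ggen (F : Type*) [Field F] (i : ℕ) : Grassmann F := ExteriorAlgebra.ι F (Finsupp.single i 1)

theorem gmon_empty (F : Type*) [Field F] : gmon F ∅ = 1 := by
  rw [gmon, ExteriorAlgebra.basis_apply_ofCard _ (s := ∅) (n := 0) rfl,
    ExteriorAlgebra.ιMulti_family, ExteriorAlgebra.ιMulti_zero_apply]

theorem gmon_singleton (F : Type*) [Field F] (i : ℕ) : gmon F {i} = ggen F i := by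
  rw [gmon, ExteriorAlgebra.basis_apply_ofCard _ (s := {i}) (n := 1) rfl,
    ExteriorAlgebra.ιMulti_family, ExteriorAlgebra.ιMulti_apply]
  have h := (Set.powersetCard.mem_range_ofFinEmbEquiv_symm_iff_mem
    (Set.powersetCard.ofCard (Finset.card_singleton i)) _).1 ⟨(0 : Fin 1), rfl⟩
  have h' : Set.powersetCard.ofFinEmbEquiv.symm
      (Set.powersetCard.ofCard (Finset.card_singleton i)) (0 : Fin 1) = i :=
    Finset.mem_singleton.1 h
  simp only [ggen, List.ofFn_succ, List.ofFn_zero, List.prod_singleton, Function.comp_apply,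
    Finsupp.coe_basisSingleOne]
  rw [h']

theorem gmon_mul_of_not_disjoint (F : Type*) [Field F] {S T : Finset ℕ} (h : ¬ Disjoint S T) :
    gmon F S * gmon F T = 0 :=
  ExteriorAlgebra.basis_mul_of_not_disjoint _ (⟨S, rfl⟩ : Set.powersetCard ℕ S.card)
    (⟨T, rfl⟩ : Set.powersetCard ℕ T.card) h

theorem gmon_mul_of_disjoint (F : Type*) [Field F] {S T : Finset ℕ} (h : Disjoint S T) :
    ∃ ε : F, ε * ε = 1 ∧ gmon F S * gmon F T = ε • gmon F (S ∪ T) := by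
  have h1 := ExteriorAlgebra.basis_mul_of_disjoint (Finsupp.basisSingleOne (R := F) (ι := ℕ))
    (⟨S, rfl⟩ : Set.powersetCard ℕ S.card) (⟨T, rfl⟩ : Set.powersetCard ℕ T.card) h
  have hd : Disjoint (⟨S, rfl⟩ : Set.powersetCard ℕ S.card).val
    (⟨T, rfl⟩ : Set.powersetCard ℕ T.card).val := h
  refine ⟨((Equiv.Perm.sign (Set.powersetCard.permOfDisjoint hd) : ℤ) : F),
    sign_mul_self F _, ?_⟩
  have hu : ((Set.powersetCard.disjUnion hd : Set.powersetCard ℕ _) : Finset ℕ) = S ∪ T :=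
    Finset.disjUnion_eq_union S T hd
  rw [hu] at h1
  refine h1.trans ?_
  rcases Int.units_eq_one_or (Equiv.Perm.sign (Set.powersetCard.permOfDisjoint hd)) with hs | hs <;>
    rw [hs] <;> simp [gmon]

/-- The odd part of the Grassmann algebra, described as the span of the products of a central
element and a vector. -/
def oddPart (F : Type*) [Field F] : Submodule F (Grassmann F) :=
  Submodule.span F {x | ∃ z ∈ Subalgebra.center F (Grassmann F), ∃ m, x = z * ExteriorAlgebra.ι F m}

theorem ι_mul_swap {F : Type*} [Field F] (m m' : ℕ →₀ F) :
    ExteriorAlgebra.ι F m * ExteriorAlgebra.ι F m' =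
      -(ExteriorAlgebra.ι F m' * ExteriorAlgebra.ι F m) :=
  eq_neg_of_add_eq_zero_left (ExteriorAlgebra.ι_add_mul_swap m m')

theorem ι_mem_oddPart {F : Type*} [Field F] (m : ℕ →₀ F) :
    ExteriorAlgebra.ι F m ∈ oddPart F :=
  Submodule.subset_span ⟨1, Subalgebra.one_mem _, m, (one_mul _).symm⟩

theorem oddPart_mul_swap {F : Type*} [Field F] {b b' : Grassmann F} (hb : b ∈ oddPart F)
    (hb' : b' ∈ oddPart F) : b * b' = -(b' * b) := by
  induction hb, hb' using Submodule.span_induction₂ with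
  | mem_mem x y hx hy =>
    obtain ⟨z, hz, m, rfl⟩ := hx
    obtain ⟨z', hz', m', rfl⟩ := hy
    rw [Subalgebra.mem_center_iff] at hz hz'
    calc z * ExteriorAlgebra.ι F m * (z' * ExteriorAlgebra.ι F m')
        = z * (ExteriorAlgebra.ι F m * z') * ExteriorAlgebra.ι F m' := by simp only [mul_assoc]
      _ = z * z' * (ExteriorAlgebra.ι F m * ExteriorAlgebra.ι F m') := by
          rw [hz']; simp only [mul_assoc]
      _ = -(z' * z * (ExteriorAlgebra.ι F m' * ExteriorAlgebra.ι F m)) := by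
          rw [ι_mul_swap m m', hz' z, mul_neg]
      _ = -(z' * (z * ExteriorAlgebra.ι F m') * ExteriorAlgebra.ι F m) := by simp only [mul_assoc]
      _ = -(z' * ExteriorAlgebra.ι F m' * (z * ExteriorAlgebra.ι F m)) := by
          rw [← hz (ExteriorAlgebra.ι F m')]; simp only [mul_assoc]
  | zero_left y hy => simp
  | zero_right x hx => simp
  | add_left x y z _ _ _ h1 h2 => rw [add_mul, mul_add, h1, h2, neg_add]
  | add_right x y z _ _ _ h1 h2 => rw [add_mul, mul_add, h1, h2, neg_add]
  | smul_left r x y _ _ h => rw [smul_mul_assoc, mul_smul_comm, h, smul_neg]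
  | smul_right r x y _ _ h => rw [smul_mul_assoc, mul_smul_comm, h, smul_neg]

theorem oddPart_mul_self {F : Type*} [Field F] [CharZero F] {b : Grassmann F}
    (hb : b ∈ oddPart F) : b * b = 0 := by
  have h := oddPart_mul_swap hb hb
  have h2 : (2 : F) • (b * b) = 0 := by
    rw [two_smul]
    nth_rewrite 2 [h]
    exact add_neg_cancel _
  exact (smul_eq_zero.1 h2).resolve_left two_ne_zero

theorem mul_mem_oddPart {F : Type*} [Field F] {z b : Grassmann F}
    (hz : z ∈ Subalgebra.center F (Grassmann F)) (hb : b ∈ oddPart F) : z * b ∈ oddPart F := by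
  induction hb using Submodule.span_induction with
  | mem x hx =>
    obtain ⟨z', hz', m, rfl⟩ := hx
    exact Submodule.subset_span ⟨z * z', Subalgebra.mul_mem _ hz hz', m, (mul_assoc _ _ _).symm⟩
  | zero => rw [mul_zero]; exact zero_mem _
  | add x y _ _ hx hy => rw [mul_add]; exact add_mem hx hy
  | smul r x _ hx => rw [mul_smul_comm]; exact Submodule.smul_mem _ _ hx

theorem ι_mul_ι_mem_center {F : Type*} [Field F] (m m' : ℕ →₀ F) :
    ExteriorAlgebra.ι F m * ExteriorAlgebra.ι F m' ∈ Subalgebra.center F (Grassmann F) := by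
  rw [Subalgebra.mem_center_iff]
  intro x
  induction x using ExteriorAlgebra.induction with
  | algebraMap r => exact Algebra.commutes r _
  | ι v =>
    calc ExteriorAlgebra.ι F v * (ExteriorAlgebra.ι F m * ExteriorAlgebra.ι F m')
        = -(ExteriorAlgebra.ι F m * (ExteriorAlgebra.ι F v * ExteriorAlgebra.ι F m')) := by
          rw [← mul_assoc, ι_mul_swap v m, neg_mul, mul_assoc]
      _ = ExteriorAlgebra.ι F m * ExteriorAlgebra.ι F m' * ExteriorAlgebra.ι F v := by
          rw [ι_mul_swap v m', mul_neg, neg_neg, mul_assoc]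
  | mul x y hx hy => rw [mul_assoc, hy, ← mul_assoc, hx, mul_assoc]
  | add x y hx hy => rw [add_mul, mul_add, hx, hy]

theorem mul_mem_center_of_mem_oddPart {F : Type*} [Field F] {b b' : Grassmann F}
    (hb : b ∈ oddPart F) (hb' : b' ∈ oddPart F) :
    b * b' ∈ Subalgebra.center F (Grassmann F) := by
  induction hb, hb' using Submodule.span_induction₂ with
  | mem_mem x y hx hy =>
    obtain ⟨z, hz, m, rfl⟩ := hx
    obtain ⟨z', hz', m', rfl⟩ := hy
    have h : z * ExteriorAlgebra.ι F m * (z' * ExteriorAlgebra.ι F m') =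
        z * z' * (ExteriorAlgebra.ι F m * ExteriorAlgebra.ι F m') := by
      rw [mul_assoc, ← mul_assoc (ExteriorAlgebra.ι F m), Subalgebra.mem_center_iff.1 hz']
      simp only [mul_assoc]
    rw [h]
    exact Subalgebra.mul_mem _ (Subalgebra.mul_mem _ hz hz') (ι_mul_ι_mem_center m m')
  | zero_left y hy => rw [zero_mul]; exact Subalgebra.zero_mem _
  | zero_right x hx => rw [mul_zero]; exact Subalgebra.zero_mem _
  | add_left x y z _ _ _ h1 h2 => rw [add_mul]; exact Subalgebra.add_mem _ h1 h2
  | add_right x y z _ _ _ h1 h2 => rw [mul_add]; exact Subalgebra.add_mem _ h1 h2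
  | smul_left r x y _ _ h => rw [smul_mul_assoc]; exact Subalgebra.smul_mem _ h r
  | smul_right r x y _ _ h => rw [mul_smul_comm]; exact Subalgebra.smul_mem _ h r

/-- Every element of the Grassmann algebra is the sum of a central and an odd element. -/
theorem exists_center_add_oddPart {F : Type*} [Field F] (y : Grassmann F) :
    ∃ a ∈ Subalgebra.center F (Grassmann F), ∃ b ∈ oddPart F, y = a + b := by
  induction y using ExteriorAlgebra.induction with
  | algebraMap r => exact ⟨_, Subalgebra.algebraMap_mem _ r, 0, zero_mem _, (add_zero _).symm⟩
  | ι m => exact ⟨0, Subalgebra.zero_mem _, _, ι_mem_oddPart m, (zero_add _).symm⟩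
  | mul x y hx hy =>
    obtain ⟨a, ha, b, hb, rfl⟩ := hx
    obtain ⟨a', ha', b', hb', rfl⟩ := hy
    refine ⟨a * a' + b * b', Subalgebra.add_mem _ (Subalgebra.mul_mem _ ha ha')
      (mul_mem_center_of_mem_oddPart hb hb'), a * b' + a' * b,
      add_mem (mul_mem_oddPart ha hb') (mul_mem_oddPart ha' hb), ?_⟩
    rw [add_mul, mul_add, mul_add, Subalgebra.mem_center_iff.1 ha' b]
    abel
  | add x y hx hy =>
    obtain ⟨a, ha, b, hb, rfl⟩ := hx
    obtain ⟨a', ha', b', hb', rfl⟩ := hy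
    exact ⟨a + a', Subalgebra.add_mem _ ha ha', b + b', add_mem hb hb', by abel⟩

theorem monomial_nil (F : Type*) [Field F] {X : Type*} : monomial F ([] : List X) = 1 := rfl

theorem monomial_cons (F : Type*) [Field F] {X : Type*} (k : X) (w : List X) :
    monomial F (k :: w) = FreeAlgebra.ι F k * monomial F w := by
  rw [monomial, monomial, List.map_cons, List.prod_cons]

/-- The span of the basis monomials `e_S` with `S` in a given family. -/
def gspan (F : Type*) [Field F] (P : Set (Finset ℕ)) : Submodule F (Grassmann F) :=
  Submodule.span F (gmon F '' P)

theorem gmon_mem_gspan {F : Type*} [Field F] {P : Set (Finset ℕ)} {S : Finset ℕ} (h : S ∈ P) :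
    gmon F S ∈ gspan F P := Submodule.subset_span ⟨S, h, rfl⟩

theorem gspan_mono {F : Type*} [Field F] {P Q : Set (Finset ℕ)} (h : P ⊆ Q) :
    gspan F P ≤ gspan F Q := Submodule.span_mono (Set.image_mono h)

theorem ggen_mul_gmon_of_mem {F : Type*} [Field F] {i : ℕ} {S : Finset ℕ} (h : i ∈ S) :
    ggen F i * gmon F S = 0 := by
  rw [← gmon_singleton]
  exact gmon_mul_of_not_disjoint F (by simpa using h)

theorem ggen_mul_gmon_of_notMem (F : Type*) [Field F] {i : ℕ} {S : Finset ℕ} (h : i ∉ S) :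
    ∃ ε : F, ε * ε = 1 ∧ ggen F i * gmon F S = ε • gmon F (insert i S) := by
  rw [← gmon_singleton, Finset.insert_eq]
  exact gmon_mul_of_disjoint F (by simpa using h)

theorem ggen_mul_mem_gspan {F : Type*} [Field F] {P Q : Set (Finset ℕ)} {i : ℕ}
    (h : ∀ S ∈ P, i ∉ S → insert i S ∈ Q) {x : Grassmann F} (hx : x ∈ gspan F P) :
    ggen F i * x ∈ gspan F Q := by
  induction hx using Submodule.span_induction with
  | mem x hx =>
    obtain ⟨S, hS, rfl⟩ := hx
    by_cases hi : i ∈ S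
    · rw [ggen_mul_gmon_of_mem hi]
      exact zero_mem _
    · obtain ⟨ε, -, hε⟩ := ggen_mul_gmon_of_notMem F hi
      rw [hε]
      exact Submodule.smul_mem _ _ (gmon_mem_gspan (h S hS hi))
  | zero => rw [mul_zero]; exact zero_mem _
  | add x y _ _ hx hy => rw [mul_add]; exact add_mem hx hy
  | smul r x _ hx => rw [mul_smul_comm]; exact Submodule.smul_mem _ _ hx

/-- The generic substitution `x_k ↦ 1 + e_{φ k}` into the Grassmann algebra. -/
def theta (F : Type*) [Field F] {d : ℕ} (φ : Fin d → ℕ) :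
    FreeAlgebra F (Fin d) →ₐ[F] Grassmann F :=
  FreeAlgebra.lift F fun k => 1 + ggen F (φ k)

theorem theta_nil (F : Type*) [Field F] {d : ℕ} (φ : Fin d → ℕ) :
    theta F φ (monomial F []) = 1 := by rw [monomial_nil, map_one]

theorem theta_cons (F : Type*) [Field F] {d : ℕ} (φ : Fin d → ℕ) (k : Fin d) (w : List (Fin d)) :
    theta F φ (monomial F (k :: w)) = (1 + ggen F (φ k)) * theta F φ (monomial F w) := by
  rw [monomial_cons, map_mul, theta, FreeAlgebra.lift_ι_apply]

theorem theta_mem_gspan (F : Type*) [Field F] {d : ℕ} (φ : Fin d → ℕ) (w : List (Fin d)) :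
    theta F φ (monomial F w) ∈ gspan F {S | S ⊆ (w.map φ).toFinset} := by
  induction w with
  | nil =>
    rw [theta_nil, ← gmon_empty]
    exact gmon_mem_gspan (Finset.empty_subset _)
  | cons k w ih =>
    rw [theta_cons, add_mul, one_mul, List.map_cons, List.toFinset_cons]
    refine add_mem (gspan_mono (fun S hS => ?_) ih) (ggen_mul_mem_gspan (fun S hS _ => ?_) ih)
    · exact Finset.Subset.trans hS (Finset.subset_insert _ _)
    · exact Finset.insert_subset_insert _ hS

/-- The linear map that computes all values of a multihomogeneous polynomial of multidegree `α` from
its generic value: if `x_k` is replaced by `a k + b k`, with `a k` central and `b k` odd, then `e_S`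
has to be replaced by `∏ k, a k ^ (α k - [k ∈ S])` times the product of the `b k`, `k ∈ S`. -/
def specialize (F : Type*) [Field F] {d : ℕ} (φ : Fin d → ℕ)
    (a : Fin d → Subalgebra.center F (Grassmann F)) (Θ : Grassmann F →ₐ[F] Grassmann F)
    (α : Fin d → ℕ) : Grassmann F →ₗ[F] Grassmann F :=
  (gmon F).constr F fun S =>
    ((∏ k, a k ^ (α k - if φ k ∈ S then 1 else 0) : Subalgebra.center F (Grassmann F)) :
      Grassmann F) * Θ (gmon F S)

theorem specialize_gmon (F : Type*) [Field F] {d : ℕ} (φ : Fin d → ℕ)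
    (a : Fin d → Subalgebra.center F (Grassmann F)) (Θ : Grassmann F →ₐ[F] Grassmann F)
    (α : Fin d → ℕ) (S : Finset ℕ) : specialize F φ a Θ α (gmon F S) =
    ((∏ k, a k ^ (α k - if φ k ∈ S then 1 else 0) : Subalgebra.center F (Grassmann F)) :
      Grassmann F) * Θ (gmon F S) := (gmon F).constr_basis F _ S

theorem specialize_step {F : Type*} [Field F] {d : ℕ} {φ : Fin d → ℕ}
    (hφ : Function.Injective φ) (a : Fin d → Subalgebra.center F (Grassmann F))
    (Θ : Grassmann F →ₐ[F] Grassmann F) (α : Fin d → ℕ) (k : Fin d) (S : Finset ℕ)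
    (hS : φ k ∈ S → 1 ≤ α k) :
    specialize F φ a Θ (fun j => α j + if j = k then 1 else 0) ((1 + ggen F (φ k)) * gmon F S) =
      ((a k : Grassmann F) + Θ (ggen F (φ k))) * specialize F φ a Θ α (gmon F S) := by
  rw [add_mul, add_mul, one_mul, map_add]
  congr 1
  · rw [specialize_gmon, specialize_gmon, ← mul_assoc, ← Subalgebra.coe_mul]
    congr 2
    have h : ∀ j, a j ^ (α j + (if j = k then 1 else 0) - if φ j ∈ S then 1 else 0) =
        a j ^ (α j - if φ j ∈ S then 1 else 0) * if j = k then a j else 1 := by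
      intro j
      by_cases hj : j = k
      · subst hj
        rw [if_pos rfl, if_pos rfl, ← pow_succ]
        congr 1
        split_ifs with h1
        · have := hS h1
          omega
        · omega
      · rw [if_neg hj, if_neg hj, mul_one, add_zero]
    rw [Finset.prod_congr rfl fun j _ => h j, Finset.prod_mul_distrib, Finset.prod_ite_eq',
      if_pos (Finset.mem_univ k), mul_comm]
  · have hc : ∀ z : Subalgebra.center F (Grassmann F), ∀ x y : Grassmann F,
        x * ((z : Grassmann F) * y) = (z : Grassmann F) * (x * y) := by
      intro z x y
      rw [← mul_assoc, Subalgebra.mem_center_iff.1 z.2 x, mul_assoc]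
    rw [specialize_gmon, hc, ← map_mul]
    by_cases hk : φ k ∈ S
    · rw [ggen_mul_gmon_of_mem hk, map_zero, map_zero, mul_zero]
    · obtain ⟨ε, -, hε⟩ := ggen_mul_gmon_of_notMem F hk
      rw [hε, map_smul, map_smul, specialize_gmon, mul_smul_comm]
      congr 3
      refine Finset.prod_congr rfl fun j _ => ?_
      congr 1
      by_cases hj : j = k
      · subst hj
        rw [if_pos rfl, if_pos (Finset.mem_insert_self _ _), if_neg hk]
        omega
      · have h1 : φ j ∈ insert (φ k) S ↔ φ j ∈ S := by
          rw [Finset.mem_insert, or_iff_right fun h => hj (hφ h)]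
        simp only [h1, if_neg hj, add_zero]

theorem count_cons_eq {d : ℕ} (k : Fin d) (w : List (Fin d)) :
    (fun j => (k :: w).count j) = fun j => w.count j + if j = k then 1 else 0 := by
  funext j
  rw [List.count_cons]
  congr 1
  rcases eq_or_ne j k with rfl | h
  · simp
  · simp [h, h.symm]

/-- A multihomogeneous polynomial that vanishes under the generic substitution is an identity of the
Grassmann algebra. -/
theorem mem_identities_of_theta_eq_zero {F : Type*} [Field F] [CharZero F] {d : ℕ} {φ : Fin d → ℕ}
    (hφ : Function.Injective φ) {α : Fin d →₀ ℕ} {f : FreeAlgebra F (Fin d)}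
    (hf : f ∈ multihomogeneous F d α) (h0 : theta F φ f = 0) :
    f ∈ identities F (Grassmann F) (Fin d) := by
  rw [mem_identities]
  intro ψ
  -- `Θ` sends the generator `e_{φ k}` to the odd part `b k` of the value of `x_k`; it exists since
  -- odd elements have square zero.
  choose a ha b hb hab using fun k => exists_center_add_oddPart (ψ (FreeAlgebra.ι F k))
  let L : (ℕ →₀ F) →ₗ[F] Grassmann F := Finsupp.lift (Grassmann F) F ℕ (Function.extend φ b 0)
  have hLodd : ∀ m, L m ∈ oddPart F := by
    intro m
    have hb' : ∀ i, Function.extend φ b 0 i ∈ oddPart F := by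
      intro i
      by_cases hi : ∃ k, φ k = i
      · obtain ⟨k, rfl⟩ := hi
        rw [hφ.extend_apply]
        exact hb k
      · rw [Function.extend_apply' _ _ _ hi]
        exact zero_mem _
    rw [Finsupp.lift_apply]
    exact Submodule.sum_mem _ fun i _ => Submodule.smul_mem _ _ (hb' i)
  let Θ : Grassmann F →ₐ[F] Grassmann F :=
    ExteriorAlgebra.lift F ⟨L, fun m => oddPart_mul_self (hLodd m)⟩
  have hΘ : ∀ k, Θ (ggen F (φ k)) = b k := by
    intro k
    rw [ggen, ExteriorAlgebra.lift_ι_apply]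
    simp [L, hφ.extend_apply]
  let a' : Fin d → Subalgebra.center F (Grassmann F) := fun k => ⟨a k, ha k⟩
  have hword : ∀ w : List (Fin d), ψ (monomial F w) =
      specialize F φ a' Θ (fun j => w.count j) (theta F φ (monomial F w)) := by
    intro w
    induction w with
    | nil =>
      rw [theta_nil, monomial_nil, map_one, ← gmon_empty, specialize_gmon]
      simp [gmon_empty]
    | cons k w ih =>
      rw [monomial_cons, map_mul, ih, hab k, ← hΘ k, count_cons_eq, ← monomial_cons, theta_cons]
      -- In `e_S` with `φ k ∈ S` the letter `k` has occurred, so that the truncated subtraction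
      -- `α k - 1` in `specialize` is exact.
      have hmem := theta_mem_gspan F φ w
      generalize theta F φ (monomial F w) = z at hmem
      symm
      refine LinearMap.eqOn_span (R := F)
        (f := (specialize F φ a' Θ fun j => w.count j + if j = k then 1 else 0).comp
          (LinearMap.mulLeft F (1 + ggen F (φ k))))
        (g := (LinearMap.mulLeft F (a k + Θ (ggen F (φ k)))).comp
          (specialize F φ a' Θ fun j => w.count j)) ?_ hmem
      rintro _ ⟨S, hS, rfl⟩
      refine specialize_step hφ a' Θ (fun j => w.count j) k S fun hk => ?_
      have h1 := hS hk
      rw [List.mem_toFinset, List.mem_map] at h1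
      obtain ⟨j, hj, hjk⟩ := h1
      rw [hφ hjk] at hj
      exact List.count_pos_iff.2 hj
  have hmain : ψ f = specialize F φ a' Θ α (theta F φ f) := by
    refine LinearMap.eqOn_span (f := ψ.toLinearMap)
      (g := (specialize F φ a' Θ α).comp (theta F φ).toLinearMap) ?_ hf
    rintro _ ⟨w, hw, rfl⟩
    have hα : (α : Fin d → ℕ) = fun j => w.count j := funext fun j => (hw j).symm
    rw [hα]
    exact hword w
  rw [hmain, h0, map_zero]

theorem theta_eq_zero_of_mem_identities {F : Type*} [Field F] {d : ℕ} (φ : Fin d → ℕ)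
    {f : FreeAlgebra F (Fin d)} (hf : f ∈ identities F (Grassmann F) (Fin d)) :
    theta F φ f = 0 := mem_identities.1 hf _

/-! ### The Hilbert series of the Grassmann algebra -/

/-- The vector `∑ k, α k • e_{φ k}`, the sum of the odd parts of the letters of a word of
content `α`. -/
def contentVec (F : Type*) [Field F] {d : ℕ} (φ : Fin d → ℕ) (α : Fin d → ℕ) : Grassmann F :=
  ∑ k, (α k : F) • ggen F (φ k)

theorem contentVec_eq (F : Type*) [Field F] {d : ℕ} (φ : Fin d → ℕ) (α : Fin d → ℕ) :
    contentVec F φ α = ExteriorAlgebra.ι F (∑ k, (α k : F) • Finsupp.single (φ k) 1) := by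
  simp only [contentVec, ggen, map_sum, map_smul]

theorem one_add_mul_one_add {A : Type*} [Ring A] {e h : A} (he : e * e = 0) (hh : h * h = 0)
    (hs : e * h = -(h * e)) : (1 + e) * (1 + h) = (1 + (h + e)) * (1 + e * h) := by
  have h1 : e * (e * h) = 0 := by rw [← mul_assoc, he, zero_mul]
  have h2 : h * (e * h) = 0 := by rw [hs, mul_neg, ← mul_assoc, hh, zero_mul, neg_zero]
  have h3 : (1 + (h + e)) * (1 + e * h) = 1 + h + e + e * h + h * (e * h) + e * (e * h) := by
    noncomm_ring
  rw [h3, h1, h2]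
  noncomm_ring

/-- The generic value of a word is determined by its even part: it is `(1 + η) q` with `q` even,
where `η` depends only on the content of the word. -/
theorem exists_theta_eq (F : Type*) [Field F] {d : ℕ} (φ : Fin d → ℕ) (w : List (Fin d)) :
    ∃ q ∈ gspan F {S | S ⊆ (w.map φ).toFinset ∧ Even S.card},
      theta F φ (monomial F w) = (1 + contentVec F φ fun k => w.count k) * q := by
  induction w with
  | nil =>
    refine ⟨1, ?_, ?_⟩
    · rw [← gmon_empty]
      exact gmon_mem_gspan ⟨Finset.empty_subset _, by simp⟩
    · rw [theta_nil]
      simp [contentVec]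
  | cons k w ih =>
    obtain ⟨q, hq, hw⟩ := ih
    set η := contentVec F φ fun k => w.count k with hη
    have hη' : contentVec F φ (fun j => (k :: w).count j) = η + ggen F (φ k) := by
      rw [hη, count_cons_eq, contentVec, contentVec]
      simp only [Nat.cast_add, add_smul, Finset.sum_add_distrib]
      congr 1
      rw [Finset.sum_eq_single k]
      · simp
      · intro j _ hj
        simp [hj]
      · intro h
        exact absurd (Finset.mem_univ k) h
    refine ⟨(1 + ggen F (φ k) * η) * q, ?_, ?_⟩
    · rw [add_mul, one_mul, List.map_cons, List.toFinset_cons]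
      refine add_mem (gspan_mono (fun S hS => ?_) hq) ?_
      · exact ⟨Finset.Subset.trans hS.1 (Finset.subset_insert _ _), hS.2⟩
      · rw [mul_assoc]
        refine ggen_mul_mem_gspan (P := {S | S ⊆ (w.map φ).toFinset ∧ Odd S.card}) ?_ ?_
        · intro S hS hk
          refine ⟨Finset.insert_subset_insert _ hS.1, ?_⟩
          rw [Finset.card_insert_of_notMem hk]
          exact hS.2.add_one
        · rw [hη, contentVec, Finset.sum_mul]
          refine Submodule.sum_mem _ fun j _ => ?_
          rw [smul_mul_assoc]
          by_cases hj : w.count j = 0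
          · rw [hj, Nat.cast_zero, zero_smul]
            exact zero_mem _
          · refine Submodule.smul_mem _ _ (ggen_mul_mem_gspan (fun S hS hjS => ?_) hq)
            constructor
            · refine Finset.insert_subset ?_ hS.1
              rw [List.mem_toFinset]
              exact List.mem_map_of_mem (List.count_pos_iff.1 (Nat.pos_of_ne_zero hj))
            · rw [Finset.card_insert_of_notMem hjS]
              exact hS.2.add_one
    · rw [theta_cons, hw, hη', ← mul_assoc, ← mul_assoc]
      congr 1
      have h1 : η = ExteriorAlgebra.ι F _ := contentVec_eq F φ _
      refine one_add_mul_one_add (ExteriorAlgebra.ι_sq_zero _) ?_ ?_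
      · rw [h1, ExteriorAlgebra.ι_sq_zero]
      · rw [h1, ggen, ι_mul_swap]

theorem repr_gmon_mul_of_not_subset {F : Type*} [Field F] {S T : Finset ℕ} (h : ¬ S ⊆ T)
    (z : Grassmann F) : (gmon F).repr (gmon F S * z) T = 0 := by
  have h0 : ((Finsupp.lapply T).comp ((gmon F).repr.toLinearMap.comp
      (LinearMap.mulLeft F (gmon F S))) : Grassmann F →ₗ[F] F) = 0 := by
    refine (gmon F).ext fun R => ?_
    simp only [LinearMap.comp_apply, LinearMap.mulLeft_apply, LinearEquiv.coe_coe,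
      Finsupp.lapply_apply, LinearMap.zero_apply]
    by_cases hd : Disjoint S R
    · obtain ⟨ε, -, hε⟩ := gmon_mul_of_disjoint F hd
      rw [hε, map_smul, Module.Basis.repr_self, Finsupp.smul_apply, Finsupp.single_apply, if_neg,
        smul_zero]
      rintro rfl
      exact h Finset.subset_union_left
    · rw [gmon_mul_of_not_disjoint F hd]
      simp
  exact LinearMap.congr_fun h0 z

theorem repr_gmon_mul_self {F : Type*} [Field F] (S : Finset ℕ) (z : Grassmann F) :
    (gmon F).repr (gmon F S * z) S = (gmon F).repr z ∅ := by
  have h0 : ((Finsupp.lapply S).comp ((gmon F).repr.toLinearMap.comp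
      (LinearMap.mulLeft F (gmon F S))) : Grassmann F →ₗ[F] F) =
      (Finsupp.lapply ∅).comp (gmon F).repr.toLinearMap := by
    refine (gmon F).ext fun R => ?_
    simp only [LinearMap.comp_apply, LinearMap.mulLeft_apply, LinearEquiv.coe_coe,
      Finsupp.lapply_apply, Module.Basis.repr_self]
    by_cases hR : R = ∅
    · subst hR
      rw [gmon_empty, mul_one, Module.Basis.repr_self, Finsupp.single_eq_same,
        Finsupp.single_eq_same]
    · rw [Finsupp.single_eq_of_ne' hR]
      by_cases hd : Disjoint S R
      · obtain ⟨ε, -, hε⟩ := gmon_mul_of_disjoint F hd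
        rw [hε, map_smul, Module.Basis.repr_self, Finsupp.smul_apply, Finsupp.single_apply, if_neg,
          smul_zero]
        intro h
        refine hR (Finset.disjoint_self_iff_empty R |>.1 (hd.mono_left ?_))
        rw [← h]
        exact Finset.subset_union_right
      · rw [gmon_mul_of_not_disjoint F hd]
        simp
  exact LinearMap.congr_fun h0 z

theorem repr_theta_empty (F : Type*) [Field F] {d : ℕ} (φ : Fin d → ℕ) (w : List (Fin d)) :
    (gmon F).repr (theta F φ (monomial F w)) ∅ = 1 := by
  induction w with
  | nil => rw [theta_nil, ← gmon_empty, Module.Basis.repr_self, Finsupp.single_eq_same]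
  | cons k w ih =>
    rw [theta_cons, add_mul, one_mul, map_add, Finsupp.add_apply, ih, ← gmon_singleton,
      repr_gmon_mul_of_not_subset (by simp), add_zero]

/-- Products of commutators of distinct variables have nonzero monomials as generic values. -/
theorem exists_theta_eq_smul_gmon (F : Type*) [Field F] [CharZero F] {d : ℕ} {φ : Fin d → ℕ}
    (hφ : Function.Injective φ) : ∀ ts : List (Fin d), ts.Nodup → Even ts.length →
      ∃ p : FreeAlgebra F (Fin d), (∃ c : F, c ≠ 0 ∧
        theta F φ p = c • gmon F (ts.map φ).toFinset) ∧
        ∀ w, p * monomial F w ∈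
          Submodule.span F {f | ∃ w', w'.Perm (ts ++ w) ∧ f = monomial F w'}
  | [], _, _ => by
    refine ⟨1, ⟨1, one_ne_zero, ?_⟩, fun w => ?_⟩
    · rw [map_one, one_smul]
      exact (gmon_empty F).symm
    · rw [one_mul]
      exact Submodule.subset_span ⟨w, List.Perm.refl _, rfl⟩
  | [_], _, h => by simp at h
  | i :: j :: ts, hnd, hlen => by
    obtain ⟨hi, hnd'⟩ := List.nodup_cons.1 hnd
    obtain ⟨hj, hnd''⟩ := List.nodup_cons.1 hnd'
    obtain ⟨p, ⟨c, hc, hp⟩, hpw⟩ := exists_theta_eq_smul_gmon F hφ ts hnd'' (by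
      simp only [List.length_cons] at hlen
      rcases hlen with ⟨r, hr⟩
      exact ⟨r - 1, by omega⟩)
    have hjS : φ j ∉ (ts.map φ).toFinset := by
      rw [List.mem_toFinset, List.mem_map]
      rintro ⟨k, hk, hkj⟩
      exact hj (hφ hkj ▸ hk)
    have hiS : φ i ∉ insert (φ j) (ts.map φ).toFinset := by
      rw [Finset.mem_insert, List.mem_toFinset, List.mem_map]
      rintro (h | ⟨k, hk, hki⟩)
      · exact hi (hφ h ▸ List.mem_cons_self)
      · exact hi (List.mem_cons_of_mem _ (hφ hki ▸ hk))
    obtain ⟨ε, hε, h1⟩ := ggen_mul_gmon_of_notMem F hjS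
    obtain ⟨ε', hε', h2⟩ := ggen_mul_gmon_of_notMem F hiS
    refine ⟨(FreeAlgebra.ι F i * FreeAlgebra.ι F j - FreeAlgebra.ι F j * FreeAlgebra.ι F i) * p,
      ⟨2 * c * ε * ε', ?_, ?_⟩, fun w => ?_⟩
    · have h3 : ε ≠ 0 := fun h => by simp [h] at hε
      have h4 : ε' ≠ 0 := fun h => by simp [h] at hε'
      exact mul_ne_zero (mul_ne_zero (mul_ne_zero two_ne_zero hc) h3) h4
    · have hcomm : theta F φ (FreeAlgebra.ι F i * FreeAlgebra.ι F j -
          FreeAlgebra.ι F j * FreeAlgebra.ι F i) = (2 : F) • (ggen F (φ i) * ggen F (φ j)) := by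
        simp only [map_sub, map_mul, theta, FreeAlgebra.lift_ι_apply]
        have hs : ggen F (φ j) * ggen F (φ i) = -(ggen F (φ i) * ggen F (φ j)) := ι_mul_swap _ _
        simp only [mul_add, add_mul, one_mul, mul_one, hs, two_smul]
        abel
      rw [map_mul, hcomm, hp, smul_mul_assoc, mul_smul_comm, mul_assoc, h1, mul_smul_comm, h2,
        smul_smul, smul_smul, smul_smul, List.map_cons, List.map_cons, List.toFinset_cons,
        List.toFinset_cons]
    · have hl : ∀ (k l : Fin d), ((k :: l :: ts).Perm (i :: j :: ts)) → ∀ x ∈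
          Submodule.span F {f | ∃ w', w'.Perm (ts ++ w) ∧ f = monomial F w'},
          FreeAlgebra.ι F k * (FreeAlgebra.ι F l * x) ∈
          Submodule.span F {f | ∃ w', w'.Perm (i :: j :: ts ++ w) ∧ f = monomial F w'} := by
        intro k l hkl x hx
        induction hx using Submodule.span_induction with
        | mem x hx =>
          obtain ⟨w', hw', rfl⟩ := hx
          refine Submodule.subset_span ⟨k :: l :: w', ?_, ?_⟩
          · exact (((hw'.cons l).cons k).trans (List.Perm.append_right w hkl))
          · rw [monomial_cons, monomial_cons]
        | zero => simp
        | add x y _ _ hx hy => rw [mul_add, mul_add]; exact add_mem hx hy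
        | smul r x _ hx =>
          rw [mul_smul_comm, mul_smul_comm]
          exact Submodule.smul_mem _ _ hx
      rw [mul_assoc, sub_mul, mul_assoc, mul_assoc]
      exact sub_mem (hl i j (List.Perm.refl _) _ (hpw w)) (hl j i (List.Perm.swap _ _ _) _ (hpw w))

theorem exists_list_count {d : ℕ} (β : Fin d → ℕ) : ∃ w : List (Fin d), ∀ k, w.count k = β k := by
  refine ⟨(Finsupp.toMultiset (Finsupp.equivFunOnFinite.symm β)).toList, fun k => ?_⟩
  rw [← Multiset.coe_count, Multiset.coe_toList, Finsupp.count_toMultiset]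
  rfl

/-- Twice the number of subsets of even cardinality. -/
theorem two_mul_card_filter_even (U : Finset ℕ) :
    2 * ((U.powerset.filter fun S => Even S.card).card : ℤ) =
      2 ^ U.card + if U = ∅ then 1 else 0 := by
  have h1 := Finset.sum_powerset_neg_one_pow_card (x := U)
  have h2 : ∑ S ∈ U.powerset, ((-1 : ℤ) ^ S.card + 1) =
      ∑ S ∈ U.powerset, if Even S.card then 2 else 0 := by
    refine Finset.sum_congr rfl fun S _ => ?_
    split_ifs with h
    · rw [h.neg_one_pow]; norm_num
    · rw [(Nat.not_even_iff_odd.1 h).neg_one_pow]; norm_num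
  rw [Finset.sum_add_distrib, h1, ← Finset.sum_filter, Finset.sum_const, Finset.sum_const,
    Finset.card_powerset] at h2
  simp only [nsmul_eq_mul, mul_one] at h2
  push_cast at h2
  linarith

open Classical in
/-- The dimension of the multihomogeneous components of the relatively free Grassmann algebra, in
terms of generic values. -/
theorem finrank_map_theta (F : Type*) [Field F] [CharZero F] {d : ℕ} {φ : Fin d → ℕ}
    (hφ : Function.Injective φ) (α : Fin d →₀ ℕ) :
    Module.finrank F ((multihomogeneous F d α).map (theta F φ).toLinearMap) =
      (((Finset.univ.filter fun k => α k ≠ 0).image φ).powerset.filter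
        fun S => Even S.card).card := by
  set U := (Finset.univ.filter fun k => α k ≠ 0).image φ with hU
  set P := U.powerset.filter fun S => Even S.card with hP
  have hPmem : ∀ S, S ∈ P ↔ S ⊆ U ∧ Even S.card := fun S => by simp [hP]
  have hUw : ∀ w : List (Fin d), (∀ k, w.count k = α k) → (w.map φ).toFinset = U := by
    intro w hw
    ext i
    simp only [hU, List.mem_toFinset, List.mem_map, Finset.mem_image, Finset.mem_filter,
      Finset.mem_univ, true_and]
    refine exists_congr fun k => and_congr_left fun _ => ?_
    rw [← hw, ← List.count_pos_iff, Nat.pos_iff_ne_zero]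
  -- Upper bound: all values are `(1 + η) q` with the same `η` and with `q` in the span of the `e_S`
  -- with `|S|` even.
  have hle : (multihomogeneous F d α).map (theta F φ).toLinearMap ≤
      (gspan F (P : Set (Finset ℕ))).map (LinearMap.mulLeft F (1 + contentVec F φ α)) := by
    rw [multihomogeneous, Submodule.map_span, Submodule.span_le]
    rintro _ ⟨_, ⟨w, hw, rfl⟩, rfl⟩
    obtain ⟨q, hq, hqw⟩ := exists_theta_eq F φ w
    refine ⟨q, gspan_mono (fun S hS => ?_) hq, ?_⟩
    · rw [hUw w hw] at hS
      exact Finset.mem_coe.2 ((hPmem S).2 hS)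
    · have hα : (α : Fin d → ℕ) = fun j => w.count j := funext fun j => (hw j).symm
      rw [LinearMap.mulLeft_apply, hα]
      exact hqw.symm
  have hfin : FiniteDimensional F (gspan F (P : Set (Finset ℕ))) :=
    FiniteDimensional.span_of_finite F (P.finite_toSet.image _)
  have hfin' : FiniteDimensional F ((multihomogeneous F d α).map (theta F φ).toLinearMap) :=
    Submodule.finiteDimensional_of_le hle
  apply le_antisymm
  · refine (Submodule.finrank_mono hle).trans ((Submodule.finrank_map_le _ _).trans ?_)
    rw [gspan, ← Finset.coe_image]
    exact (finrank_span_finset_le_card _).trans Finset.card_image_le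
  -- Lower bound: commutators in the letters of `S` followed by the remaining letters have a value
  -- with lowest term `e_S`.
  · have hex : ∀ S : P, ∃ v : (multihomogeneous F d α).map (theta F φ).toLinearMap,
        (gmon F).repr v.1 S.1 ≠ 0 ∧ ∀ T, ¬ S.1 ⊆ T → (gmon F).repr v.1 T = 0 := by
      rintro ⟨S, hS⟩
      obtain ⟨hSU, hSe⟩ := (hPmem S).1 hS
      set R : Finset (Fin d) := Finset.univ.filter fun k => φ k ∈ S with hR
      have hRS : (R.toList.map φ).toFinset = S := by
        ext i
        simp only [hR, List.mem_toFinset, List.mem_map, Finset.mem_toList, Finset.mem_filter,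
          Finset.mem_univ, true_and]
        constructor
        · rintro ⟨k, hk, rfl⟩
          exact hk
        · intro hi
          obtain ⟨k, -, rfl⟩ := Finset.mem_image.1 (hSU hi)
          exact ⟨k, hi, rfl⟩
      have hRcard : R.toList.length = S.card := by
        rw [← hRS, List.toFinset_card_of_nodup ((Finset.nodup_toList R).map hφ), List.length_map]
      obtain ⟨p, ⟨c, hc, hp⟩, hpw⟩ := exists_theta_eq_smul_gmon F hφ R.toList
        (Finset.nodup_toList R) (hRcard ▸ hSe)
      obtain ⟨w, hw⟩ := exists_list_count fun k => α k - R.toList.count k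
      have hmem : p * monomial F w ∈ multihomogeneous F d α := by
        refine Submodule.span_mono ?_ (hpw w)
        rintro _ ⟨w', hw', rfl⟩
        refine ⟨w', fun k => ?_, rfl⟩
        rw [hw'.count_eq, List.count_append, hw]
        have : R.toList.count k ≤ α k := by
          by_cases hk : k ∈ R
          · have h1 := (List.nodup_iff_count_le_one.1 (Finset.nodup_toList R)) k
            obtain ⟨k', hk', hkk⟩ := Finset.mem_image.1 (hSU (Finset.mem_filter.1 hk).2)
            have h2 := (Finset.mem_filter.1 hk').2
            rw [hφ hkk] at h2
            omega
          · rw [List.count_eq_zero.2 (by rwa [Finset.mem_toList])]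
            exact Nat.zero_le _
        omega
      refine ⟨⟨_, ⟨_, hmem, rfl⟩⟩, ?_, ?_⟩
      · change (gmon F).repr (theta F φ (p * monomial F w)) S ≠ 0
        rw [map_mul, hp, hRS, smul_mul_assoc, map_smul, Finsupp.smul_apply, repr_gmon_mul_self,
          repr_theta_empty, smul_eq_mul, mul_one]
        exact hc
      · intro T hT
        change (gmon F).repr (theta F φ (p * monomial F w)) T = 0
        rw [map_mul, hp, hRS, smul_mul_assoc, map_smul, Finsupp.smul_apply,
          repr_gmon_mul_of_not_subset hT, smul_zero]
    choose v hv1 hv2 using hex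
    have hli : LinearIndependent F v := by
      rw [Fintype.linearIndependent_iff]
      intro a ha
      by_contra! hne
      obtain ⟨S₀, hS₀, hmin⟩ := (Finset.univ.filter fun S => a S ≠ 0).exists_min_image
        (fun S => S.1.card) (by
          obtain ⟨S, hS⟩ := hne
          exact ⟨S, Finset.mem_filter.2 ⟨Finset.mem_univ _, hS⟩⟩)
      have h0 := congrArg (fun x => (gmon F).repr (Submodule.subtype _ x) S₀.1) ha
      simp only [map_sum, map_smul, map_zero, Finsupp.finsetSum_apply, Finsupp.smul_apply,
        Finsupp.zero_apply, Submodule.subtype_apply] at h0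
      rw [Finset.sum_eq_single S₀] at h0
      · exact (mul_ne_zero (Finset.mem_filter.1 hS₀).2 (hv1 S₀)) h0
      · intro S _ hS
        by_cases haS : a S = 0
        · rw [haS, zero_smul]
        · rw [hv2, smul_zero]
          intro hsub
          have := hmin S (Finset.mem_filter.2 ⟨Finset.mem_univ _, haS⟩)
          exact hS (Subtype.ext (Finset.eq_of_subset_of_card_le hsub this))
      · intro h
        exact absurd (Finset.mem_univ _) h
    have := hli.fintype_card_le_finrank
    rwa [Fintype.card_coe] at this

open Classical in
theorem two_mul_finrank_map_theta (F : Type*) [Field F] [CharZero F] {d : ℕ} {φ : Fin d → ℕ}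
    (hφ : Function.Injective φ) (α : Fin d →₀ ℕ) :
    2 * (Module.finrank F ((multihomogeneous F d α).map (theta F φ).toLinearMap) : ℤ) =
      (if ∀ k, α k = 0 then 1 else 0) + ∏ k, seriesP (α k) := by
  rw [finrank_map_theta F hφ, two_mul_card_filter_even, Finset.card_image_of_injective _ hφ,
    add_comm]
  congr 1
  · refine if_congr ?_ rfl rfl
    rw [Finset.image_eq_empty, Finset.filter_eq_empty_iff]
    simp
  · simp only [seriesP]
    rw [Finset.prod_ite, Finset.prod_const_one, one_mul, Finset.prod_const]

/-! ### Normal words -/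

/-- The span of the monomials of the rearrangements of a word `z` that satisfy `P`. -/
def rearrangements (F : Type*) [Field F] {d : ℕ} (z : List (Fin d)) (P : List (Fin d) → Prop) :
    Submodule F (FreeAlgebra F (Fin d)) :=
  Submodule.span F {f | ∃ w : List (Fin d), w.Perm z ∧ P w ∧ f = monomial F w}

theorem monomial_mem_rearrangements (F : Type*) [Field F] {d : ℕ} {z w : List (Fin d)}
    {P : List (Fin d) → Prop} (h : w.Perm z) (hP : P w) :
    monomial F w ∈ rearrangements F z P := Submodule.subset_span ⟨w, h, hP, rfl⟩

theorem rearrangements_mono (F : Type*) [Field F] {d : ℕ} {z z' : List (Fin d)}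
    {P Q : List (Fin d) → Prop} (hz : z.Perm z') (h : ∀ w, w.Perm z → P w → Q w) :
    rearrangements F z P ≤ rearrangements F z' Q := by
  refine Submodule.span_mono ?_
  rintro _ ⟨w, hw, hP, rfl⟩
  exact ⟨w, hw.trans hz, h w hw hP, rfl⟩

theorem rearrangements_eq (F : Type*) [Field F] {d : ℕ} {z : List (Fin d)} {α : Fin d →₀ ℕ}
    (hz : ∀ k, z.count k = α k) :
    rearrangements F z (fun _ => True) = multihomogeneous F d α := by
  rw [rearrangements, multihomogeneous]
  congr 1
  ext f
  refine exists_congr fun w => ?_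
  rw [true_and, List.perm_iff_count]
  simp only [hz]

theorem ι_mul_mem_rearrangements (F : Type*) [Field F] {d : ℕ} {z : List (Fin d)}
    {P Q : List (Fin d) → Prop} (x : Fin d) (h : ∀ w, w.Perm z → P w → Q (x :: w))
    {f : FreeAlgebra F (Fin d)} (hf : f ∈ rearrangements F z P) :
    FreeAlgebra.ι F x * f ∈ rearrangements F (x :: z) Q := by
  induction hf using Submodule.span_induction with
  | mem f hf =>
    obtain ⟨w, hw, hP, rfl⟩ := hf
    rw [← monomial_cons]
    exact monomial_mem_rearrangements F (hw.cons x) (h w hw hP)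
  | zero => rw [mul_zero]; exact zero_mem _
  | add f g _ _ hf hg => rw [mul_add]; exact add_mem hf hg
  | smul r f _ hf => rw [mul_smul_comm]; exact Submodule.smul_mem _ _ hf

theorem monomial_mul_mem_rearrangements (F : Type*) [Field F] {d : ℕ} {z : List (Fin d)}
    {f : FreeAlgebra F (Fin d)} (hf : f ∈ rearrangements F z fun _ => True) (v : List (Fin d)) :
    monomial F v * f ∈ rearrangements F (v ++ z) fun _ => True := by
  induction v with
  | nil => rwa [monomial_nil, one_mul]
  | cons x v ih =>
    rw [monomial_cons, mul_assoc]
    exact ι_mul_mem_rearrangements F x (fun _ _ _ => trivial) ih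

theorem finite_perm {d : ℕ} (z : List (Fin d)) : {w : List (Fin d) | w.Perm z}.Finite := by
  refine Set.Finite.subset (z.permutations.toFinset.finite_toSet) fun w hw => ?_
  simpa using hw

/-- A word is normal modulo `I` if it is not congruent modulo `I` to a linear combination of
lexicographically smaller rearrangements. -/
def IsNormal {F : Type*} [Field F] {d : ℕ} (I : Submodule F (FreeAlgebra F (Fin d)))
    (w : List (Fin d)) : Prop :=
  monomial F w ∉ rearrangements F w (· < w) ⊔ I

section

variable {F : Type*} [Field F] {d : ℕ} {I : Submodule F (FreeAlgebra F (Fin d))}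

theorem IsNormal.tail (hI : ∀ x, ∀ f ∈ I, FreeAlgebra.ι F x * f ∈ I) {x : Fin d}
    {u : List (Fin d)} (h : IsNormal I (x :: u)) : IsNormal I u := by
  intro hu
  refine h ?_
  obtain ⟨s, hs, i, hi, hsi⟩ := Submodule.mem_sup.1 hu
  rw [monomial_cons, ← hsi, mul_add]
  refine Submodule.add_mem_sup (ι_mul_mem_rearrangements F x (fun w _ hw => ?_) hs) (hI x i hi)
  exact List.cons_lt_cons_iff.2 (Or.inr ⟨rfl, hw⟩)

theorem IsNormal.of_append (hI : ∀ x, ∀ f ∈ I, FreeAlgebra.ι F x * f ∈ I) {v u : List (Fin d)}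
    (h : IsNormal I (v ++ u)) : IsNormal I u := by
  induction v with
  | nil => exact h
  | cons x v ih => exact ih (IsNormal.tail hI h)

theorem isNormal_nil (hI : (1 : FreeAlgebra F (Fin d)) ∉ I) : IsNormal I [] := by
  intro h
  have h0 : rearrangements F ([] : List (Fin d)) (· < []) = ⊥ := by
    rw [rearrangements, Submodule.span_eq_bot]
    rintro _ ⟨w, -, hw, -⟩
    exact absurd hw (List.not_lt_nil w)
  rw [h0, bot_sup_eq] at h
  exact hI h

/-- Modulo `I`, the normal words span. -/
theorem monomial_mem_normal_sup (I : Submodule F (FreeAlgebra F (Fin d))) (w : List (Fin d)) :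
    monomial F w ∈ rearrangements F w (IsNormal I) ⊔ I := by
  classical
  by_contra hbad
  let B := (finite_perm w).toFinset.filter fun w' =>
    monomial F w' ∉ rearrangements F w (IsNormal I) ⊔ I
  -- A smallest rearrangement outside the span is neither normal nor reducible to smaller ones.
  obtain ⟨v, hv, hmin⟩ := B.exists_min_image id ⟨w, by simp [B, hbad]⟩
  simp only [B, Finset.mem_filter, Set.Finite.mem_toFinset, Set.mem_ofPred_eq] at hv hmin
  obtain ⟨hvw, hv⟩ := hv
  by_cases hn : IsNormal I v
  · exact hv (Submodule.mem_sup_left (monomial_mem_rearrangements F hvw hn))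
  · rw [IsNormal, not_not] at hn
    suffices hle : rearrangements F v (· < v) ≤ rearrangements F w (IsNormal I) ⊔ I from
      hv (sup_le hle le_sup_right hn)
    rw [rearrangements, Submodule.span_le]
    rintro _ ⟨u, huv, hlt, rfl⟩
    by_contra hu
    exact absurd (hmin u ⟨huv.trans hvw, hu⟩) (not_le.2 hlt)

/-- The normal form of a word. -/
theorem exists_normalForm (I : Submodule F (FreeAlgebra F (Fin d))) (w : List (Fin d)) :
    ∃ r ∈ rearrangements F w (IsNormal I), monomial F w - r ∈ I := by
  obtain ⟨r, hr, i, hi, h⟩ := Submodule.mem_sup.1 (monomial_mem_normal_sup I w)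
  exact ⟨r, hr, by rw [← h, add_sub_cancel_left]; exact hi⟩

instance finite_normal (I : Submodule F (FreeAlgebra F (Fin d))) (z : List (Fin d)) :
    Finite {w : List (Fin d) // w.Perm z ∧ IsNormal I w} :=
  Set.Finite.subset (finite_perm z) fun _ h => h.1

/-- Modulo `I`, the normal words are linearly independent. -/
theorem linearIndependent_normal {V : Type*} [AddCommGroup V] [Module F V] (z : List (Fin d))
    (θ : FreeAlgebra F (Fin d) →ₗ[F] V)
    (hθ : ∀ f ∈ rearrangements F z (fun _ => True), θ f = 0 → f ∈ I) :
    LinearIndependent F fun w : {w : List (Fin d) // w.Perm z ∧ IsNormal I w} =>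
      θ (monomial F w.1) := by
  classical
  have : Fintype {w : List (Fin d) // w.Perm z ∧ IsNormal I w} := Fintype.ofFinite _
  rw [Fintype.linearIndependent_iff]
  intro a ha
  by_contra! hne
  -- The largest word in a linear relation would be congruent to a combination of smaller ones.
  obtain ⟨w₀, hw₀, hmax⟩ := (Finset.univ.filter fun w => a w ≠ 0).exists_max_image
    (fun w => w.1) (by
      obtain ⟨w, hw⟩ := hne
      exact ⟨w, Finset.mem_filter.2 ⟨Finset.mem_univ _, hw⟩⟩)
  have ha₀ := (Finset.mem_filter.1 hw₀).2
  have hmem : ∑ w, a w • monomial F w.1 ∈ I := by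
    refine hθ _ (Submodule.sum_mem _ fun w _ => Submodule.smul_mem _ _
      (monomial_mem_rearrangements F w.2.1 trivial)) ?_
    simpa only [map_sum, map_smul] using ha
  refine w₀.2.2 ?_
  rw [← Submodule.smul_mem_iff _ ha₀]
  have h1 : a w₀ • monomial F w₀.1 = -(∑ w ∈ Finset.univ.erase w₀, a w • monomial F w.1) +
      ∑ w, a w • monomial F w.1 := by
    rw [← Finset.add_sum_erase _ _ (Finset.mem_univ w₀)]
    abel
  rw [h1]
  refine Submodule.add_mem_sup (Submodule.neg_mem _ (Submodule.sum_mem _ fun w hw => ?_)) hmem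
  by_cases hw0 : a w = 0
  · rw [hw0, zero_smul]
    exact zero_mem _
  · refine Submodule.smul_mem _ _
      (monomial_mem_rearrangements F (w.2.1.trans w₀.2.1.symm) ?_)
    exact lt_of_le_of_ne (hmax w (Finset.mem_filter.2 ⟨Finset.mem_univ _, hw0⟩))
      fun h => (Finset.mem_erase.1 hw).1 (Subtype.ext h)

open Classical in
/-- The functional that reads off the coefficient of a normal word. -/
theorem exists_normal_dual {V : Type*} [AddCommGroup V] [Module F V] {z : List (Fin d)}
    (hz : IsNormal I z) (θ : FreeAlgebra F (Fin d) →ₗ[F] V)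
    (hθ : ∀ f ∈ rearrangements F z (fun _ => True), θ f = 0 → f ∈ I) :
    ∃ l : V →ₗ[F] F, ∀ w : List (Fin d), w.Perm z → IsNormal I w →
      l (θ (monomial F w)) = if w = z then 1 else 0 := by
  have hli := linearIndependent_normal z θ hθ
  obtain ⟨l, hl⟩ := LinearMap.exists_extend
    ((Module.Basis.span hli).coord ⟨z, List.Perm.refl z, hz⟩)
  refine ⟨l, fun w hw hn => ?_⟩
  have h1 := LinearMap.congr_fun hl (Module.Basis.span hli ⟨w, hw, hn⟩)
  rw [LinearMap.comp_apply, Module.Basis.coord_apply, Module.Basis.repr_self,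
    Finsupp.single_apply, Submodule.subtype_apply, Module.Basis.span_apply] at h1
  rw [h1]
  refine if_congr ?_ rfl rfl
  rw [Subtype.mk.injEq]

theorem finrank_map_eq_card_normal {V : Type*} [AddCommGroup V] [Module F V] (z : List (Fin d))
    (θ : FreeAlgebra F (Fin d) →ₗ[F] V)
    (hθ : ∀ f ∈ rearrangements F z (fun _ => True), θ f = 0 → f ∈ I)
    (hI : ∀ f ∈ I, θ f = 0) :
    Module.finrank F ((rearrangements F z fun _ => True).map θ) =
      Nat.card {w : List (Fin d) // w.Perm z ∧ IsNormal I w} := by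
  have : Fintype {w : List (Fin d) // w.Perm z ∧ IsNormal I w} := Fintype.ofFinite _
  have h : (rearrangements F z fun _ => True).map θ = Submodule.span F (Set.range
      fun w : {w : List (Fin d) // w.Perm z ∧ IsNormal I w} => θ (monomial F w.1)) := by
    apply le_antisymm
    · rw [rearrangements, Submodule.map_span, Submodule.span_le]
      rintro _ ⟨_, ⟨w, hw, -, rfl⟩, rfl⟩
      obtain ⟨r, hr, hi⟩ := exists_normalForm I w
      have h1 := hI _ hi
      rw [map_sub, sub_eq_zero] at h1
      rw [SetLike.mem_coe, h1]
      have h2 : θ r ∈ (rearrangements F w (IsNormal I)).map θ := ⟨r, hr, rfl⟩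
      refine Submodule.span_le.2 ?_ ((Submodule.map_span θ _).le h2)
      rintro _ ⟨_, ⟨w', hw', hn, rfl⟩, rfl⟩
      exact Submodule.subset_span ⟨⟨w', hw'.trans hw, hn⟩, rfl⟩
    · rw [Submodule.span_le]
      rintro _ ⟨w, rfl⟩
      exact ⟨_, monomial_mem_rearrangements F w.2.1 trivial, rfl⟩
  rw [h, finrank_span_eq_card (linearIndependent_normal z θ hθ), Nat.card_eq_fintype_card]

end

/-! ### Substitutions into `UT₂(E)` -/

theorem basisFreeMonoid_eq_monomial (F : Type*) [Field F] {X : Type*} (w : FreeMonoid X) :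
    FreeAlgebra.basisFreeMonoid F X w = monomial F w.toList := by
  have h : FreeAlgebra.basisFreeMonoid F X w =
      FreeAlgebra.equivMonoidAlgebraFreeMonoid.symm (MonoidAlgebra.of F _ w) := rfl
  rw [h]
  change MonoidAlgebra.lift F _ _ (FreeMonoid.lift (FreeAlgebra.ι F)) (MonoidAlgebra.of F _ w) = _
  rw [MonoidAlgebra.lift_of, FreeMonoid.lift_apply]
  rfl

/-- Linear maps on the free algebra agree if they agree on monomials. -/
theorem linearMap_ext_monomial {F V X : Type*} [Field F] [AddCommGroup V] [Module F V]
    {f g : FreeAlgebra F X →ₗ[F] V} (h : ∀ w, f (monomial F w) = g (monomial F w)) : f = g := by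
  refine (FreeAlgebra.basisFreeMonoid F X).ext fun w => ?_
  rw [basisFreeMonoid_eq_monomial, h]

/-- The linear map on the free algebra with given values on the monomials. -/
def ofWords {F V X : Type*} [Field F] [AddCommGroup V] [Module F V] (p : List X → V) :
    FreeAlgebra F X →ₗ[F] V :=
  (FreeAlgebra.basisFreeMonoid F X).constr F fun w => p w.toList

theorem ofWords_monomial {F V X : Type*} [Field F] [AddCommGroup V] [Module F V] (p : List X → V)
    (w : List X) : ofWords p (monomial F w) = p w := by
  have h := (FreeAlgebra.basisFreeMonoid F X).constr_basis F (fun w => p w.toList)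
    (FreeMonoid.ofList w)
  rw [basisFreeMonoid_eq_monomial] at h
  exact h

/-- The sum of `p v * q u` over all factorizations `w = v x u` of a word. -/
def splitSum {X B : Type*} [DecidableEq X] [NonUnitalNonAssocSemiring B] (x : X) :
    (List X → B) → (List X → B) → List X → B
  | _, _, [] => 0
  | p, q, k :: w => (if k = x then p [] * q w else 0) + splitSum x (fun v => p (k :: v)) q w

section

variable {X : Type*} [DecidableEq X]

theorem map_splitSum {B B' : Type*} [NonUnitalNonAssocSemiring B] [NonUnitalNonAssocSemiring B']
    (x : X) (L : B →+ B') {p q : List X → B} {p' q' : List X → B'}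
    (h : ∀ v u, L (p v * q u) = p' v * q' u) (w : List X) :
    L (splitSum x p q w) = splitSum x p' q' w := by
  induction w generalizing p p' with
  | nil => exact map_zero L
  | cons k w ih =>
    rw [splitSum, splitSum, map_add, ih fun v u => h (k :: v) u]
    congr 1
    split_ifs
    · exact h _ _
    · exact map_zero L

theorem mul_splitSum {B : Type*} [Semiring B] (x : X) (a : B) (p q : List X → B) (w : List X) :
    a * splitSum x p q w = splitSum x (fun v => a * p v) q w :=
  map_splitSum x (AddMonoidHom.mulLeft a) (fun _ _ => (mul_assoc _ _ _).symm) w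

theorem splitSum_eq_zero {B : Type*} [Semiring B] (x : X) (p q : List X → B) (w : List X)
    (h : ∀ v u, w = v ++ x :: u → q u = 0) : splitSum x p q w = 0 := by
  induction w generalizing p with
  | nil => rfl
  | cons k w ih =>
    rw [splitSum, ih _ fun v u hw => h (k :: v) u (by rw [hw]; rfl), add_zero]
    split_ifs with hk
    · rw [h [] w (by rw [hk]; rfl), mul_zero]
    · rfl

end

/-- The substitution of upper triangular matrices given by two substitutions on the diagonal, in
which the variable `x` also has the upper right entry `1`. -/
def triangular {F A : Type*} [Field F] [Ring A] [Algebra F A] {d : ℕ} (x : Fin d)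
    (a b : Fin d → A) :
    FreeAlgebra F (Fin d) →ₐ[F] UT2 F A :=
  FreeAlgebra.lift F fun k => ⟨!![a k, if k = x then 1 else 0; 0, b k], rfl⟩

theorem triangular_monomial {F A : Type*} [Field F] [Ring A] [Algebra F A] {d : ℕ} (x : Fin d)
    (a b : Fin d → A) (w : List (Fin d)) :
    (triangular (F := F) x a b (monomial F w)).1 =
      !![FreeAlgebra.lift F a (monomial F w),
        splitSum x (fun v => FreeAlgebra.lift F a (monomial F v))
          (fun u => FreeAlgebra.lift F b (monomial F u)) w;
        0, FreeAlgebra.lift F b (monomial F w)] := by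
  induction w with
  | nil =>
    simp only [monomial_nil, map_one, splitSum]
    exact Matrix.one_fin_two
  | cons k w ih =>
    have h1 : (triangular (F := F) x a b (FreeAlgebra.ι F k)).1 =
        !![a k, if k = x then 1 else 0; 0, b k] := by
      rw [triangular, FreeAlgebra.lift_ι_apply]
    rw [monomial_cons, map_mul, MulMemClass.coe_mul, h1, ih, Matrix.mul_fin_two]
    simp only [map_mul, FreeAlgebra.lift_ι_apply, mul_zero, zero_mul, add_zero, zero_add]
    congr 3
    rw [mul_splitSum, splitSum, add_comm]
    simp only [monomial_cons, map_mul, FreeAlgebra.lift_ι_apply, monomial_nil, map_one, ite_mul,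
      one_mul, zero_mul]

/-- Functionals on two Grassmann algebras in disjoint sets of generators combine to a functional on
products. -/
theorem exists_mul_functional {F : Type*} [Field F] (U : Set ℕ) (l₁ l₂ : Grassmann F →ₗ[F] F) :
    ∃ L : Grassmann F →ₗ[F] F, ∀ a ∈ gspan F {S | ∀ i ∈ S, i ∈ U},
      ∀ b ∈ gspan F {S | ∀ i ∈ S, i ∉ U}, L (a * b) = l₁ a * l₂ b := by
  classical
  choose ε hε hmul using fun S : Finset ℕ => gmon_mul_of_disjoint F
    (Finset.disjoint_filter_filter_not S S (· ∈ U))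
  let L : Grassmann F →ₗ[F] F := (gmon F).constr F fun S =>
    ε S * (l₁ (gmon F (S.filter (· ∈ U))) * l₂ (gmon F (S.filter fun i => ¬ i ∈ U)))
  have hL : ∀ S, L (gmon F S) =
      ε S * (l₁ (gmon F (S.filter (· ∈ U))) * l₂ (gmon F (S.filter fun i => ¬ i ∈ U))) :=
    fun S => (gmon F).constr_basis F _ S
  refine ⟨L, fun a ha b hb => ?_⟩
  rw [gspan] at ha hb
  induction ha, hb using Submodule.span_induction₂ with
  | mem_mem a b ha hb =>
    obtain ⟨S, hS, rfl⟩ := ha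
    obtain ⟨T, hT, rfl⟩ := hb
    have h1 : (S ∪ T).filter (· ∈ U) = S := by
      ext i
      simp only [Finset.mem_filter, Finset.mem_union]
      exact ⟨fun h => h.1.resolve_right fun h' => hT i h' h.2, fun h => ⟨Or.inl h, hS i h⟩⟩
    have h2 : ((S ∪ T).filter fun i => ¬ i ∈ U) = T := by
      ext i
      simp only [Finset.mem_filter, Finset.mem_union]
      exact ⟨fun h => h.1.resolve_left fun h' => h.2 (hS i h'), fun h => ⟨Or.inr h, hT i h⟩⟩
    have h3 := hmul (S ∪ T)
    rw [h1, h2] at h3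
    rw [h3, map_smul, hL, h1, h2, smul_eq_mul, ← mul_assoc, hε, one_mul]
  | zero_left b hb => simp
  | zero_right a ha => simp
  | add_left a b c _ _ _ h1 h2 => rw [add_mul, map_add, map_add, add_mul, h1, h2]
  | add_right a b c _ _ _ h1 h2 => rw [mul_add, map_add, map_add, mul_add, h1, h2]
  | smul_left r a b _ _ h => rw [smul_mul_assoc, map_smul, map_smul, smul_mul_assoc, h]
  | smul_right r a b _ _ h => rw [mul_smul_comm, map_smul, map_smul, mul_smul_comm, h]

theorem lift_smul_monomial (F : Type*) [Field F] {d : ℕ} (φ : Fin d → ℕ) (c : Fin d → F)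
    (w : List (Fin d)) :
    FreeAlgebra.lift F (fun k => c k • (1 + ggen F (φ k))) (monomial F w) =
      (w.map c).prod • theta F φ (monomial F w) := by
  induction w with
  | nil => rw [monomial_nil, map_one, map_one, List.map_nil, List.prod_nil, one_smul]
  | cons k w ih =>
    rw [theta_cons, monomial_cons, map_mul, ih, FreeAlgebra.lift_ι_apply, List.map_cons,
      List.prod_cons, smul_mul_smul_comm]

theorem prod_map_X (F : Type*) [Field F] {σ : Type*} (l : List σ) :
    (l.map (MvPolynomial.X : σ → MvPolynomial σ F)).prod =
      MvPolynomial.monomial ((l.map fun i => Finsupp.single i 1).sum) 1 := by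
  induction l with
  | nil => rfl
  | cons i l ih =>
    rw [List.map_cons, List.prod_cons, ih, List.map_cons, List.sum_cons, MvPolynomial.X,
      MvPolynomial.monomial_mul, one_mul]

theorem sum_map_single_eq_iff {σ : Type*} [DecidableEq σ] (l l' : List σ) :
    (l.map fun i => Finsupp.single i 1).sum = (l'.map fun i => Finsupp.single i (1 : ℕ)).sum ↔
      l.Perm l' := by
  have h : ∀ (l : List σ) (i : σ), (l.map fun i => Finsupp.single i 1).sum i = l.count i := by
    intro l i
    induction l with
    | nil => rfl
    | cons j l ih =>
      rw [List.map_cons, List.sum_cons, Finsupp.add_apply, ih, List.count_cons,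
        Finsupp.single_apply, add_comm]
      simp
  rw [List.perm_iff_count, Finsupp.ext_iff]
  simp only [h]

theorem perm_inl_append_inr {σ τ : Type*} {v v' : List σ} {u u' : List τ} :
    (v.map Sum.inl ++ u.map Sum.inr : List (σ ⊕ τ)).Perm (v'.map Sum.inl ++ u'.map Sum.inr) ↔
      v.Perm v' ∧ u.Perm u' := by
  constructor
  · intro h
    have h1 := h.filterMap Sum.getLeft?
    have h2 := h.filterMap Sum.getRight?
    simp only [List.filterMap_append, List.filterMap_map] at h1 h2
    have e1 : ((Sum.getLeft? : σ ⊕ τ → Option σ) ∘ Sum.inl) = some := rfl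
    have e2 : ((Sum.getLeft? : σ ⊕ τ → Option σ) ∘ Sum.inr) = fun _ => none := rfl
    have e3 : ((Sum.getRight? : σ ⊕ τ → Option τ) ∘ Sum.inr) = some := rfl
    have e4 : ((Sum.getRight? : σ ⊕ τ → Option τ) ∘ Sum.inl) = fun _ => none := rfl
    rw [e1, e2] at h1
    rw [e3, e4] at h2
    simp only [List.filterMap_some, List.filterMap_none, List.append_nil, List.nil_append] at h1 h2
    exact ⟨h1, h2⟩
  · rintro ⟨h1, h2⟩
    exact (h1.map _).append (h2.map _)

open Classical in
/-- The identities of `UT₂(E)` are annihilated by all functionals that split a word at a variable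
and evaluate both factors, in fixed multidegrees, by functionals on generic values. -/
theorem ofWords_splitSum_eq_zero {F : Type*} [Field F] [CharZero F] {d : ℕ} (x : Fin d)
    (v₀ u₀ : List (Fin d)) (l₁ l₂ : Grassmann F →ₗ[F] F) {φ ψ : Fin d → ℕ}
    (hφψ : ∀ i j, φ i ≠ ψ j)
    {f : FreeAlgebra F (Fin d)} (hf : f ∈ identities F (UT2 F (Grassmann F)) (Fin d)) :
    ofWords (splitSum x (fun v => if v.Perm v₀ then l₁ (theta F φ (monomial F v)) else 0)
      (fun u => if u.Perm u₀ then l₂ (theta F ψ (monomial F u)) else 0)) f = 0 := by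
  obtain ⟨L, hL⟩ := exists_mul_functional (Set.range φ) l₁ l₂
  have hL' : ∀ v u : List (Fin d), L (theta F φ (monomial F v) * theta F ψ (monomial F u)) =
      l₁ (theta F φ (monomial F v)) * l₂ (theta F ψ (monomial F u)) := by
    intro v u
    refine hL _ (gspan_mono (fun S hS => ?_) (theta_mem_gspan F φ v)) _
      (gspan_mono (fun S hS => ?_) (theta_mem_gspan F ψ u))
    · intro i hi
      have := hS hi
      rw [List.mem_toFinset, List.mem_map] at this
      obtain ⟨k, -, rfl⟩ := this
      exact ⟨k, rfl⟩
    · intro i hi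
      have := hS hi
      rw [List.mem_toFinset, List.mem_map] at this
      obtain ⟨k, -, rfl⟩ := this
      rintro ⟨j, hj⟩
      exact hφψ j k hj
  let P : List (Fin d) → MvPolynomial (Fin d ⊕ Fin d) F := fun v =>
    ((v.map Sum.inl).map MvPolynomial.X).prod * MvPolynomial.C (l₁ (theta F φ (monomial F v)))
  let Q : List (Fin d) → MvPolynomial (Fin d ⊕ Fin d) F := fun u =>
    ((u.map Sum.inr).map MvPolynomial.X).prod * MvPolynomial.C (l₂ (theta F ψ (monomial F u)))
  -- The polynomial `Z f` in the scaling parameters collects the contributions of all multidegrees.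
  let Z : FreeAlgebra F (Fin d) →ₗ[F] MvPolynomial (Fin d ⊕ Fin d) F := ofWords (splitSum x P Q)
  have hZ : Z f = 0 := by
    -- The value of `Z f` at scaling parameters `c` is a functional of the upper right entry of `f`
    -- at triangular matrices; polynomials over the infinite field `F` are determined by their
    -- values.
    refine MvPolynomial.funext fun c => ?_
    let Ψ := triangular (F := F) x (fun k => c (Sum.inl k) • (1 + ggen F (φ k)))
      (fun k => c (Sum.inr k) • (1 + ggen F (ψ k)))
    let entry : FreeAlgebra F (Fin d) →ₗ[F] Grassmann F :=
      (LinearMap.proj 1 ∘ₗ LinearMap.proj 0) ∘ₗ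
        ((UT2 F (Grassmann F)).val.toLinearMap ∘ₗ Ψ.toLinearMap)
    have hentry : ∀ f, entry f = (Ψ f).1 0 1 := fun _ => rfl
    have heq : (MvPolynomial.aeval c).toLinearMap ∘ₗ Z = L ∘ₗ entry := by
      refine linearMap_ext_monomial fun w => ?_
      rw [LinearMap.comp_apply, LinearMap.comp_apply, hentry, triangular_monomial, ofWords_monomial]
      simp only [Matrix.of_apply, Matrix.cons_val_zero, Matrix.cons_val_one]
      have h1 : ∀ v u, MvPolynomial.aeval c (P v * Q u) =
          ((v.map fun k => c (Sum.inl k)).prod * l₁ (theta F φ (monomial F v))) *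
          ((u.map fun k => c (Sum.inr k)).prod * l₂ (theta F ψ (monomial F u))) := by
        intro v u
        simp only [P, Q, map_mul, map_list_prod, List.map_map, MvPolynomial.aeval_C,
          Algebra.algebraMap_self, RingHom.id_apply]
        congr 4 <;> · funext k
                      simp
      have h2 : ∀ v u : List (Fin d), L (
          FreeAlgebra.lift F (fun k => c (Sum.inl k) • (1 + ggen F (φ k))) (monomial F v) *
          FreeAlgebra.lift F (fun k => c (Sum.inr k) • (1 + ggen F (ψ k))) (monomial F u)) =
          ((v.map fun k => c (Sum.inl k)).prod * l₁ (theta F φ (monomial F v))) *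
          ((u.map fun k => c (Sum.inr k)).prod * l₂ (theta F ψ (monomial F u))) := by
        intro v u
        rw [lift_smul_monomial, lift_smul_monomial, smul_mul_smul_comm, map_smul, hL', smul_eq_mul]
        ring
      refine (map_splitSum x (MvPolynomial.aeval c).toLinearMap.toAddMonoidHom h1 w).trans ?_
      exact (map_splitSum x L.toAddMonoidHom h2 w).symm
    have h3 := LinearMap.congr_fun heq f
    rw [LinearMap.comp_apply, LinearMap.comp_apply, hentry, mem_identities.1 hf Ψ] at h3
    rw [map_zero, ← MvPolynomial.coe_aeval_eq_eval]
    refine Eq.trans h3 ?_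
    exact map_zero L
  -- The coefficient of `e₀` picks the factorizations in which the factors are rearrangements of
  -- `v₀` and `u₀`.
  let e₀ : Fin d ⊕ Fin d →₀ ℕ :=
    ((v₀.map Sum.inl ++ u₀.map Sum.inr).map fun i => Finsupp.single i 1).sum
  have hY : MvPolynomial.lcoeff F e₀ ∘ₗ Z =
      ofWords (splitSum x (fun v => if v.Perm v₀ then l₁ (theta F φ (monomial F v)) else 0)
        (fun u => if u.Perm u₀ then l₂ (theta F ψ (monomial F u)) else 0)) := by
    refine linearMap_ext_monomial fun w => ?_
    rw [LinearMap.comp_apply, ofWords_monomial, ofWords_monomial]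
    refine map_splitSum x (MvPolynomial.lcoeff F e₀).toAddMonoidHom (fun v u => ?_) w
    have h1 : P v * Q u = MvPolynomial.monomial
        ((v.map Sum.inl ++ u.map Sum.inr).map fun i => Finsupp.single i 1).sum
        (l₁ (theta F φ (monomial F v)) * l₂ (theta F ψ (monomial F u))) := by
      simp only [P, Q]
      rw [mul_mul_mul_comm, ← List.prod_append, ← List.map_append, prod_map_X, ← map_mul, mul_comm,
        MvPolynomial.C_mul_monomial, mul_one]
    change MvPolynomial.coeff e₀ (P v * Q u) = _
    rw [h1, MvPolynomial.coeff_monomial]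
    simp only [e₀, sum_map_single_eq_iff, perm_inl_append_inr]
    by_cases hv : v.Perm v₀ <;> by_cases hu : u.Perm u₀ <;> simp [hv, hu]
  rw [← hY, LinearMap.comp_apply, hZ, map_zero]

/-! ### Identities of upper triangular matrices -/

/-- The diagonal entries, as homomorphisms on upper triangular matrices. -/
def diagEntry (F A : Type*) [Field F] [Ring A] [Algebra F A] (i : Fin 2) : UT2 F A →ₐ[F] A :=
  AlgHom.ofLinearMap ((LinearMap.proj i ∘ₗ LinearMap.proj i) ∘ₗ (UT2 F A).val.toLinearMap)
    (by
      change (1 : Matrix (Fin 2) (Fin 2) A) i i = 1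
      exact Matrix.one_apply_eq i)
    (by
      rintro ⟨M, hM⟩ ⟨N, hN⟩
      change (M * N) i i = M i i * N i i
      have hM' : M 1 0 = 0 := hM
      have hN' : N 1 0 = 0 := hN
      rw [Matrix.mul_apply, Fin.sum_univ_two]
      fin_cases i
      · simp [hN']
      · simp [hM'])

theorem diagEntry_apply {F A : Type*} [Field F] [Ring A] [Algebra F A] (i : Fin 2) (M : UT2 F A) :
    diagEntry F A i M = M.1 i i := rfl

/-- The scalar matrices in the algebra of upper triangular matrices. -/
def scalarUT2 (F A : Type*) [Field F] [Ring A] [Algebra F A] : A →ₐ[F] UT2 F A :=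
  AlgHom.codRestrict ((Matrix.diagonalAlgHom F).comp (Pi.constAlgHom F (Fin 2) A)) (UT2 F A)
    fun a => (Matrix.diagonal_apply_ne (fun _ : Fin 2 => a) (by decide : (1 : Fin 2) ≠ 0) :
      Matrix.diagonal (fun _ : Fin 2 => a) 1 0 = 0)

theorem identities_UT2_le (F A X : Type*) [Field F] [Ring A] [Algebra F A] :
    identities F (UT2 F A) X ≤ identities F A X := by
  intro f hf
  rw [mem_identities] at hf ⊢
  intro φ
  have h := congrArg (diagEntry F A 0) (hf ((scalarUT2 F A).comp φ))
  rw [map_zero, diagEntry_apply] at h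
  exact h

/-- Products of two identities of `A` are identities of `UT₂(A)`. -/
theorem mul_mem_identities_UT2 {F A X : Type*} [Field F] [Ring A] [Algebra F A]
    {f g : FreeAlgebra F X} (hf : f ∈ identities F A X) (hg : g ∈ identities F A X) :
    f * g ∈ identities F (UT2 F A) X := by
  rw [mem_identities] at hf hg ⊢
  intro φ
  have h : ∀ {f : FreeAlgebra F X}, (∀ ψ : FreeAlgebra F X →ₐ[F] A, ψ f = 0) →
      (φ f).1 0 0 = 0 ∧ (φ f).1 1 1 = 0 ∧ (φ f).1 1 0 = 0 :=
    fun hf => ⟨hf ((diagEntry F A 0).comp φ), hf ((diagEntry F A 1).comp φ), (φ _).2⟩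
  obtain ⟨h1, h2, h3⟩ := h hf
  obtain ⟨h4, h5, h6⟩ := h hg
  refine Subtype.ext ?_
  rw [map_mul, MulMemClass.coe_mul]
  ext i j
  rw [Matrix.mul_apply, Fin.sum_univ_two]
  fin_cases i <;> fin_cases j <;> simp [h1, h2, h3, h4, h5, h6]

theorem mul_mem_identities {F A X : Type*} [Field F] [Ring A] [Algebra F A]
    (g : FreeAlgebra F X) {f : FreeAlgebra F X} (hf : f ∈ identities F A X) :
    g * f ∈ identities F A X := by
  rw [mem_identities] at hf ⊢
  intro φ
  rw [map_mul, hf, mul_zero]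

/-! ### A basis of the relatively free algebra of `UT₂(E)` -/

section

variable {F : Type*} [Field F] {d : ℕ}

/-- The difference of a word and its normal form. -/
def relator (I : Submodule F (FreeAlgebra F (Fin d))) (w : List (Fin d)) : FreeAlgebra F (Fin d) :=
  monomial F w - (exists_normalForm I w).choose

theorem relator_mem (I : Submodule F (FreeAlgebra F (Fin d))) (w : List (Fin d)) :
    relator I w ∈ I := (exists_normalForm I w).choose_spec.2

theorem monomial_sub_relator_mem (I : Submodule F (FreeAlgebra F (Fin d))) (w : List (Fin d)) :
    monomial F w - relator I w ∈ rearrangements F w (IsNormal I) := by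
  rw [relator, sub_sub_cancel]
  exact (exists_normalForm I w).choose_spec.1

theorem relator_mem_rearrangements (I : Submodule F (FreeAlgebra F (Fin d))) (w : List (Fin d)) :
    relator I w ∈ rearrangements F w fun _ => True := by
  rw [← sub_sub_cancel (monomial F w) (relator I w)]
  exact sub_mem (monomial_mem_rearrangements F (List.Perm.refl w) trivial)
    (rearrangements_mono F (List.Perm.refl w) (fun _ _ _ => trivial)
      (monomial_sub_relator_mem I w))

theorem ofWords_splitSum_ι_mul (x k : Fin d) (p q : List (Fin d) → F) (h : FreeAlgebra F (Fin d)) :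
    ofWords (splitSum x p q) (FreeAlgebra.ι F k * h) =
      (if k = x then p [] * ofWords q h else 0) +
        ofWords (splitSum x (fun v => p (k :: v)) q) h := by
  have h1 : ofWords (splitSum x p q) ∘ₗ LinearMap.mulLeft F (FreeAlgebra.ι F k) =
      (if k = x then p [] • ofWords q else 0) +
        ofWords (splitSum x (fun v => p (k :: v)) q) := by
    refine linearMap_ext_monomial fun w => ?_
    rw [LinearMap.comp_apply, LinearMap.mulLeft_apply, ← monomial_cons, ofWords_monomial, splitSum,
      LinearMap.add_apply, ofWords_monomial]
    split_ifs <;> simp [ofWords_monomial]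
  have h2 := LinearMap.congr_fun h1 h
  rw [LinearMap.comp_apply, LinearMap.mulLeft_apply, LinearMap.add_apply] at h2
  rw [h2]
  split_ifs <;> simp

theorem ofWords_splitSum_monomial_mul (x : Fin d) (p q : List (Fin d) → F)
    {g : FreeAlgebra F (Fin d)} (hg : ∀ t, ofWords q (monomial F t * g) = 0) (v : List (Fin d)) :
    ofWords (splitSum x p q) (monomial F v * g) =
      ofWords (splitSum x (fun t => p (v ++ t)) q) g := by
  induction v generalizing p with
  | nil => rw [monomial_nil, one_mul]; rfl
  | cons k v ih =>
    rw [monomial_cons, mul_assoc, ofWords_splitSum_ι_mul, hg, mul_zero, ite_self, zero_add, ih]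
    rfl

variable {I : Submodule F (FreeAlgebra F (Fin d))}

open Classical in
theorem splitSum_normal_eq_zero (hI : ∀ x, ∀ f ∈ I, FreeAlgebra.ι F x * f ∈ I) {x : Fin d}
    {u : List (Fin d)} (hxu : ¬ IsNormal I (x :: u)) (p : List (Fin d) → F)
    {q : List (Fin d) → F} (hq : ∀ w, IsNormal I w → q w = if w = u then 1 else 0)
    {w : List (Fin d)} (hw : IsNormal I w) : splitSum x p q w = 0 := by
  refine splitSum_eq_zero x p q w fun v u' h => ?_
  rw [h] at hw
  have h1 := IsNormal.of_append hI hw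
  rw [hq u' (IsNormal.tail hI h1), if_neg]
  rintro rfl
  exact hxu h1

open Classical in
/-- The splitting functional of a triple `(v₀, x₀, u₀)` of normal words `v₀`, `u₀` and a letter such
that `x₀ u₀` is not normal is dual to the products of normal words and relators. -/
theorem ofWords_splitSum_relator (hI : ∀ x, ∀ f ∈ I, FreeAlgebra.ι F x * f ∈ I) {x₀ : Fin d}
    {v₀ u₀ : List (Fin d)} (hxu₀ : ¬ IsNormal I (x₀ :: u₀)) {p q : List (Fin d) → F}
    (hp : ∀ w, IsNormal I w → p w = if w = v₀ then 1 else 0)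
    (hq : ∀ w, IsNormal I w → q w = if w = u₀ then 1 else 0)
    (hqI : ∀ w, ∀ g ∈ I, g ∈ rearrangements F w (fun _ => True) → ofWords q g = 0)
    {x : Fin d} {v u : List (Fin d)} (hv : IsNormal I v) (hu : IsNormal I u) :
    ofWords (splitSum x₀ p q) (monomial F v * relator I (x :: u)) =
      if v = v₀ ∧ x = x₀ ∧ u = u₀ then 1 else 0 := by
  have hI' : ∀ t : List (Fin d), ∀ f ∈ I, monomial F t * f ∈ I := by
    intro t f hf
    induction t with
    | nil => rwa [monomial_nil, one_mul]
    | cons x t ih => rw [monomial_cons, mul_assoc]; exact hI _ _ ih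
  rw [ofWords_splitSum_monomial_mul x₀ p q (fun t => hqI (t ++ x :: u) _ (hI' t _ (relator_mem I _))
    (monomial_mul_mem_rearrangements F (relator_mem_rearrangements I _) t))]
  set Y : FreeAlgebra F (Fin d) →ₗ[F] F := ofWords (splitSum x₀ (fun t => p (v ++ t)) q) with hY
  have h1 : Y (monomial F (x :: u) - relator I (x :: u)) = 0 := by
    have h2 : rearrangements F (x :: u) (IsNormal I) ≤ LinearMap.ker Y := by
      rw [rearrangements, Submodule.span_le]
      rintro _ ⟨w, -, hw, rfl⟩
      rw [SetLike.mem_coe, LinearMap.mem_ker, hY, ofWords_monomial]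
      exact splitSum_normal_eq_zero hI hxu₀ _ hq hw
    exact h2 (monomial_sub_relator_mem I _)
  rw [map_sub, sub_eq_zero] at h1
  rw [← h1, hY, ofWords_monomial, splitSum, splitSum_normal_eq_zero hI hxu₀ _ hq hu, add_zero,
    List.append_nil, hp v hv, hq u hu]
  by_cases h3 : v = v₀ <;> by_cases h4 : x = x₀ <;> by_cases h5 : u = u₀ <;> simp [h3, h4, h5]

/-- The spanning family of the relatively free algebra of `UT₂`: the normal words and the products
`v · (x u - normal form)` with `v`, `u` normal and `x u` not normal. -/
def IsGenerator (I : Submodule F (FreeAlgebra F (Fin d))) (z : List (Fin d))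
    (f : FreeAlgebra F (Fin d)) : Prop :=
  (∃ w : List (Fin d), w.Perm z ∧ IsNormal I w ∧ f = monomial F w) ∨
    ∃ (v : List (Fin d)) (x : Fin d) (u : List (Fin d)), (v ++ x :: u).Perm z ∧ IsNormal I v ∧
      IsNormal I u ∧ ¬ IsNormal I (x :: u) ∧ f = monomial F v * relator I (x :: u)

/-- The generators span modulo `J`: since the products of two elements of `I` lie in `J`, one
relator in each product suffices. -/
theorem monomial_mem_generators {J : Submodule F (FreeAlgebra F (Fin d))}
    (hJ : ∀ x, ∀ f ∈ J, FreeAlgebra.ι F x * f ∈ J) (hIJ : ∀ f ∈ I, ∀ g ∈ I, f * g ∈ J)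
    (h1 : (1 : FreeAlgebra F (Fin d)) ∉ I) (w : List (Fin d)) :
    monomial F w ∈ Submodule.span F {f | IsGenerator I w f} ⊔ J := by
  induction w with
  | nil =>
    exact Submodule.mem_sup_left (Submodule.subset_span
      (Or.inl ⟨[], List.Perm.refl _, isNormal_nil h1, rfl⟩))
  | cons x w ih =>
    have key : ∀ f ∈ Submodule.span F {f | IsGenerator I w f} ⊔ J, FreeAlgebra.ι F x * f ∈
        Submodule.span F {f | IsGenerator I (x :: w) f} ⊔ J := by
      intro f hf
      obtain ⟨s, hs, j, hj, rfl⟩ := Submodule.mem_sup.1 hf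
      rw [mul_add]
      refine add_mem ?_ (Submodule.mem_sup_right (hJ x j hj))
      clear hf
      induction hs using Submodule.span_induction with
      | mem s hs =>
        rcases hs with ⟨t, htw, ht, rfl⟩ | ⟨v, y, u, hperm, hv, hu, hyu, rfl⟩
        · rw [← monomial_cons]
          by_cases hn : IsNormal I (x :: t)
          · exact Submodule.mem_sup_left (Submodule.subset_span
              (Or.inl ⟨x :: t, htw.cons x, hn, rfl⟩))
          · rw [← sub_add_cancel (monomial F (x :: t)) (relator I (x :: t))]
            -- A word `x t` that is not normal is the generator with `v` empty plus its normal form.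
            refine Submodule.mem_sup_left (add_mem ?_ (Submodule.subset_span (Or.inr
              ⟨[], x, t, htw.cons x, isNormal_nil h1, ht, hn, by rw [monomial_nil, one_mul]⟩)))
            refine Submodule.span_mono ?_ (monomial_sub_relator_mem I (x :: t))
            rintro _ ⟨t', ht', hn', rfl⟩
            exact Or.inl ⟨t', ht'.trans (htw.cons x), hn', rfl⟩
        -- The product of the two relators is an identity of `UT₂`, so that `x v` may be replaced by
        -- its normal form.
        · rw [← mul_assoc, ← monomial_cons,
            ← sub_add_cancel (monomial F (x :: v)) (relator I (x :: v)), add_mul]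
          refine add_mem (Submodule.mem_sup_left ?_) (Submodule.mem_sup_right
            (hIJ _ (relator_mem I _) _ (relator_mem I _)))
          have hr := monomial_sub_relator_mem I (x :: v)
          generalize monomial F (x :: v) - relator I (x :: v) = r at hr
          induction hr using Submodule.span_induction with
          | mem r hr =>
            obtain ⟨v', hv', hn', rfl⟩ := hr
            refine Submodule.subset_span (Or.inr ⟨v', y, u, ?_, hn', hu, hyu, rfl⟩)
            exact (hv'.append_right _).trans (hperm.cons x)
          | zero => rw [zero_mul]; exact zero_mem _
          | add r r' _ _ hr hr' => rw [add_mul]; exact add_mem hr hr'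
          | smul c r _ hr => rw [smul_mul_assoc]; exact Submodule.smul_mem _ _ hr
      | zero => rw [mul_zero]; exact zero_mem _
      | add s s' _ _ hs hs' => rw [mul_add]; exact add_mem hs hs'
      | smul c s _ hs => rw [mul_smul_comm]; exact Submodule.smul_mem _ _ hs
    rw [monomial_cons]
    exact key _ ih

theorem IsGenerator.mem_rearrangements {z : List (Fin d)} {f : FreeAlgebra F (Fin d)}
    (h : IsGenerator I z f) : f ∈ rearrangements F z fun _ => True := by
  rcases h with ⟨w, hw, -, rfl⟩ | ⟨v, x, u, hperm, -, -, -, rfl⟩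
  · exact monomial_mem_rearrangements F hw trivial
  · exact rearrangements_mono F hperm (fun _ _ _ => trivial)
      (monomial_mul_mem_rearrangements F (relator_mem_rearrangements I _) v)

end

/-! ### Counting normal words -/

/-- The content of a word: the number of occurrences of the letters. -/
def content {d : ℕ} (w : List (Fin d)) : Fin d →₀ ℕ :=
  Finsupp.equivFunOnFinite.symm fun k => w.count k

theorem content_apply {d : ℕ} (w : List (Fin d)) (k : Fin d) : content w k = w.count k := rfl

theorem content_nil {d : ℕ} : content ([] : List (Fin d)) = 0 := by
  ext k
  simp [content_apply]

theorem content_cons {d : ℕ} (k : Fin d) (w : List (Fin d)) :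
    content (k :: w) = Finsupp.single k 1 + content w := by
  ext j
  rw [content_apply, congrFun (count_cons_eq k w) j, Finsupp.add_apply, content_apply, add_comm,
    Finsupp.single_apply]
  simp only [eq_comm]

theorem content_append {d : ℕ} (v w : List (Fin d)) : content (v ++ w) = content v + content w := by
  ext j
  rw [content_apply, List.count_append]
  rfl

theorem content_eq_iff {d : ℕ} {v w : List (Fin d)} : content v = content w ↔ v.Perm w := by
  rw [List.perm_iff_count, Finsupp.ext_iff]
  rfl

section

variable {F : Type*} [Field F] {d : ℕ} (I : Submodule F (FreeAlgebra F (Fin d)))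

theorem finite_normal_content (β : Fin d →₀ ℕ) :
    {w : List (Fin d) | content w = β ∧ IsNormal I w}.Finite := by
  obtain ⟨z, hz⟩ := exists_list_count β
  refine (finite_perm z).subset fun w hw => content_eq_iff.1 ?_
  rw [hw.1]
  exact Finsupp.ext fun k => (hz k).symm

/-- The normal words of a given content. -/
def normals (β : Fin d →₀ ℕ) : Finset (List (Fin d)) := (finite_normal_content I β).toFinset

variable {I}

theorem mem_normals {β : Fin d →₀ ℕ} {w : List (Fin d)} :
    w ∈ normals I β ↔ content w = β ∧ IsNormal I w := by simp [normals]

variable (I)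

open Classical in
/-- The pairs of normal words of a given total content. -/
def normalPairs (α : Fin d →₀ ℕ) : Finset (List (Fin d) × List (Fin d)) :=
  (Finset.HasAntidiagonal.antidiagonal α).biUnion fun p => normals I p.1 ×ˢ normals I p.2

open Classical in
theorem card_normalPairs (α : Fin d →₀ ℕ) : (normalPairs I α).card =
    ∑ p ∈ Finset.HasAntidiagonal.antidiagonal α, (normals I p.1).card * (normals I p.2).card := by
  rw [normalPairs, Finset.card_biUnion]
  · simp only [Finset.card_product]
  · intro p _ p' _ hpp
    rw [Function.onFun, Finset.disjoint_left]
    rintro ⟨v, w⟩ h h'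
    rw [Finset.mem_product, mem_normals, mem_normals] at h h'
    exact hpp (Prod.ext (h.1.1.symm.trans h'.1.1) (h.2.1.symm.trans h'.2.1))

open Classical in
/-- The triples of a normal word, a letter and a normal word of a given total content. -/
def normalTriples (α : Fin d →₀ ℕ) : Finset (Σ _ : Fin d, List (Fin d) × List (Fin d)) :=
  Finset.univ.sigma fun x => if α x = 0 then ∅ else normalPairs I (α - Finsupp.single x 1)

variable {I}

theorem mem_normalPairs {α : Fin d →₀ ℕ} {v w : List (Fin d)} :
    (v, w) ∈ normalPairs I α ↔ IsNormal I v ∧ IsNormal I w ∧ content v + content w = α := by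
  classical
  simp only [normalPairs, Finset.mem_biUnion, Finset.HasAntidiagonal.mem_antidiagonal,
    Finset.mem_product,
    mem_normals, Prod.exists]
  constructor
  · rintro ⟨β, γ, rfl, ⟨rfl, hv⟩, rfl, hw⟩
    exact ⟨hv, hw, rfl⟩
  · rintro ⟨hv, hw, rfl⟩
    exact ⟨_, _, rfl, ⟨rfl, hv⟩, rfl, hw⟩

theorem mem_normalTriples {α : Fin d →₀ ℕ} {x : Fin d} {v u : List (Fin d)} :
    (⟨x, v, u⟩ : Σ _ : Fin d, List (Fin d) × List (Fin d)) ∈ normalTriples I α ↔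
      IsNormal I v ∧ IsNormal I u ∧ content (v ++ x :: u) = α := by
  rw [normalTriples, Finset.mem_sigma, content_append, content_cons]
  simp only [Finset.mem_univ, true_and]
  split_ifs with h
  · simp only [Finset.notMem_empty, false_iff]
    rintro ⟨-, -, h1⟩
    have := DFunLike.congr_fun h1 x
    simp only [Finsupp.add_apply, Finsupp.single_eq_same] at this
    omega
  · rw [mem_normalPairs]
    refine and_congr_right fun _ => and_congr_right fun _ => ?_
    have hle : Finsupp.single x 1 ≤ α := by
      rw [Finsupp.single_le_iff]
      omega
    rw [eq_tsub_iff_add_eq_of_le hle, add_assoc, add_comm (Finsupp.single x 1)]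

open Classical in
/-- The number of triples `(v, x, u)` with `v`, `u` normal and `x u` not normal. -/
theorem card_filter_normalTriples (hI : ∀ x, ∀ f ∈ I, FreeAlgebra.ι F x * f ∈ I)
    (h1 : (1 : FreeAlgebra F (Fin d)) ∉ I) (α : Fin d →₀ ℕ) :
    ((normalTriples I α).filter fun t => ¬ IsNormal I (t.1 :: t.2.2)).card +
      (normalPairs I α).card = (normalTriples I α).card + (normals I α).card := by
  -- The triples with `x u` normal are the pairs of normal words whose second word is not empty.
  have e1 := Finset.card_filter_add_card_filter_not (s := normalTriples I α)
    (fun t => IsNormal I (t.1 :: t.2.2))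
  have e2 := Finset.card_filter_add_card_filter_not (s := normalPairs I α) (fun t => t.2 = [])
  have e3 : ((normalPairs I α).filter fun t => t.2 = []).card = (normals I α).card := by
    symm
    refine Finset.card_bij (fun w _ => (w, [])) ?_ ?_ ?_
    · intro w hw
      rw [mem_normals] at hw
      rw [Finset.mem_filter, mem_normalPairs]
      exact ⟨⟨hw.2, isNormal_nil h1, by rw [content_nil, add_zero, hw.1]⟩, rfl⟩
    · intro w _ w' _ h
      exact congrArg Prod.fst h
    · rintro ⟨v, w⟩ h
      rw [Finset.mem_filter, mem_normalPairs] at h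
      obtain ⟨⟨hv, -, hc⟩, hw⟩ := h
      simp only at hw
      subst hw
      rw [content_nil, add_zero] at hc
      exact ⟨v, mem_normals.2 ⟨hc, hv⟩, rfl⟩
  have e4 : ((normalPairs I α).filter fun t => ¬ t.2 = []).card =
      ((normalTriples I α).filter fun t => IsNormal I (t.1 :: t.2.2)).card := by
    symm
    refine Finset.card_bij (fun t _ => (t.2.1, t.1 :: t.2.2)) ?_ ?_ ?_
    · rintro ⟨x, v, u⟩ h
      rw [Finset.mem_filter, mem_normalTriples] at h
      rw [Finset.mem_filter, mem_normalPairs]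
      exact ⟨⟨h.1.1, h.2, by rw [← content_append]; exact h.1.2.2⟩, List.cons_ne_nil _ _⟩
    · rintro ⟨x, v, u⟩ _ ⟨x', v', u'⟩ _ h
      simp only [Prod.mk.injEq, List.cons.injEq] at h
      obtain ⟨rfl, rfl, rfl⟩ := h
      rfl
    · rintro ⟨v, w⟩ h
      rw [Finset.mem_filter, mem_normalPairs] at h
      obtain ⟨⟨hv, hw, hc⟩, hne⟩ := h
      obtain ⟨x, u, rfl⟩ := List.exists_cons_of_ne_nil hne
      refine ⟨⟨x, v, u⟩, ?_, rfl⟩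
      rw [Finset.mem_filter, mem_normalTriples, content_append]
      exact ⟨⟨hv, IsNormal.tail hI hw, hc⟩, hw⟩
  omega

theorem card_normalTriples (α : Fin d →₀ ℕ) : (normalTriples I α).card =
    ∑ x, if α x = 0 then 0 else (normalPairs I (α - Finsupp.single x 1)).card := by
  rw [normalTriples, Finset.card_sigma]
  refine Finset.sum_congr rfl fun x _ => ?_
  split_ifs <;> simp

end

/-! ### The dimensions of the components of the relatively free algebra of `UT₂(E)` -/

theorem one_notMem_identities {F X : Type*} [Field F] :
    (1 : FreeAlgebra F X) ∉ identities F (Grassmann F) X := by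
  intro h
  have h1 := mem_identities.1 h (FreeAlgebra.lift F fun _ => 0)
  rw [map_one] at h1
  exact one_ne_zero h1

section

variable {F : Type*} [Field F] [CharZero F] {d : ℕ}

theorem mem_identities_of_mem_rearrangements {φ : Fin d → ℕ} (hφ : Function.Injective φ)
    (z : List (Fin d)) : ∀ f ∈ rearrangements F z (fun _ => True), (theta F φ).toLinearMap f = 0 →
      f ∈ identities F (Grassmann F) (Fin d) := by
  intro f hf h0
  rw [rearrangements_eq F (α := content z) fun _ => rfl] at hf
  exact mem_identities_of_theta_eq_zero hφ hf h0

theorem card_normals {φ : Fin d → ℕ} (hφ : Function.Injective φ) (β : Fin d →₀ ℕ) :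
    (normals (identities F (Grassmann F) (Fin d)) β).card =
      Module.finrank F ((multihomogeneous F d β).map (theta F φ).toLinearMap) := by
  obtain ⟨z, hz⟩ := exists_list_count β
  have hzβ : content z = β := Finsupp.ext hz
  rw [← rearrangements_eq F hz, finrank_map_eq_card_normal z _
    (mem_identities_of_mem_rearrangements hφ z) fun f hf => theta_eq_zero_of_mem_identities φ hf,
    ← Nat.card_eq_finsetCard]
  refine Nat.card_congr (Equiv.subtypeEquivRight fun w => ?_)
  rw [mem_normals, ← hzβ, content_eq_iff]

open Classical in
/-- The generators of the component of multidegree `α` of the relatively free algebra of `UT₂(E)`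
are linearly independent modulo the identities of `UT₂(E)`. -/
theorem linearIndependent_generators (α : Fin d →₀ ℕ) :
    LinearIndependent F (Sum.elim
      (fun w : normals (identities F (Grassmann F) (Fin d)) α =>
        (identities F (UT2 F (Grassmann F)) (Fin d)).mkQ (monomial F w.1))
      (fun t : (normalTriples (identities F (Grassmann F) (Fin d)) α).filter
          fun t => ¬ IsNormal (identities F (Grassmann F) (Fin d)) (t.1 :: t.2.2) =>
        (identities F (UT2 F (Grassmann F)) (Fin d)).mkQ (monomial F t.1.2.1 *
          relator (identities F (Grassmann F) (Fin d)) (t.1.1 :: t.1.2.2)))) := by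
  set I := identities F (Grassmann F) (Fin d) with hIdef
  set J := identities F (UT2 F (Grassmann F)) (Fin d) with hJdef
  have hI : ∀ x, ∀ f ∈ I, FreeAlgebra.ι F x * f ∈ I := fun x f hf => mul_mem_identities _ hf
  let φ : Fin d → ℕ := fun k => k
  let ψ : Fin d → ℕ := fun k => d + k
  have hφ : Function.Injective φ := fun i j h => Fin.ext h
  have hψ : Function.Injective ψ := fun i j h => Fin.ext (by simpa [ψ] using h)
  have hφψ : ∀ i j, φ i ≠ ψ j := fun i j h => by
    have := i.2
    simp only [φ, ψ] at h
    omega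
  rw [Fintype.linearIndependent_iff]
  intro a ha
  rw [Fintype.sum_sum_type] at ha
  simp only [Sum.elim_inl, Sum.elim_inr, ← map_smul, ← map_sum, ← map_add] at ha
  rw [Submodule.mkQ_apply, Submodule.Quotient.mk_eq_zero] at ha
  -- On the diagonal, the relators vanish and the normal words are independent.
  have ha1 : ∀ w, a (Sum.inl w) = 0 := by
    intro w₀
    obtain ⟨hw₀, hn₀⟩ := mem_normals.1 w₀.2
    obtain ⟨l, hl⟩ := exists_normal_dual hn₀ (theta F φ).toLinearMap
      (mem_identities_of_mem_rearrangements hφ w₀.1)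
    have h0 := congrArg l (theta_eq_zero_of_mem_identities φ (identities_UT2_le F _ _ ha))
    have h2 : ∀ t : (normalTriples I α).filter fun t => ¬ IsNormal I (t.1 :: t.2.2),
        theta F φ (monomial F t.1.2.1 * relator I (t.1.1 :: t.1.2.2)) = 0 := fun t => by
      rw [map_mul, theta_eq_zero_of_mem_identities φ (relator_mem I _), mul_zero]
    rw [map_add, map_sum, map_sum] at h0
    simp only [map_smul, h2, smul_zero, Finset.sum_const_zero, add_zero, map_sum, map_zero] at h0
    rw [Finset.sum_eq_single w₀] at h0
    · have h3 := hl w₀.1 (List.Perm.refl _) hn₀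
      rw [if_pos rfl, AlgHom.toLinearMap_apply] at h3
      rwa [h3, smul_eq_mul, mul_one] at h0
    · intro w _ hne
      obtain ⟨hw, hn⟩ := mem_normals.1 w.2
      have h3 := hl w.1 (content_eq_iff.1 (hw.trans hw₀.symm)) hn
      rw [if_neg fun h => hne (Subtype.ext h), AlgHom.toLinearMap_apply] at h3
      rw [h3, smul_zero]
    · intro h
      exact absurd (Finset.mem_univ _) h
  simp only [ha1, zero_smul, Finset.sum_const_zero, zero_add] at ha
  rintro (w | t₀)
  · exact ha1 w
  obtain ⟨⟨x₀, v₀, u₀⟩, ht₀⟩ := t₀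
  obtain ⟨htm, hxu₀⟩ := Finset.mem_filter.1 ht₀
  obtain ⟨hv₀, hu₀, hc₀⟩ := mem_normalTriples.1 htm
  obtain ⟨l₁, hl₁⟩ := exists_normal_dual hv₀ (theta F φ).toLinearMap
    (mem_identities_of_mem_rearrangements hφ v₀)
  obtain ⟨l₂, hl₂⟩ := exists_normal_dual hu₀ (theta F ψ).toLinearMap
    (mem_identities_of_mem_rearrangements hψ u₀)
  -- The upper right entries, read off by dual functionals in disjoint generators of `E`.
  have h0 := ofWords_splitSum_eq_zero x₀ v₀ u₀ l₁ l₂ hφψ ha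
  set p : List (Fin d) → F := fun v => if v.Perm v₀ then l₁ (theta F φ (monomial F v)) else 0
  set q : List (Fin d) → F := fun u => if u.Perm u₀ then l₂ (theta F ψ (monomial F u)) else 0
  have hp : ∀ w, IsNormal I w → p w = if w = v₀ then 1 else 0 := by
    intro w hw
    by_cases h : w.Perm v₀
    · simp only [p, if_pos h]
      exact hl₁ w h hw
    · simp only [p, if_neg h]
      rw [if_neg]
      rintro rfl
      exact h (List.Perm.refl _)
  have hq : ∀ w, IsNormal I w → q w = if w = u₀ then 1 else 0 := by
    intro w hw
    by_cases h : w.Perm u₀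
    · simp only [q, if_pos h]
      exact hl₂ w h hw
    · simp only [q, if_neg h]
      rw [if_neg]
      rintro rfl
      exact h (List.Perm.refl _)
  have hqI : ∀ w, ∀ g ∈ I, g ∈ rearrangements F w (fun _ => True) → ofWords q g = 0 := by
    intro w g hgI hg
    by_cases h : w.Perm u₀
    · have h1 : ofWords q g = (l₂ ∘ₗ (theta F ψ).toLinearMap) g := by
        refine LinearMap.eqOn_span ?_ hg
        rintro _ ⟨w', hw', -, rfl⟩
        rw [ofWords_monomial]
        exact if_pos (hw'.trans h)
      rw [h1, LinearMap.comp_apply, AlgHom.toLinearMap_apply,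
        theta_eq_zero_of_mem_identities ψ hgI, map_zero]
    · have h1 : ofWords q g = (0 : FreeAlgebra F (Fin d) →ₗ[F] F) g := by
        refine LinearMap.eqOn_span ?_ hg
        rintro _ ⟨w', hw', -, rfl⟩
        rw [ofWords_monomial]
        exact if_neg fun h' => h (hw'.symm.trans h')
      rw [h1, LinearMap.zero_apply]
  simp only [map_sum, map_smul] at h0
  rw [Finset.sum_eq_single ⟨⟨x₀, v₀, u₀⟩, ht₀⟩] at h0
  · rw [ofWords_splitSum_relator hI hxu₀ hp hq hqI hv₀ hu₀, if_pos ⟨rfl, rfl, rfl⟩, smul_eq_mul,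
      mul_one] at h0
    exact h0
  · rintro ⟨⟨x, v, u⟩, ht⟩ _ hne
    obtain ⟨hv, hu, -⟩ := mem_normalTriples.1 (Finset.mem_filter.1 ht).1
    rw [ofWords_splitSum_relator hI hxu₀ hp hq hqI hv hu, if_neg, smul_zero]
    rintro ⟨rfl, rfl, rfl⟩
    exact hne rfl
  · intro h
    exact absurd (Finset.mem_univ _) h

open Classical in
theorem finrank_identities_UT2 (α : Fin d →₀ ℕ) :
    Module.finrank F ((multihomogeneous F d α).map
      (identities F (UT2 F (Grassmann F)) (Fin d)).mkQ) =
      (normals (identities F (Grassmann F) (Fin d)) α).card +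
        ((normalTriples (identities F (Grassmann F) (Fin d)) α).filter
          fun t => ¬ IsNormal (identities F (Grassmann F) (Fin d)) (t.1 :: t.2.2)).card := by
  have hli := linearIndependent_generators (F := F) α
  set I := identities F (Grassmann F) (Fin d) with hIdef
  set J := identities F (UT2 F (Grassmann F)) (Fin d) with hJdef
  rw [← Fintype.card_coe, ← Fintype.card_coe, ← Fintype.card_sum, ← finrank_span_eq_card hli]
  refine congrArg (fun S : Submodule F (FreeAlgebra F (Fin d) ⧸ J) => Module.finrank F S) ?_
  have hgen : ∀ z : List (Fin d), content z = α → ∀ f, IsGenerator I z f → J.mkQ f ∈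
      Submodule.span F (Set.range (Sum.elim
        (fun w : normals I α => J.mkQ (monomial F w.1))
        (fun t : (normalTriples I α).filter fun t => ¬ IsNormal I (t.1 :: t.2.2) =>
          J.mkQ (monomial F t.1.2.1 * relator I (t.1.1 :: t.1.2.2))))) := by
    intro z hz f hf
    rcases hf with ⟨w, hw, hn, rfl⟩ | ⟨v, x, u, hperm, hv, hu, hxu, rfl⟩
    · exact Submodule.subset_span ⟨Sum.inl ⟨w, mem_normals.2
        ⟨(content_eq_iff.2 hw).trans hz, hn⟩⟩, rfl⟩
    · exact Submodule.subset_span ⟨Sum.inr ⟨⟨x, v, u⟩, Finset.mem_filter.2 ⟨mem_normalTriples.2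
        ⟨hv, hu, (content_eq_iff.2 hperm).trans hz⟩, hxu⟩⟩, rfl⟩
  apply le_antisymm
  · rw [multihomogeneous, Submodule.map_span, Submodule.span_le]
    rintro _ ⟨_, ⟨w, hw, rfl⟩, rfl⟩
    have h1 := monomial_mem_generators (I := I) (J := J) (fun x f hf => mul_mem_identities _ hf)
      (fun f hf g hg => mul_mem_identities_UT2 hf hg) one_notMem_identities w
    obtain ⟨s, hs, j, hj, hsj⟩ := Submodule.mem_sup.1 h1
    have h2 : J.mkQ j = 0 := by
      rw [Submodule.mkQ_apply, Submodule.Quotient.mk_eq_zero]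
      exact hj
    rw [SetLike.mem_coe, ← hsj, map_add, h2, add_zero]
    have h3 : J.mkQ s ∈ (Submodule.span F {f | IsGenerator I w f}).map J.mkQ := ⟨s, hs, rfl⟩
    rw [Submodule.map_span] at h3
    refine Submodule.span_le.2 ?_ h3
    rintro _ ⟨f, hf, rfl⟩
    exact hgen w (Finsupp.ext hw) f hf
  · rw [Submodule.span_le]
    have hmem : ∀ z : List (Fin d), content z = α → ∀ f, IsGenerator I z f →
        J.mkQ f ∈ (multihomogeneous F d α).map J.mkQ := by
      intro z hz f hf
      refine ⟨f, ?_, rfl⟩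
      have := hf.mem_rearrangements
      rwa [rearrangements_eq F (α := α) fun k => by rw [← hz]; rfl] at this
    rintro _ ⟨w | t, rfl⟩
    · obtain ⟨hw, hn⟩ := mem_normals.1 w.2
      exact hmem w.1 hw _ (Or.inl ⟨w.1, List.Perm.refl _, hn, rfl⟩)
    · obtain ⟨⟨x, v, u⟩, ht⟩ := t
      obtain ⟨htm, hxu⟩ := Finset.mem_filter.1 ht
      obtain ⟨hv, hu, hc⟩ := mem_normalTriples.1 htm
      exact hmem _ hc _ (Or.inr ⟨v, x, u, List.Perm.refl _, hv, hu, hxu, rfl⟩)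

end

/-! ### The Hilbert series of `UT₂(E)` -/

theorem sum_antidiagonal_prod {d : ℕ} (α : Fin d →₀ ℕ) (s t : ℕ → ℤ) :
    ∑ p ∈ Finset.HasAntidiagonal.antidiagonal α, (∏ k, s (p.1 k)) * ∏ k, t (p.2 k) =
      ∏ k, ∑ p ∈ Finset.HasAntidiagonal.antidiagonal (α k), s p.1 * t p.2 := by
  rw [Finset.prod_univ_sum]
  refine Finset.sum_bij' (fun p _ k => (p.1 k, p.2 k))
    (fun f _ => (Finsupp.equivFunOnFinite.symm fun k => (f k).1,
      Finsupp.equivFunOnFinite.symm fun k => (f k).2)) ?_ ?_ ?_ ?_ ?_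
  · intro p hp
    rw [Fintype.mem_piFinset]
    intro k
    rw [Finset.HasAntidiagonal.mem_antidiagonal] at hp ⊢
    rw [← hp]
    rfl
  · intro f hf
    rw [Fintype.mem_piFinset] at hf
    rw [Finset.HasAntidiagonal.mem_antidiagonal]
    ext k
    exact Finset.HasAntidiagonal.mem_antidiagonal.1 (hf k)
  · intro p _
    exact Prod.ext (Finsupp.ext fun _ => rfl) (Finsupp.ext fun _ => rfl)
  · intro f _
    rfl
  · intro p _
    rw [← Finset.prod_mul_distrib]

theorem sum_antidiagonal_seriesP (n : ℕ) :
    ∑ p ∈ Finset.HasAntidiagonal.antidiagonal n, seriesP p.1 * seriesP p.2 = seriesPSq n := by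
  rw [Finset.Nat.sum_antidiagonal_eq_sum_range_succ fun i j => seriesP i * seriesP j]
  rcases n with _ | n
  · simp [seriesP, seriesPSq]
  · rw [Finset.sum_range_succ, Finset.sum_range_succ']
    have h : ∑ k ∈ Finset.range n, seriesP (k + 1) * seriesP (n + 1 - (k + 1)) =
        ∑ k ∈ Finset.range n, (4 : ℤ) := by
      refine Finset.sum_congr rfl fun k hk => ?_
      have := Finset.mem_range.1 hk
      rw [seriesP, seriesP, if_neg (by omega), if_neg (by omega)]
      norm_num
    rw [h]
    simp [seriesP, seriesPSq]
    ring

theorem sum_antidiagonal_ite_zero {d : ℕ} (α : Fin d →₀ ℕ) (f : (Fin d →₀ ℕ) → ℤ) :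
    ∑ p ∈ Finset.HasAntidiagonal.antidiagonal α, (if ∀ k, p.1 k = 0 then 1 else 0) * f p.2 =
      f α := by
  rw [Finset.sum_eq_single (0, α)]
  · simp
  · rintro ⟨β, γ⟩ hp hne
    rw [Finset.HasAntidiagonal.mem_antidiagonal] at hp
    rw [if_neg, zero_mul]
    intro h
    have hβ : β = 0 := Finsupp.ext h
    rw [hβ, zero_add] at hp
    exact hne (by rw [hβ]; simp only at hp; rw [hp])
  · intro h
    exact absurd (by simp) h

/-- The convolution square of the Hilbert series of the Grassmann algebra. -/
theorem four_mul_sum_antidiagonal {d : ℕ} (h : (Fin d →₀ ℕ) → ℕ)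
    (hh : ∀ β : Fin d →₀ ℕ, 2 * (h β : ℤ) =
      (if ∀ k, β k = 0 then 1 else 0) + ∏ k, seriesP (β k)) (α : Fin d →₀ ℕ) :
    4 * ((∑ p ∈ Finset.HasAntidiagonal.antidiagonal α, h p.1 * h p.2 : ℕ) : ℤ) =
      (if ∀ k, α k = 0 then 1 else 0) + 2 * ∏ k, seriesP (α k) + ∏ k, seriesPSq (α k) := by
  have h1 : 4 * ((∑ p ∈ Finset.HasAntidiagonal.antidiagonal α, h p.1 * h p.2 : ℕ) : ℤ) =
      ∑ p ∈ Finset.HasAntidiagonal.antidiagonal α, (2 * (h p.1 : ℤ)) * (2 * (h p.2 : ℤ)) := by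
    push_cast
    rw [Finset.mul_sum]
    exact Finset.sum_congr rfl fun p _ => by ring
  have h2 : ∑ p ∈ Finset.HasAntidiagonal.antidiagonal α,
      (∏ k, seriesP (p.1 k)) * ∏ k, seriesP (p.2 k) =
      ∏ k, seriesPSq (α k) := by
    rw [sum_antidiagonal_prod]
    exact Finset.prod_congr rfl fun k _ => sum_antidiagonal_seriesP _
  have h3 := sum_antidiagonal_ite_zero α fun β => ∏ k, seriesP (β k)
  have h4 := sum_antidiagonal_ite_zero α fun β => if ∀ k, β k = 0 then 1 else 0
  have h5 : ∑ p ∈ Finset.HasAntidiagonal.antidiagonal α, (∏ k, seriesP (p.1 k)) *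
      (if ∀ k, p.2 k = 0 then (1 : ℤ) else 0) = ∏ k, seriesP (α k) := by
    rw [← h3]
    refine Finset.sum_equiv (Equiv.prodComm _ _) (fun p => ?_) fun p _ => mul_comm _ _
    rw [Finset.HasAntidiagonal.mem_antidiagonal, Finset.HasAntidiagonal.mem_antidiagonal,
      add_comm]
    rfl
  rw [h1]
  simp only [hh, add_mul, mul_add, Finset.sum_add_distrib]
  rw [h2, h3, h4, h5]
  ring

theorem four_mul_finrank_identities_UT2 (F : Type*) [Field F] [CharZero F] {d : ℕ}
    (α : Fin d →₀ ℕ) :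
    4 * (Module.finrank F ((multihomogeneous F d α).map
      (identities F (UT2 F (Grassmann F)) (Fin d)).mkQ) : ℤ) =
      3 * (if ∀ k, α k = 0 then 1 else 0) + 2 * ∏ k, seriesP (α k) - ∏ k, seriesPSq (α k) +
      ∑ x, if α x = 0 then 0 else
        ((if ∀ k, α k - (if k = x then 1 else 0) = 0 then 1 else 0) +
          2 * ∏ k, seriesP (α k - if k = x then 1 else 0) +
          ∏ k, seriesPSq (α k - if k = x then 1 else 0)) := by
  classical
  set I := identities F (Grassmann F) (Fin d) with hIdef
  have hh : ∀ β : Fin d →₀ ℕ, 2 * ((normals I β).card : ℤ) =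
      (if ∀ k, β k = 0 then 1 else 0) + ∏ k, seriesP (β k) := by
    intro β
    have hφ : Function.Injective fun k : Fin d => (k : ℕ) := fun i j h => Fin.ext h
    rw [hIdef, card_normals hφ, two_mul_finrank_map_theta F hφ]
  have hpairs : ∀ β : Fin d →₀ ℕ, 4 * ((normalPairs I β).card : ℤ) =
      (if ∀ k, β k = 0 then 1 else 0) + 2 * ∏ k, seriesP (β k) + ∏ k, seriesPSq (β k) := by
    intro β
    rw [card_normalPairs, four_mul_sum_antidiagonal (fun β => (normals I β).card) hh]
  have htriples : 4 * ((normalTriples I α).card : ℤ) = ∑ x, if α x = 0 then 0 else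
        ((if ∀ k, α k - (if k = x then 1 else 0) = 0 then 1 else 0) +
          2 * ∏ k, seriesP (α k - if k = x then 1 else 0) +
          ∏ k, seriesPSq (α k - if k = x then 1 else 0)) := by
    rw [card_normalTriples]
    rw [Nat.cast_sum, Finset.mul_sum]
    refine Finset.sum_congr rfl fun x _ => ?_
    by_cases hx : α x = 0
    · rw [if_pos hx, if_pos hx, Nat.cast_zero, mul_zero]
    · rw [if_neg hx, if_neg hx]
      have hsub : ∀ k, (α - Finsupp.single x 1 : Fin d →₀ ℕ) k = α k - if k = x then 1 else 0 := by
        intro k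
        rw [Finsupp.tsub_apply, Finsupp.single_apply]
        simp only [eq_comm]
      have := hpairs (α - Finsupp.single x 1)
      simp only [hsub] at this
      exact this
  have hcard := card_filter_normalTriples (I := I) (fun x f hf => mul_mem_identities _ hf)
    one_notMem_identities α
  rw [finrank_identities_UT2, ← htriples]
  have h1 := hh α
  have h2 := hpairs α
  push_cast
  zify at hcard
  linarith

/-! ### Comparison with the Schur functions -/

theorem finrank_identities_UT2_eq_sum (F : Type*) [Field F] [CharZero F] {d : ℕ}
    (α : Fin d →₀ ℕ) :
    Module.finrank F ((multihomogeneous F d α).map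
      (identities F (UT2 F (Grassmann F)) (Fin d)).mkQ) =
      ∑ μ ∈ partitions (∑ k, α k), mult μ * kostka d μ α := by
  have h1 := four_mul_finrank_identities_UT2 F α
  rw [← four_mul_schurSum_mult d α, schurSum] at h1
  have h2 := mul_left_cancel₀ (by norm_num : (4 : ℤ) ≠ 0) h1
  exact_mod_cast h2

theorem hasSum_hilbertSeries_UT2 (F : Type*) [Field F] [CharZero F] (d : ℕ) :
    HasSum (fun μ : YoungDiagram => mult μ • schur d μ)
      (hilbertSeries F (UT2 F (Grassmann F)) d) := by
  refine Pi.hasSum.2 fun α => ?_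
  have h : hilbertSeries F (UT2 F (Grassmann F)) d α =
      ∑ μ ∈ partitions (∑ k, α k), (mult μ • schur d μ) α := by
    rw [hilbertSeries, finrank_identities_UT2_eq_sum, Nat.cast_sum]
    refine Finset.sum_congr rfl fun μ _ => ?_
    rw [Nat.cast_mul, ← nsmul_eq_mul]
    rfl
  rw [h]
  refine hasSum_sum_of_ne_finset_zero fun μ hμ => ?_
  have h0 : schur d μ α = 0 :=
    Nat.cast_eq_zero.2 (kostka_eq_zero fun hc => hμ (mem_partitions.2 hc))
  change mult μ • schur d μ α = 0
  rw [h0, smul_zero]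

end PICochar

end

open PICochar

theorem proposition6p2 (F : Type*) [Field F] [CharZero F] :
    ∃ m : YoungDiagram → ℕ,
      -- the Hilbert series in any number of variables
      (∀ d : ℕ, HasSum (fun μ : YoungDiagram => m μ • schur d μ)
        (hilbertSeries F (UT2 F (Grassmann F)) d)) ∧
      -- the cocharacter sequence
      (∀ (n : ℕ) (σ : Equiv.Perm (Fin n)),
        cocharacter F (UT2 F (Grassmann F)) n σ =
          ∑ μ ∈ partitions n, (m μ : F) * irreducibleCharacter F n μ σ) ∧
      -- the shapes that occur
      (∀ μ : YoungDiagram, m μ ≠ 0 →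
        μ.rowLens = [] ∨
        (∃ k l : ℕ, μ.rowLens = k :: List.replicate l 1) ∨
        (∃ k₁ k₂ r l : ℕ, 2 ≤ k₂ ∧ k₂ ≤ k₁ ∧
          μ.rowLens = k₁ :: k₂ :: (List.replicate r 2 ++ List.replicate l 1)) ∨
        (∃ k₁ k₂ r l : ℕ, 3 ≤ k₂ ∧ k₂ ≤ k₁ ∧
          μ.rowLens = k₁ :: k₂ :: 3 :: (List.replicate r 2 ++ List.replicate l 1))) ∧
      -- the multiplicities of `(k₁, k₂, 2^r, 1^l)`
      (∀ (μ : YoungDiagram) (k₁ k₂ r l : ℕ), 3 ≤ k₂ → k₂ ≤ k₁ → 1 ≤ r →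
        μ.rowLens = k₁ :: k₂ :: (List.replicate r 2 ++ List.replicate l 1) →
        (m μ : ℤ) = 12 * ((k₁ : ℤ) - k₂ + 1) * (l + 1)) ∧
      (∀ (μ : YoungDiagram) (k₁ k₂ l : ℕ), 3 ≤ k₂ → k₂ ≤ k₁ →
        μ.rowLens = k₁ :: k₂ :: List.replicate l 1 →
        (m μ : ℤ) = 4 * ((k₁ : ℤ) - k₂ + 1) * (2 * l + 1)) ∧
      (∀ (μ : YoungDiagram) (k₁ r l : ℕ), 2 ≤ k₁ → 1 ≤ r →
        μ.rowLens = k₁ :: 2 :: (List.replicate r 2 ++ List.replicate l 1) →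
        (m μ : ℤ) = 8 * ((k₁ : ℤ) - 2) * (l + 1) + 4 * (l + 1)) ∧
      (∀ (μ : YoungDiagram) (k₁ l : ℕ), 2 ≤ k₁ →
        μ.rowLens = k₁ :: 2 :: List.replicate l 1 →
        (m μ : ℤ) = 3 * ((k₁ : ℤ) - 2) * (2 * l + 1) + 3 * l + 2) ∧
      (∀ (μ : YoungDiagram) (k₁ l : ℕ), 2 ≤ k₁ → 1 ≤ l →
        μ.rowLens = k₁ :: List.replicate l 1 →
        (m μ : ℤ) = ((k₁ : ℤ) - 2) * (2 * l - 1) + l + 1) ∧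
      (∀ (μ : YoungDiagram) (l : ℕ), μ.rowLens = List.replicate l 1 → m μ = 1) ∧
      (∀ (μ : YoungDiagram) (k : ℕ), μ.rowLens = [k] → m μ = 1) ∧
      -- the multiplicities of `(k₁, k₂, 3, 2^r, 1^l)`
      (∀ (μ : YoungDiagram) (k₁ k₂ r l : ℕ), 3 ≤ k₂ → k₂ ≤ k₁ →
        μ.rowLens = k₁ :: k₂ :: 3 :: (List.replicate r 2 ++ List.replicate l 1) →
        (m μ : ℤ) = 4 * ((k₁ : ℤ) - k₂ + 1) * (l + 1)) := by
  refine ⟨mult, hasSum_hilbertSeries_UT2 F, fun n σ => ?_, fun μ => shape_of_mult_ne_zero,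
    mult_values⟩
  refine cocharacter_eq_sum F _ mult n (fun α hα => ?_) σ
  rw [finrank_identities_UT2_eq_sum, hα]
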